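/- **Conventions.** Let $G$ be a finite group and $R=\mathbb Z$ or $R=\mathbb Z_p$ (the $p$-adic integers). An $R[G]$-lattice is an $R[G]$-module that is finitely generated and free over $R$; a $G$-lattice is a $\mathbb Z[G]$-lattice. It is *permutation* if it has an $R$-basis permuted by $G$ (the zero lattice is permutation). It is *faithful* if only $1\in G$ acts as the identity, and *indecomposable* if it is nonzero and not a direct sum of two nonzero sublattices stable under $G$. A $G$-lattice $F$ is *flabby* if $\widehat H^{-1}(H,F)=0$ (Tate cohomology) for every subgroup $H\le G$. A *flabby resolution* of a $G$-lattice $M$ is an exact sequence of $G$-lattices $0\to M\to P\to F\to 0$ with $P$ permutation and $F$ flabby; the flabby class $[M]^{fl}$ is the class of $F$ modulo adding permutation lattices. Let $Sy_p(G)$ be a Sylow $p$-subgroup of $G$. A *$p$-part* $\widetilde N_p$ of $[M]^{fl}$ is a $\mathbb Z_p[Sy_p(G)]$-lattice without nonzero permutation direct summands such that $(F\otimes_{\mathbb Z}\mathbb Z_p)|_{Sy_p(G)}\simeq \widetilde N_p\oplus\widetilde Q_p$ with $\widetilde Q_p$ permutation, for a flabby resolution as above. For a finite subgroup $G\le \mathrm{GL}(n,\mathbb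 Z)$, let $M_G=\bigoplus_{i=1}^n\mathbb Z u_i$ be the $G$-lattice on which $\sigma=[a_{i,j}]\in G$ acts by $u_i\mapsto\sum_j a_{i,j}u_j$ (this right action is read as a left action through inverses). Put $$a_1=\begin{pmatrix}-1&-1&-1\\0&0&1\\0&1&0\end{pmatrix},\ a_2=\begin{pmatrix}0&1&0\\1&0&0\\-1&-1&-1\end{pmatrix},\ w=\begin{pmatrix}0&1&0\\1&0&0\\0&0&1\end{pmatrix},\ c=\begin{pmatrix}0&1&0\\0&0&1\\1&0&0\end{pmatrix},$$ $$q=\begin{pmatrix}0&0&-1\\1&1&1\\0&-1&0\end{pmatrix},\ b_1=\begin{pmatrix}-1&0&0\\-1&0&1\\-1&1&0\end{pmatrix},\ b_2=\begin{pmatrix}0&1&-1\\1&0&-1\\0&0&-1\end{pmatrix},\ r=\begin{pmatrix}1&0&-1\\1&0&0\\1&-1&0\end{pmatrix}.$$ Up to conjugacy in $\mathrm{GL}(3,\mathbb Z)$, the groups $N_{3,i}$ $(1\le i\le 15)$ are $N_{3,1}=\langle a_1,a_2\rangle$, $N_{3,2}=\langle a_1,a_2,-1\rangle$, $N_{3,3}=\langle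 b_1,b_2,-1\rangle$, $N_{3,4}=\langle q,-1\rangle$, $N_{3,5}=\langle q,a_1\rangle$, $N_{3,6}=\langle -q,a_1\rangle$, $N_{3,7}=\langle q,a_1,-1\rangle$, $N_{3,8}=\langle a_1,a_2,c\rangle$, $N_{3,9}=\langle a_1,a_2,c,-1\rangle$, $N_{3,10}=\langle b_1,b_2,c,-1\rangle$, $N_{3,11}=\langle a_1,a_2,c,q\rangle$, $N_{3,12}=\langle b_1,b_2,c,r\rangle$, $N_{3,13}=\langle a_1,a_2,c,w\rangle$, $N_{3,14}=\langle a_1,a_2,c,q,-1\rangle$, $N_{3,15}=\langle b_1,b_2,c,r,-1\rangle$. **Theorem.** Let $G\le\mathrm{GL}(3,\mathbb Z)$ be conjugate in $\mathrm{GL}(3,\mathbb Z)$ to $N_{3,i}$, $1\le i\le 15$, and let $Sy_2(G)$ be a Sylow $2$-subgroup of $G$. Then $M_G$ has a flabby resolution, every flabby resolution of $M_G$ yields a $2$-part $\widetilde N_2$ of $[M_G]^{fl}$, and $\widetilde N_2$ is unique up to isomorphism of $\mathbb Z_2[Sy_2(G)]$-lattices, independently of the resolution. Moreover $\widetilde N_2$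 is a faithful and indecomposable $\mathbb Z_2[Sy_2(G)]$-lattice, and its $\mathbb Z_2$-rank is $5, 9, 11, 11, 7, 7, 11, 5, 9, 11, 7, 7, 7, 11, 11$ for $i=1,2,\dots,15$ respectively. -/

import Mathlib

open scoped TensorProduct

/-! ### Lattices over group rings, as representations on finite free modules -/

/-- `ρ` is an `R[G]`-lattice: the underlying `R`-module is finitely generated and free. -/
def IsLatticeRep {R G V : Type*} [CommRing R] [Group G] [AddCommGroup V] [Module R V]
    (_ρ : Representation R G V) : Prop :=
  Module.Finite R V ∧ Module.Free R V

/-- `ρ` is a permutation lattice: it has a finite `R`-basis that is permuted by `G`.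
The zero lattice (empty basis) is a permutation lattice. -/
def IsPermutationRep {R G V : Type*} [CommRing R] [Group G] [AddCommGroup V] [Module R V]
    (ρ : Representation R G V) : Prop :=
  ∃ (ι : Type) (_ : Finite ι) (b : Module.Basis ι R V), ∀ (g : G) (i : ι), ∃ j : ι, ρ g (b i) = b j

/-- `ρ` is indecomposable: it is nonzero, and it is not the direct sum of two nonzero
subrepresentations. -/
def IsIndecomposableRep {R G V : Type*} [CommRing R] [Group G] [AddCommGroup V] [Module R V]
    (ρ : Representation R G V) : Prop :=
  Nontrivial V ∧ ∀ W W' : Subrepresentation ρ, IsCompl W W' → W = ⊥ ∨ W' = ⊥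

/-- `ρ` contains no nonzero permutation lattice as a direct summand. -/
def HasNoPermutationSummand {R G V : Type*} [CommRing R] [Group G] [AddCommGroup V] [Module R V]
    (ρ : Representation R G V) : Prop :=
  ∀ W W' : Subrepresentation ρ, IsCompl W W' → IsPermutationRep W.toRepresentation → W = ⊥

/-- `ρ` is flabby: the Tate cohomology `Ĥ⁻¹(H, V)` vanishes for every (finite) subgroup `H` of
the group `G` (which is finite in all uses). -/
def IsFlabbyRep {G V : Type} [Group G] [AddCommGroup V] (ρ : Representation ℤ G V) : Prop :=
  ∀ (H : Subgroup G) [Fintype H],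
    Subsingleton (tateCohomology (Rep.of (ρ.comp H.subtype)) (-1))

/-- A flabby resolution `0 → M → P → F → 0` of a `G`-lattice `M`: a short exact sequence of
`G`-lattices with `P` permutation and `F` flabby. -/
structure FlabbyResolution {G M : Type} [Group G] [AddCommGroup M]
    (ρ : Representation ℤ G M) where
  P : Type
  [addCommGroupP : AddCommGroup P]
  repP : Representation ℤ G P
  F : Type
  [addCommGroupF : AddCommGroup F]
  repF : Representation ℤ G F
  f : ρ.IntertwiningMap repP
  g : repP.IntertwiningMap repF
  permutation_P : IsPermutationRep repP
  lattice_F : IsLatticeRep repF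
  flabby_F : IsFlabbyRep repF
  injective_f : Function.Injective f
  exact_fg : Function.Exact f g
  surjective_g : Function.Surjective g

attribute [instance] FlabbyResolution.addCommGroupP FlabbyResolution.addCommGroupF

/-! ### The `p`-part of the flabby class -/

/-- The `ℤ_p[G]`-lattice `ℤ_p ⊗ M` of a `G`-lattice `M`. -/
noncomputable def padicExtension (p : ℕ) [Fact p.Prime] {G M : Type} [Group G] [AddCommGroup M]
    (ρ : Representation ℤ G M) : Representation ℤ_[p] G (ℤ_[p] ⊗[ℤ] M) where
  toFun g := (ρ g).baseChange ℤ_[p]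
  map_one' := by
    rw [map_one]
    exact LinearMap.baseChange_id
  map_mul' g h := by
    rw [map_mul]
    exact LinearMap.baseChange_comp (ρ h) (ρ g)

/-- `τ` is (a model of) the `p`-part, computed from the flabby resolution `0 → M → P → F → 0`:
`ℤ_p ⊗ F`, restricted to the Sylow `p`-subgroup `S`, is isomorphic to `τ ⊕ σ` where `σ` is
permutation and `τ` has no permutation direct summands. -/
def IsPPart (p : ℕ) [Fact p.Prime] {G M : Type} [Group G] [AddCommGroup M]
    {ρ : Representation ℤ G M} (E : FlabbyResolution ρ) (S : Sylow p G)
    {V : Type} [AddCommGroup V] [Module ℤ_[p] V] (τ : Representation ℤ_[p] S V) : Prop :=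
  HasNoPermutationSummand τ ∧
    ∃ (Q : Type) (_ : AddCommGroup Q) (_ : Module ℤ_[p] Q) (σ : Representation ℤ_[p] S Q),
      IsPermutationRep σ ∧
      Nonempty (Representation.Equiv
        ((padicExtension p E.repF).comp (S : Subgroup G).subtype) (τ.prod σ))

/-! ### The lattice `M_G` and the groups `N_{3,i}` -/

/-- The `G`-lattice `M_G` of a subgroup `G` of `GL(n, ℤ)`: the matrix `σ = [a_{i,j}]` acts on the
basis `u_1, …, u_n` by `u_i ↦ ∑ j, a_{i,j} u_j`, that is, on row vectors of coordinates by
`x ↦ x σ`. This is a right action; it is regarded as a left action through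
inverses, `σ • x = x σ⁻¹`. -/
def latticeRep {n : ℕ} (G : Subgroup (GL (Fin n) ℤ)) : Representation ℤ G (Fin n → ℤ) where
  toFun g := Matrix.vecMulLinear (((g : GL (Fin n) ℤ)⁻¹ : GL (Fin n) ℤ) : Matrix (Fin n) (Fin n) ℤ)
  map_one' := by
    refine LinearMap.ext fun x => ?_
    simp
  map_mul' g h := by
    refine LinearMap.ext fun x => ?_
    simp [Matrix.vecMul_vecMul]

namespace N3

/-! With `u_4 = -(u_1 + u_2 + u_3)`: `a₁ = (u_1 u_4)(u_2 u_3)`, `a₂ = (u_1 u_2)(u_3 u_4)`,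
`w = (u_1 u_2)`, `c = (u_1 u_2 u_3)`, and `q` is minus the 4-cycle `(u_1 u_3 u_2 u_4)`.
The matrices `b₁`, `b₂`, `r` are the rotations of `a₁`, `a₂`, `q` written in the basis
`(0,1,1), (1,0,1), (1,1,0)` in place of `(-1,1,1), (1,-1,1), (1,1,-1)`. -/

def a₁ : GL (Fin 3) ℤ :=
  ⟨!![-1, -1, -1; 0, 0, 1; 0, 1, 0], !![-1, -1, -1; 0, 0, 1; 0, 1, 0], by decide, by decide⟩

def a₂ : GL (Fin 3) ℤ :=
  ⟨!![0, 1, 0; 1, 0, 0; -1, -1, -1], !![0, 1, 0; 1, 0, 0; -1, -1, -1], by decide, by decide⟩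

def w : GL (Fin 3) ℤ :=
  ⟨!![0, 1, 0; 1, 0, 0; 0, 0, 1], !![0, 1, 0; 1, 0, 0; 0, 0, 1], by decide, by decide⟩

def c : GL (Fin 3) ℤ :=
  ⟨!![0, 1, 0; 0, 0, 1; 1, 0, 0], !![0, 0, 1; 1, 0, 0; 0, 1, 0], by decide, by decide⟩

def q : GL (Fin 3) ℤ :=
  ⟨!![0, 0, -1; 1, 1, 1; 0, -1, 0], !![1, 1, 1; 0, 0, -1; -1, 0, 0], by decide, by decide⟩

def b₁ : GL (Fin 3) ℤ :=
  ⟨!![-1, 0, 0; -1, 0, 1; -1, 1, 0], !![-1, 0, 0; -1, 0, 1; -1, 1, 0], by decide, by decide⟩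

def b₂ : GL (Fin 3) ℤ :=
  ⟨!![0, 1, -1; 1, 0, -1; 0, 0, -1], !![0, 1, -1; 1, 0, -1; 0, 0, -1], by decide, by decide⟩

def r : GL (Fin 3) ℤ :=
  ⟨!![1, 0, -1; 1, 0, 0; 1, -1, 0], !![0, 1, 0; 0, 1, -1; -1, 1, 0], by decide, by decide⟩

/-- Representatives of the `GL(3, ℤ)`-conjugacy classes of the fifteen groups
`N_{3,1}, …, N_{3,15}`; `N3.group i` is `N_{3,i+1}`. The comments give the isomorphism type and
the number of the `ℤ`-class in the crystallographic tables
(dimension, crystal system, `ℚ`-class, `ℤ`-class). -/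
def group : Fin 15 → Subgroup (GL (Fin 3) ℤ) :=
  ![ -- `C₂²`, (3,3,1,3)
     Subgroup.closure {a₁, a₂},
     -- `C₂³`, (3,3,3,3)
     Subgroup.closure {a₁, a₂, -1},
     -- `C₂³`, (3,3,3,4)
     Subgroup.closure {b₁, b₂, -1},
     -- `C₄ × C₂`, (3,4,3,2)
     Subgroup.closure {q, -1},
     -- `D₄`, (3,4,4,2)
     Subgroup.closure {q, a₁},
     -- `D₄`, (3,4,6,3)
     Subgroup.closure {-q, a₁},
     -- `D₄ × C₂`, (3,4,7,2)
     Subgroup.closure {q, a₁, -1},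
     -- `A₄`, (3,7,1,2)
     Subgroup.closure {a₁, a₂, c},
     -- `A₄ × C₂`, (3,7,2,2)
     Subgroup.closure {a₁, a₂, c, -1},
     -- `A₄ × C₂`, (3,7,2,3)
     Subgroup.closure {b₁, b₂, c, -1},
     -- `S₄`, (3,7,3,2)
     Subgroup.closure {a₁, a₂, c, q},
     -- `S₄`, (3,7,3,3)
     Subgroup.closure {b₁, b₂, c, r},
     -- `S₄`, (3,7,4,2)
     Subgroup.closure {a₁, a₂, c, w},
     -- `S₄ × C₂`, (3,7,5,2)
     Subgroup.closure {a₁, a₂, c, q, -1},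
     -- `S₄ × C₂`, (3,7,5,3)
     Subgroup.closure {b₁, b₂, c, r, -1} ]

/-- The `ℤ₂`-ranks of the `2`-parts for `N_{3,1}, …, N_{3,15}`. -/
def rank : Fin 15 → ℕ := ![5, 9, 11, 11, 7, 7, 11, 5, 9, 11, 7, 7, 7, 11, 11]

end N3

/-! Flabby resolutions come from finite stable families of functionals. If a finite `G`-set `ι`
indexes functionals on `M`, and every functional invariant under a subgroup `H` is a combination of
them with `H`-invariant coefficients, then `M` embeds in `ℤ^ι` with torsion-free flabby cokernel
(`IsFlabbyFamily.normKernelsVanish`). Generators of the invariant functionals of all subgroups, with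
their translates, form such a family, so resolutions exist.

Any two resolutions satisfy `F ⊕ P' ≃ F' ⊕ P` by a Schanuel argument, since maps from `M` to
permutation lattices extend along an embedding with flabby cokernel
(`nonempty_equiv_of_flabby_resolutions`). Over `ℤ_p` and a `p`-group, transitive permutation
lattices have local endomorphism rings, and a Krull-Schmidt exchange cancels permutation lattices
(`exists_equiv_prod_of_isPermutationRep`). Hence one resolution over the Sylow `2`-subgroup with a
suitable cokernel is enough: if this cokernel is indecomposable over `ℤ₂` of odd rank greater than
one, then it is not permutation and is the `2`-part (`two_part_of_resolution`).

The fifteen groups have, up to conjugacy, seven kinds of Sylow `2`-subgroup. In a suitable basis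
each acts on `ℤ⁴/(1,1,1,1)` by signed permutations of the coordinates, with one sign for all four. A
vector there is canonically a nonnegative combination of indicator vectors of subsets, namely its
superlevel sets; this expansion is equivariant, so the fourteen indicator vectors form a flabby
family. A stable subfamily also works when the omitted vectors are equivariantly sums of members.
All the families used contain the unit vectors, so the embedding is the graph of the matrix `W` of
the remaining `r` vectors, and the cokernel is `ℤ^r` with explicit action.

Indecomposability is checked modulo `2`. For a `2`-group, an equivariant endomorphism that is not
bijective annihilates a nonzero invariant functional modulo `2`. An idempotent endomorphism is
therefore `0` or `1` as soon as it acts by `0` or `1` on the invariant functionals, and finite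
certificates derive this from its commutation with the generators
(`LocalTopCertificate.idempotent`). Faithfulness holds because a group element acting trivially on
the cokernel fixes every row of `W`, and the negatives of the unit vectors are among these rows.
Sylow subgroups are identified by writing each group as the union of `K`, `cK` and `c⁻¹K`, with `K`
the explicit `2`-group and `c³ = 1`. -/

/-! ### Tate cohomology in degree minus one. -/

section Tate

open CategoryTheory

/-- The Tate group `Ĥ⁻¹(G, A)` vanishes if and only if the kernel of the norm of `A` is contained
in the augmentation submodule of `A`. -/
theorem subsingleton_tateCohomology_neg_one_iff {R G : Type} [CommRing R] [Group G] [Fintype G]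
    (A : Rep R G) :
    Subsingleton (tateCohomology A (-1)) ↔
      ∀ x : A, A.ρ.norm x = 0 → x ∈ Representation.Coinvariants.ker A.ρ := by
  have h1 : Subsingleton (tateCohomology A (-1)) ↔ (tateComplex A).ExactAt (-1) := by
    rw [HomologicalComplex.exactAt_iff_isZero_homology, ModuleCat.isZero_iff_subsingleton]
    rfl
  rw [h1, HomologicalComplex.exactAt_iff' _ (-2) (-1) 0 (by simp) (by simp),
    ShortComplex.moduleCat_exact_iff]
  -- In degree zero the chains and the cochains are both identified with `A`, and the Tate
  -- differential leaving degree `-1` becomes the norm.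
  have hn : ∀ y : (groupHomology.inhomogeneousChains A).X 0, A.tateNorm y = 0 ↔
      A.ρ.norm ((groupHomology.chainsIso₀ A).hom y) = 0 := by
    intro y
    have hi : Function.Injective (groupCohomology.cochainsIso₀ A).inv :=
      (ModuleCat.mono_iff_injective _).1 inferInstance
    have : A.tateNorm y = (groupCohomology.cochainsIso₀ A).inv
        (A.ρ.norm ((groupHomology.chainsIso₀ A).hom y)) := rfl
    rw [this, map_eq_zero_iff _ hi]
  -- The incoming differential is the first group homology boundary, whose image is the augmentation
  -- submodule.
  have hd : ∀ z, (groupHomology.chainsIso₀ A).hom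
      ((groupHomology.inhomogeneousChains A).d 1 0 z) =
      groupHomology.d₁₀ A ((groupHomology.chainsIso₁ A).hom z) := by
    intro z
    exact congr($(groupHomology.comp_d₁₀_eq A) z).symm
  constructor
  · intro h x hx
    obtain ⟨z, hz⟩ := h ((groupHomology.chainsIso₀ A).inv x) ((hn _).2 (by simpa using hx))
    rw [← groupHomology.range_d₁₀_eq_coinvariantsKer]
    refine ⟨(groupHomology.chainsIso₁ A).hom z, ?_⟩
    refine (hd z).symm.trans ?_
    refine (congrArg (groupHomology.chainsIso₀ A).hom hz).trans ?_
    simp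
  · intro h y hy
    have := h _ ((hn y).1 hy)
    rw [← groupHomology.range_d₁₀_eq_coinvariantsKer] at this
    obtain ⟨w, hw⟩ := this
    refine ⟨(groupHomology.chainsIso₁ A).inv w, ?_⟩
    have hi : Function.Injective (groupHomology.chainsIso₀ A).hom :=
      (ModuleCat.mono_iff_injective _).1 inferInstance
    apply hi
    refine (hd _).trans ?_
    simpa using hw

end Tate

/-! ### Flabbiness as a condition on norm kernels. -/

/-- The kernel of the norm of every subgroup is contained in the corresponding augmentation
submodule. -/
def NormKernelsVanish {G V : Type*} [Group G] [Finite G] [AddCommGroup V]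
    (ρ : Representation ℤ G V) : Prop :=
  ∀ (H : Subgroup G) (x : V), (∑ᶠ h : H, ρ h x) = 0 →
    x ∈ Representation.Coinvariants.ker (ρ.comp H.subtype)

theorem isFlabbyRep_iff {G V : Type} [Group G] [Finite G] [AddCommGroup V]
    (ρ : Representation ℤ G V) : IsFlabbyRep ρ ↔ NormKernelsVanish ρ := by
  have key (H : Subgroup G) [Fintype H] :
      Subsingleton (tateCohomology (Rep.of (ρ.comp H.subtype)) (-1)) ↔
      ∀ x : V, (∑ᶠ h : H, ρ h x) = 0 →
        x ∈ Representation.Coinvariants.ker (ρ.comp H.subtype) := by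
    rw [subsingleton_tateCohomology_neg_one_iff]
    refine forall_congr' fun x => imp_congr ?_ Iff.rfl
    rw [finsum_eq_sum_of_fintype]
    simp [Representation.norm]
  constructor
  · intro h H
    have := Fintype.ofFinite H
    exact (key H).1 (h H)
  · intro h H _
    exact (key H).2 (h H)

theorem NormKernelsVanish.comp_subtype {G V : Type*} [Group G] [Finite G] [AddCommGroup V]
    {ρ : Representation ℤ G V} (h : NormKernelsVanish ρ) (S : Subgroup G) :
    NormKernelsVanish (ρ.comp S.subtype) := by
  intro H x hx
  have := h (H.map S.subtype) x (by
    rw [← hx]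
    refine (finsum_eq_of_bijective _ (H.equivMapOfInjective _ S.subtype_injective).bijective ?_).symm
    intro h
    simp)
  refine Submodule.span_le.2 ?_ this
  rintro _ ⟨⟨⟨_, h, hh, rfl⟩, y⟩, rfl⟩
  exact Submodule.subset_span ⟨(⟨h, hh⟩, y), by simp⟩

/-! ### Permutation lattices and group actions on their bases. -/

section PermutationLattices

/-- Basis vectors are distinct over a nontrivial ring, so the index each one is sent to is unique
and the action laws follow from those of `ρ`. -/
theorem IsPermutationRep.exists_mulAction {R G V : Type*} [CommRing R] [Nontrivial R] [Group G]
    [AddCommGroup V] [Module R V] {ρ : Representation R G V} (h : IsPermutationRep ρ) :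
    ∃ (ι : Type) (_ : Finite ι) (_ : MulAction G ι) (b : Module.Basis ι R V),
      ∀ (g : G) (i : ι), ρ g (b i) = b (g • i) := by
  obtain ⟨ι, hι, b, hb⟩ := h
  choose a ha using hb
  have h1 : ∀ i, a 1 i = i := fun i => b.injective (by rw [← ha, map_one, Module.End.one_apply])
  have h2 : ∀ g k i, a (g * k) i = a g (a k i) := fun g k i =>
    b.injective (by rw [← ha, ← ha, ← ha, map_mul, Module.End.mul_apply])
  exact ⟨ι, hι, { smul := a, one_smul := h1, mul_smul := h2 }, b, ha⟩

theorem Module.Basis.repr_permutation_smul {R G V ι : Type*} [CommRing R] [Group G]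
    [AddCommGroup V] [Module R V] {ρ : Representation R G V} [MulAction G ι]
    (b : Module.Basis ι R V) (hb : ∀ (g : G) (i : ι), ρ g (b i) = b (g • i)) (g : G) (v : V)
    (i : ι) : b.repr (ρ g v) (g • i) = b.repr v i := by
  have : b.coord (g • i) ∘ₗ ρ g = b.coord i := by
    refine b.ext fun j => ?_
    classical
    simp only [LinearMap.comp_apply, Module.Basis.coord_apply, hb, Module.Basis.repr_self]
    by_cases h : j = i
    · simp [h]
    · rw [Finsupp.single_eq_of_ne' h, Finsupp.single_eq_of_ne' fun h' => h (smul_left_cancel g h')]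
  exact LinearMap.congr_fun this v

end PermutationLattices

/-- Two surjective intertwining maps with the same kernel have isomorphic targets. -/
theorem Representation.nonempty_equiv_of_ker_eq {R G V W W' : Type*} [CommRing R] [Group G]
    [AddCommGroup V] [Module R V] [AddCommGroup W] [Module R W] [AddCommGroup W'] [Module R W']
    {ρ : Representation R G V} {σ : Representation R G W} {σ' : Representation R G W'}
    (f : V →ₗ[R] W) (f' : V →ₗ[R] W') (hf : ∀ g v, f (ρ g v) = σ g (f v))
    (hf' : ∀ g v, f' (ρ g v) = σ' g (f' v)) (hs : Function.Surjective f)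
    (hs' : Function.Surjective f') (hk : LinearMap.ker f = LinearMap.ker f') :
    Nonempty (Representation.Equiv σ σ') := by
  let e : W ≃ₗ[R] W' := (f.quotKerEquivOfSurjective hs).symm ≪≫ₗ Submodule.quotEquivOfEq _ _ hk ≪≫ₗ
    f'.quotKerEquivOfSurjective hs'
  have he : ∀ v, e (f v) = f' v := by
    intro v
    have : (f.quotKerEquivOfSurjective hs).symm (f v) = Submodule.Quotient.mk v := by
      rw [LinearEquiv.symm_apply_eq]
      rfl
    simp only [e, LinearEquiv.trans_apply, this]
    rfl
  refine ⟨Representation.Equiv.mk e fun g => ?_⟩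
  ext w
  obtain ⟨v, rfl⟩ := hs w
  simp only [LinearMap.comp_apply, LinearEquiv.coe_coe]
  rw [← hf, he, he, hf']

/-! ### Extension of maps along flabby embeddings and Schanuel's lemma. -/

section Schanuel

variable {G M P F : Type} [Group G] [Finite G] [AddCommGroup M] [AddCommGroup P] [AddCommGroup F]
  {ρM : Representation ℤ G M} {ρP : Representation ℤ G P} {ρF : Representation ℤ G F}

/-- Along an embedding with flabby torsion-free cokernel, invariant functionals extend. -/
theorem exists_extension_invariant_functional [Module.Finite ℤ P] [Module.IsTorsionFree ℤ F]
    (f : M →ₗ[ℤ] P) (g : P →ₗ[ℤ] F) (hf : ∀ s v, f (ρM s v) = ρP s (f v))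
    (hg : ∀ s v, g (ρP s v) = ρF s (g v)) (inj : Function.Injective f) (ex : Function.Exact f g)
    (sur : Function.Surjective g)
    (hF : NormKernelsVanish ρF) (H : Subgroup G) (l : M →ₗ[ℤ] ℤ)
    (hl : ∀ s ∈ H, ∀ m, l (ρM s m) = l m) :
    ∃ μ : P →ₗ[ℤ] ℤ, (∀ s ∈ H, ∀ p, μ (ρP s p) = μ p) ∧ ∀ m, μ (f m) = l m := by
  have := Fintype.ofFinite H
  let I := Representation.Coinvariants.ker (ρP.comp H.subtype)
  -- The extension is forced to vanish on the augmentation submodule `I`, so `l` is first extended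
  -- to the sum `D` of `f(M)` and `I`.
  let φ : M × I →ₗ[ℤ] P := f.coprod I.subtype
  -- the norm kills the augmentation submodule
  have normI : ∀ y ∈ I, ∑ h : H, ρP h y = 0 := by
    intro y hy
    have : I ≤ LinearMap.ker (∑ h : H, ρP (h : G)) := by
      refine Submodule.span_le.2 ?_
      rintro _ ⟨⟨k, x⟩, rfl⟩
      simp only [MonoidHom.comp_apply, SetLike.mem_coe, LinearMap.mem_ker, map_sub,
        LinearMap.sum_apply, sub_eq_zero]
      refine Fintype.sum_bijective (fun h : H => h * k) (Group.mulRight_bijective k) _ _ ?_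
      intro h
      simp
    simpa using this hy
  -- Well-definedness on `D`: if `f m` lies in `I`, then the norm of `m` is zero, so `|H| l(m) = 0`
  -- and `l(m) = 0`.
  have hker : LinearMap.ker φ ≤ LinearMap.ker (l ∘ₗ LinearMap.fst ℤ M I) := by
    rintro ⟨m, y⟩ hmy
    rw [LinearMap.mem_ker] at hmy ⊢
    have h1 : f m = -(y : P) := by
      rw [eq_neg_iff_add_eq_zero]; simpa [φ] using hmy
    have h2 : f (∑ h : H, ρM h m) = 0 := by
      rw [map_sum]
      simp only [hf, h1, map_neg, Finset.sum_neg_distrib, normI y y.2, neg_zero]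
    have h3 : ∑ h : H, ρM h m = 0 := inj (by rw [h2, map_zero])
    have h4 : (Fintype.card H : ℤ) * l m = 0 := by
      have := congrArg l h3
      rw [map_sum, map_zero] at this
      rw [← this]
      simp [hl _ (Subtype.prop _)]
    simpa [Fintype.card_ne_zero] using h4
  let D := LinearMap.range φ
  let lD : D →ₗ[ℤ] ℤ := (LinearMap.ker φ).liftQ (l ∘ₗ LinearMap.fst ℤ M I) hker ∘ₗ
    φ.quotKerEquivRange.symm
  have hlD : ∀ x, lD ⟨φ x, x, rfl⟩ = l x.1 := by
    intro x
    have : φ.quotKerEquivRange.symm ⟨φ x, x, rfl⟩ = Submodule.Quotient.mk x := by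
      rw [LinearEquiv.symm_apply_eq]; rfl
    simp only [lD, LinearMap.comp_apply, LinearEquiv.coe_coe, this]
    rfl
  let J := Representation.Coinvariants.ker (ρF.comp H.subtype)
  have hIJ : I ≤ J.comap g := by
    refine Submodule.span_le.2 ?_
    rintro _ ⟨⟨k, z⟩, rfl⟩
    exact Submodule.subset_span ⟨(k, g z), by simp [hg]⟩
  have hJI : J ≤ I.map g := by
    refine Submodule.span_le.2 ?_
    rintro _ ⟨⟨k, w⟩, rfl⟩
    obtain ⟨z, rfl⟩ := sur w
    exact ⟨ρP k z - z, Submodule.subset_span ⟨(k, z), rfl⟩, by simp [hg]⟩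
  have memD : ∀ x, x ∈ D ↔ g x ∈ J := by
    intro x
    constructor
    · rintro ⟨⟨m, y⟩, rfl⟩
      have : g (f m) = 0 := (ex _).2 ⟨m, rfl⟩
      rw [← Submodule.mem_comap]
      have h1 : f m ∈ J.comap g := by simp [this]
      exact add_mem h1 (hIJ y.2)
    · intro hx
      obtain ⟨y, hy, hyx⟩ := hJI hx
      obtain ⟨m, hm⟩ := (ex (x - y)).1 (by rw [map_sub, hyx, sub_self])
      exact ⟨(m, ⟨y, hy⟩), by simp [φ, hm]⟩
  have normJ : ∀ y ∈ J, ∑ h : H, ρF h y = 0 := by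
    intro y hy
    obtain ⟨z, hz, rfl⟩ := hJI hy
    simp only [← hg, ← map_sum, normI z hz, map_zero]
  -- Flabbiness enters here. The quotient `P/D` is the coinvariants of `F`; if `n x` lies in `J`
  -- with `n ≠ 0`, the norm of `x` vanishes because `F` is torsion-free, hence `x` lies in `J`. Thus
  -- `D` is a direct summand of `P`.
  have tf : Module.IsTorsionFree ℤ (P ⧸ D) := by
    refine Module.IsTorsionFree.of_smul_eq_zero fun n x => ?_
    obtain ⟨x, rfl⟩ := Submodule.mkQ_surjective _ x
    rw [or_iff_not_imp_left, ← map_smul]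
    simp only [Submodule.mkQ_apply, Submodule.Quotient.mk_eq_zero, memD]
    intro hx hn
    refine hF H _ ?_
    rw [finsum_eq_sum_of_fintype]
    have := normJ _ hx
    simp only [map_smul, ← Finset.smul_sum] at this
    exact (smul_eq_zero.1 this).resolve_left hn
  have free : Module.Free ℤ (P ⧸ D) := Module.free_of_finite_type_torsion_free'
  obtain ⟨s, hs⟩ := Module.projective_lifting_property D.mkQ LinearMap.id D.mkQ_surjective
  have hr : ∀ x, (LinearMap.id - s ∘ₗ D.mkQ : P →ₗ[ℤ] P) x ∈ D := by
    intro x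
    rw [← Submodule.Quotient.mk_eq_zero, ← Submodule.mkQ_apply]
    have := LinearMap.congr_fun hs (D.mkQ x)
    simp only [LinearMap.comp_apply, LinearMap.id_apply] at this
    simp [-Submodule.mkQ_apply, this]
  let r : P →ₗ[ℤ] D := (LinearMap.id - s ∘ₗ D.mkQ : P →ₗ[ℤ] P).codRestrict D hr
  have hrD : ∀ x : D, r x = x := by
    intro x
    apply Subtype.ext
    have : D.mkQ (x : P) = 0 := by simp
    simp [r, LinearMap.codRestrict_apply, this, -Submodule.mkQ_apply]
  refine ⟨lD ∘ₗ r, fun k hk p => ?_, fun m => ?_⟩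
  · have hy : ρP k p - p ∈ I := Submodule.subset_span ⟨(⟨k, hk⟩, p), rfl⟩
    have h0 : φ (0, ⟨_, hy⟩) = ρP k p - p := by simp [φ]
    have h1 : r (ρP k p - p) = ⟨φ (0, ⟨_, hy⟩), _, rfl⟩ := by
      rw [← hrD ⟨φ (0, ⟨_, hy⟩), _, rfl⟩]
      simp only [h0]
    rw [← sub_eq_zero, ← map_sub, LinearMap.comp_apply, h1, hlD, map_zero]
  · have h0 : φ (m, 0) = f m := by simp [φ]
    have h1 : r (f m) = ⟨φ (m, 0), _, rfl⟩ := by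
      rw [← hrD ⟨φ (m, 0), _, rfl⟩]
      simp only [h0]
    rw [LinearMap.comp_apply, h1, hlD]

/-- Along an embedding with flabby torsion-free cokernel, equivariant maps to permutation lattices
extend. -/
theorem exists_extension_to_permutation [Module.Finite ℤ P] [Module.IsTorsionFree ℤ F]
    {P' : Type} [AddCommGroup P'] {ρP' : Representation ℤ G P'} (hP' : IsPermutationRep ρP')
    (f : M →ₗ[ℤ] P) (g : P →ₗ[ℤ] F) (hf : ∀ s v, f (ρM s v) = ρP s (f v))
    (hg : ∀ s v, g (ρP s v) = ρF s (g v)) (inj : Function.Injective f) (ex : Function.Exact f g)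
    (sur : Function.Surjective g) (hF : NormKernelsVanish ρF) (k : M →ₗ[ℤ] P')
    (hk : ∀ s v, k (ρM s v) = ρP' s (k v)) :
    ∃ h : P →ₗ[ℤ] P', (∀ s p, h (ρP s p) = ρP' s (h p)) ∧ ∀ m, h (f m) = k m := by
  obtain ⟨ι, hι, act, b, hb⟩ := hP'.exists_mulAction
  have := Fintype.ofFinite ι
  have hrepr := b.repr_permutation_smul hb
  have H : ∀ i : ι, ∃ μ : P →ₗ[ℤ] ℤ,
      (∀ s ∈ MulAction.stabilizer G i, ∀ p, μ (ρP s p) = μ p) ∧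
        ∀ m, μ (f m) = b.repr (k m) i := by
    intro i
    refine exists_extension_invariant_functional f g hf hg inj ex sur hF _ (b.coord i ∘ₗ k) ?_
    intro s hs m
    simp only [LinearMap.comp_apply, Module.Basis.coord_apply, hk]
    conv_lhs => rw [← MulAction.mem_stabilizer_iff.1 hs]
    exact hrepr _ _ _
  choose μ hμ hμf using H
  -- As in Shapiro's lemma, an equivariant map to a permutation lattice amounts to one
  -- stabilizer-invariant functional per orbit; the other coordinates are obtained by translating
  -- from the representative.
  let rep : ι → ι := fun i => (Quotient.mk (MulAction.orbitRel G ι) i).out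
  have hrep : ∀ i, ∃ s : G, s • rep i = i := by
    intro i
    exact (MulAction.orbitRel G ι).symm ((MulAction.orbitRel G ι).trans
      (Quotient.mk_out (s := MulAction.orbitRel G ι) i) ((MulAction.orbitRel G ι).refl i))
  have hrep' : ∀ (s : G) i, rep (s • i) = rep i := by
    intro s i
    have : Quotient.mk (MulAction.orbitRel G ι) (s • i) = Quotient.mk _ i :=
      Quotient.sound ⟨s, rfl⟩
    simp only [rep, this]
  choose t ht using hrep
  let h : P →ₗ[ℤ] P' := b.equivFun.symm.toLinearMap ∘ₗ
    LinearMap.pi fun i => μ (rep i) ∘ₗ ρP (t i)⁻¹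
  have hh : ∀ p i, b.repr (h p) i = μ (rep i) (ρP (t i)⁻¹ p) := by
    intro p i
    rw [← b.equivFun_apply]
    simp [h, -Module.Basis.equivFun_symm_apply]
  refine ⟨h, fun s p => ?_, fun m => ?_⟩
  · apply b.repr.injective
    ext i
    obtain ⟨i, rfl⟩ := MulAction.surjective s i
    rw [hrepr, hh, hh, hrep']
    -- The two translates to `s • i` differ by an element of the stabilizer of the representative,
    -- which leaves `μ` unchanged.
    have : (t (s • i))⁻¹ * s * t i ∈ MulAction.stabilizer G (rep i) := by
      rw [MulAction.mem_stabilizer_iff, mul_smul, mul_smul, ht, inv_smul_eq_iff]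
      conv_rhs => rw [← hrep' s i]
      exact (ht _).symm
    rw [← hμ _ _ this (ρP (t i)⁻¹ p)]
    simp only [← Module.End.mul_apply, ← map_mul]
    congr 3
    group
  · apply b.repr.injective
    ext i
    rw [hh, ← hf, hμf, hk]
    conv_rhs => rw [← ht i]
    rw [← hrepr (t i)]
    simp [← Module.End.mul_apply, ← map_mul]

/-- Two flabby resolutions of the same lattice: each cokernel plus the other permutation lattice
are isomorphic. -/
theorem nonempty_equiv_of_flabby_resolutions [Module.IsTorsionFree ℤ F]
    {P' F' : Type} [AddCommGroup P'] [AddCommGroup F'] [Module.IsTorsionFree ℤ F']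
    {ρP' : Representation ℤ G P'} {ρF' : Representation ℤ G F'}
    (hP : IsPermutationRep ρP) (hP' : IsPermutationRep ρP')
    (f : M →ₗ[ℤ] P) (g : P →ₗ[ℤ] F) (hf : ∀ s v, f (ρM s v) = ρP s (f v))
    (hg : ∀ s v, g (ρP s v) = ρF s (g v)) (inj : Function.Injective f) (ex : Function.Exact f g)
    (sur : Function.Surjective g) (hF : NormKernelsVanish ρF)
    (f' : M →ₗ[ℤ] P') (g' : P' →ₗ[ℤ] F') (hf' : ∀ s v, f' (ρM s v) = ρP' s (f' v))
    (hg' : ∀ s v, g' (ρP' s v) = ρF' s (g' v)) (inj' : Function.Injective f')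
    (ex' : Function.Exact f' g') (sur' : Function.Surjective g') (hF' : NormKernelsVanish ρF') :
    Nonempty (Representation.Equiv (ρF.prod ρP') (ρF'.prod ρP)) := by
  have finite : ∀ {Q : Type} [AddCommGroup Q] {ρ : Representation ℤ G Q},
      IsPermutationRep ρ → Module.Finite ℤ Q := by
    rintro Q _ ρ ⟨ι, _, b, -⟩
    exact Module.Finite.of_basis b
  have := finite hP
  have := finite hP'
  obtain ⟨h, hh, hhf⟩ := exists_extension_to_permutation hP' f g hf hg inj ex sur hF f' hf'
  obtain ⟨h', hh', hhf'⟩ := exists_extension_to_permutation hP f' g' hf' hg' inj' ex' sur' hF' f hf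
  -- Both sides are quotients of `P × P'` by the image of `M` under `(f, f')`: this is the kernel of
  -- each of the two maps below.
  refine Representation.nonempty_equiv_of_ker_eq (ρ := ρP.prod ρP')
    (LinearMap.prod (g ∘ₗ LinearMap.fst ℤ P P') (LinearMap.snd ℤ P P' - h ∘ₗ LinearMap.fst ℤ P P'))
    (LinearMap.prod (g' ∘ₗ LinearMap.snd ℤ P P') (LinearMap.fst ℤ P P' - h' ∘ₗ LinearMap.snd ℤ P P'))
    ?_ ?_ ?_ ?_ ?_
  · rintro s ⟨p, p'⟩
    simp [hg, hh]
  · rintro s ⟨p, p'⟩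
    simp [hg', hh']
  · rintro ⟨x, p'⟩
    obtain ⟨p, rfl⟩ := sur x
    exact ⟨(p, p' + h p), by simp⟩
  · rintro ⟨x, p⟩
    obtain ⟨p', rfl⟩ := sur' x
    exact ⟨(p + h' p', p'), by simp⟩
  · refine Submodule.ext ?_
    rintro ⟨p, p'⟩
    suffices (g p = 0 ∧ p' = h p) ↔ (g' p' = 0 ∧ p = h' p') by simpa [sub_eq_zero] using this
    constructor
    · rintro ⟨h1, h2⟩
      obtain ⟨m, rfl⟩ := (ex p).1 h1
      rw [hhf] at h2
      subst h2
      exact ⟨(ex' _).2 ⟨m, rfl⟩, (hhf' m).symm⟩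
    · rintro ⟨h1, h2⟩
      obtain ⟨m, rfl⟩ := (ex' p').1 h1
      rw [hhf'] at h2
      subst h2
      exact ⟨(ex _).2 ⟨m, rfl⟩, (hhf m).symm⟩

end Schanuel

/-! ### Flabby cokernels from families of functionals. -/

section Functionals

/-- The permutation representation on the `R`-valued functions on a `G`-set. -/
def functionRep (R G ι : Type*) [CommRing R] [Group G] [MulAction G ι] :
    Representation R G (ι → R) where
  toFun s := LinearMap.funLeft R R fun i => s⁻¹ • i
  map_one' := by ext; simp
  map_mul' s t := by ext; simp [mul_smul]

theorem functionRep_apply {R G ι : Type*} [CommRing R] [Group G] [MulAction G ι] (s : G)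
    (p : ι → R) (i : ι) : functionRep R G ι s p i = p (s⁻¹ • i) := rfl

theorem functionRep_single {R G ι : Type*} [CommRing R] [Group G] [MulAction G ι] [DecidableEq ι]
    (s : G) (i : ι) (n : R) :
    functionRep R G ι s (Pi.single i n) = Pi.single (s • i) n := by
  ext j
  simp only [functionRep_apply, Pi.single_apply, inv_smul_eq_iff]

theorem isPermutationRep_functionRep (R G ι : Type) [CommRing R] [Group G] [MulAction G ι]
    [Finite ι] : IsPermutationRep (functionRep R G ι) := by
  classical
  refine ⟨ι, ‹_›, Pi.basisFun R ι, fun g i => ⟨g • i, ?_⟩⟩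
  rw [Pi.basisFun_apply, Pi.basisFun_apply, functionRep_single]

/-- A function on a `G`-set whose orbit sums vanish lies in the augmentation submodule. -/
theorem mem_coinvariantsKer_functionRep {G ι : Type*} [Group G] [MulAction G ι] [Fintype ι]
    [DecidableEq (MulAction.orbitRel.Quotient G ι)] (p : ι → ℤ)
    (hp : ∀ O : MulAction.orbitRel.Quotient G ι,
      ∑ i with (Quotient.mk _ i : MulAction.orbitRel.Quotient G ι) = O, p i = 0) :
    p ∈ Representation.Coinvariants.ker (functionRep ℤ G ι) := by
  classical
  have := Fintype.ofFinite (MulAction.orbitRel.Quotient G ι)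
  -- Replacing every basis vector by the representative of its orbit changes `p` by an element of
  -- the augmentation submodule and produces the orbit sums, which vanish.
  have h1 : p = ∑ i, p i • (Pi.single i 1 : ι → ℤ) := by
    ext j
    simp [Finset.sum_apply, Pi.single_apply]
  have h2 : ∑ i, p i • (Pi.single
      (Quotient.mk _ i : MulAction.orbitRel.Quotient G ι).out 1 : ι → ℤ) = 0 := by
    rw [← Finset.sum_fiberwise (s := Finset.univ)
      (g := fun i => (Quotient.mk _ i : MulAction.orbitRel.Quotient G ι))]
    refine Finset.sum_eq_zero fun O _ => ?_
    have : ∀ i ∈ Finset.univ.filter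
        (fun i => (Quotient.mk _ i : MulAction.orbitRel.Quotient G ι) = O),
        p i • (Pi.single (Quotient.mk _ i : MulAction.orbitRel.Quotient G ι).out 1 : ι → ℤ) =
          p i • (Pi.single O.out 1 : ι → ℤ) := by
      intro i hi
      rw [(Finset.mem_filter.1 hi).2]
    rw [Finset.sum_congr rfl this, ← Finset.sum_smul, hp, zero_smul]
  rw [h1, ← sub_zero (∑ i, _), ← h2, ← Finset.sum_sub_distrib]
  refine Submodule.sum_mem _ fun i _ => ?_
  rw [← smul_sub]
  refine Submodule.smul_mem _ _ ?_
  obtain ⟨s, hs⟩ : ∃ s : G, s • (Quotient.mk _ i : MulAction.orbitRel.Quotient G ι).out = i :=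
    (MulAction.orbitRel G ι).symm (Quotient.mk_out (s := MulAction.orbitRel G ι) i)
  refine Submodule.subset_span
    ⟨(s, Pi.single (Quotient.mk _ i : MulAction.orbitRel.Quotient G ι).out 1), ?_⟩
  simp only [functionRep_single]
  rw [hs]

variable {G M ι : Type} [Group G] [AddCommGroup M] [MulAction G ι]

/-- A finite equivariant family `ω` of functionals on a `G`-lattice such that every functional
invariant under a subgroup `H` is an `H`-invariant integral combination of the `ω i`. -/
structure IsFlabbyFamily (ρM : Representation ℤ G M) (ω : ι → M →ₗ[ℤ] ℤ) : Prop where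
  equivariant : ∀ (s : G) (i : ι) (m : M), ω (s • i) (ρM s m) = ω i m
  exists_coeff : ∀ (H : Subgroup G) (x : M →ₗ[ℤ] ℤ), (∀ s ∈ H, ∀ m, x (ρM s m) = x m) →
    ∃ c : ι → ℤ, (∀ s ∈ H, ∀ i, c (s • i) = c i) ∧ ∀ m, x m = ∑ᶠ i, c i * ω i m

namespace IsFlabbyFamily

variable {ρM : Representation ℤ G M} {ω : ι → M →ₗ[ℤ] ℤ}

theorem equivariant_pi (h : IsFlabbyFamily ρM ω) (s : G) (m : M) :
    LinearMap.pi ω (ρM s m) = functionRep ℤ G ι s (LinearMap.pi ω m) := by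
  ext i
  rw [functionRep_apply, LinearMap.pi_apply, LinearMap.pi_apply, ← h.equivariant s (s⁻¹ • i),
    smul_inv_smul]

theorem injective_pi [Module.Free ℤ M] (h : IsFlabbyFamily ρM ω) :
    Function.Injective (LinearMap.pi ω) := by
  rw [injective_iff_map_eq_zero]
  intro m hm
  rw [← Module.forall_dual_apply_eq_zero_iff ℤ]
  intro x
  obtain ⟨c, -, hc⟩ := h.exists_coeff ⊥ x (by
    intro s hs m
    rw [Subgroup.mem_bot.1 hs, map_one, Module.End.one_apply])
  rw [hc]
  have : ∀ i, ω i m = 0 := fun i => congrFun hm i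
  simp [this]

variable [Finite ι]

/-- A function on `ι` with a nonzero multiple in the sum of the lattice and the augmentation
submodule of `H` already lies in that sum. -/
theorem exists_sub_mem_coinvariantsKer (h : IsFlabbyFamily ρM ω) (H : Subgroup G)
    (p : ι → ℤ) (n : ℤ) (hn : n ≠ 0) (m : M)
    (hp : n • p - LinearMap.pi ω m ∈
      Representation.Coinvariants.ker ((functionRep ℤ G ι).comp H.subtype)) :
    ∃ m', p - LinearMap.pi ω m' ∈
      Representation.Coinvariants.ker ((functionRep ℤ G ι).comp H.subtype) := by
  classical
  have := Fintype.ofFinite ι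
  let O := MulAction.orbitRel.Quotient H ι
  have := Fintype.ofFinite O
  let mk : ι → O := fun i => Quotient.mk _ i
  have mk_smul : ∀ (s : H) i, mk (s • i) = mk i := fun s i => Quotient.sound ⟨s, rfl⟩
  -- The map `q` of orbit sums is the passage to `H`-coinvariants, so the claim becomes that the
  -- image `A` of the lattice in `O → ℤ` is saturated.
  let q : (ι → ℤ) →ₗ[ℤ] (O → ℤ) := LinearMap.pi fun o => ∑ i with mk i = o, LinearMap.proj i
  have hq : ∀ p o, q p o = ∑ i with mk i = o, p i := by
    intro p o
    simp [q]
  have hqs : ∀ (d : O → ℤ) (p : ι → ℤ), ∑ o, d o * q p o = ∑ i, d (mk i) * p i := by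
    intro d p
    rw [← Finset.sum_fiberwise (s := Finset.univ) (g := mk)]
    refine Finset.sum_congr rfl fun o _ => ?_
    rw [hq, Finset.mul_sum]
    refine Finset.sum_congr rfl fun i hi => ?_
    rw [(Finset.mem_filter.1 hi).2]
  have hqker : Representation.Coinvariants.ker ((functionRep ℤ G ι).comp H.subtype) ≤
      LinearMap.ker q := by
    refine Submodule.span_le.2 ?_
    rintro _ ⟨⟨s, y⟩, rfl⟩
    simp only [SetLike.mem_coe, LinearMap.mem_ker, map_sub, sub_eq_zero]
    ext o
    rw [hq, hq]
    refine Finset.sum_bijective (fun i => s⁻¹ • i) (MulAction.bijective _) ?_ ?_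
    · intro i
      simp [mk_smul]
    · intro i _
      rfl
  let A := LinearMap.range (q ∘ₗ LinearMap.pi ω)
  let b := Module.Free.chooseBasis ℤ A
  have hx : ∀ j, ∃ d : O → ℤ, ∀ a : A, b.repr a j = ∑ o, d o * (a : O → ℤ) o := by
    intro j
    -- A coordinate of `A` pulls back to an `H`-invariant functional on the lattice. Its
    -- `H`-invariant coefficients descend to the orbits and extend the coordinate to `O → ℤ`.
    obtain ⟨c, hc, hcx⟩ := h.exists_coeff H (b.coord j ∘ₗ (q ∘ₗ LinearMap.pi ω).rangeRestrict) (by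
      intro s hs m
      have : (q ∘ₗ LinearMap.pi ω) (ρM s m) = (q ∘ₗ LinearMap.pi ω) m := by
        rw [LinearMap.comp_apply, LinearMap.comp_apply, h.equivariant_pi, ← sub_eq_zero, ← map_sub]
        exact hqker (Submodule.subset_span ⟨(⟨s, hs⟩, LinearMap.pi ω m), rfl⟩)
      rw [LinearMap.comp_apply, LinearMap.comp_apply]
      congr 1
      exact Subtype.ext this)
    refine ⟨Quotient.lift c ?_, ?_⟩
    · rintro _ i ⟨s, rfl⟩
      exact hc s s.2 i
    · rintro ⟨_, m, rfl⟩
      refine (hcx m).trans ?_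
      rw [finsum_eq_sum_of_fintype]
      exact (hqs (Quotient.lift c _) (LinearMap.pi ω m)).symm
  choose d hd using hx
  -- The extended coordinates give a retraction onto `A`, so `A` is a direct summand.
  let r : (O → ℤ) →ₗ[ℤ] (O → ℤ) :=
    ∑ j, (∑ o, d j o • LinearMap.proj o : (O → ℤ) →ₗ[ℤ] ℤ).smulRight (b j : O → ℤ)
  have hrA : ∀ y, r y ∈ A := by
    intro y
    simp only [r, LinearMap.sum_apply, LinearMap.smulRight_apply]
    exact Submodule.sum_mem _ fun j _ => Submodule.smul_mem _ _ (b j).2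
  have hr : ∀ a : A, r a = a := by
    intro a
    conv_rhs => rw [← b.sum_repr a]
    simp [r, hd]
  have key : n • q p = q (LinearMap.pi ω m) := by
    rw [← map_smul, ← sub_eq_zero, ← map_sub]
    exact hqker hp
  have hqp : q p ∈ A := by
    have h1 : r (n • q p) = n • q p := by
      rw [key]
      exact hr ⟨_, m, rfl⟩
    rw [map_smul] at h1
    rw [← smul_right_injective _ hn h1]
    exact hrA _
  obtain ⟨m', hm'⟩ := hqp
  refine ⟨m', mem_coinvariantsKer_functionRep (G := H) _ fun o => ?_⟩
  have : q (p - LinearMap.pi ω m') o = 0 := by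
    rw [map_sub, ← hm']
    simp
  rwa [hq] at this

variable {F : Type} [AddCommGroup F] {ρF : Representation ℤ G F}

/-- This is the saturation statement for the trivial subgroup, whose augmentation submodule is zero.
-/
theorem mem_range_of_smul_mem (h : IsFlabbyFamily ρM ω) (p : ι → ℤ) (n : ℤ) (hn : n ≠ 0)
    (hp : n • p ∈ LinearMap.range (LinearMap.pi ω)) : p ∈ LinearMap.range (LinearMap.pi ω) := by
  obtain ⟨m, hm⟩ := hp
  obtain ⟨m', hm'⟩ := h.exists_sub_mem_coinvariantsKer ⊥ p n hn m (by rw [hm, sub_self]; simp)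
  have : Representation.Coinvariants.ker ((functionRep ℤ G ι).comp (⊥ : Subgroup G).subtype) = ⊥ := by
    rw [eq_bot_iff]
    refine Submodule.span_le.2 ?_
    rintro _ ⟨⟨s, y⟩, rfl⟩
    simp [Subsingleton.elim s 1]
  rw [this, Submodule.mem_bot, sub_eq_zero] at hm'
  exact ⟨m', hm'.symm⟩

theorem isTorsionFree (h : IsFlabbyFamily ρM ω) (g : (ι → ℤ) →ₗ[ℤ] F)
    (ex : Function.Exact (LinearMap.pi ω) g) (sur : Function.Surjective g) :
    Module.IsTorsionFree ℤ F := by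
  refine Module.IsTorsionFree.of_smul_eq_zero fun n x hx => ?_
  obtain ⟨p, rfl⟩ := sur x
  rw [or_iff_not_imp_left]
  intro hn
  rw [← map_smul] at hx
  exact (ex p).2 (h.mem_range_of_smul_mem p n hn ((ex _).1 hx))

/-- If the norm of `g p` vanishes, the norm of `p` comes from the lattice, and it is congruent to
`|H| p` modulo the augmentation submodule. Saturation then puts `p` itself in the sum of the lattice
and that submodule. -/
theorem normKernelsVanish [Finite G] (h : IsFlabbyFamily ρM ω) (g : (ι → ℤ) →ₗ[ℤ] F)
    (hg : ∀ s v, g (functionRep ℤ G ι s v) = ρF s (g v))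
    (ex : Function.Exact (LinearMap.pi ω) g) (sur : Function.Surjective g) :
    NormKernelsVanish ρF := by
  intro H x hx
  have := Fintype.ofFinite H
  obtain ⟨p, rfl⟩ := sur x
  rw [finsum_eq_sum_of_fintype] at hx
  simp only [← hg, ← map_sum] at hx
  obtain ⟨m, hm⟩ := (ex _).1 hx
  obtain ⟨m', hm'⟩ := h.exists_sub_mem_coinvariantsKer H p (Fintype.card H)
    (by exact_mod_cast Fintype.card_ne_zero) m (by
      rw [hm, ← neg_mem_iff, neg_sub]
      have : ((Fintype.card H : ℤ) • p) = ∑ s : H, p := by simp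
      rw [this, ← Finset.sum_sub_distrib]
      exact Submodule.sum_mem _ fun s _ => Submodule.subset_span ⟨(s, p), rfl⟩)
  have h1 : g p = g (p - LinearMap.pi ω m') := by
    have : g (LinearMap.pi ω m') = 0 := (ex _).2 ⟨m', rfl⟩
    rw [map_sub, this, sub_zero]
  have h2 : Representation.Coinvariants.ker ((functionRep ℤ G ι).comp H.subtype) ≤
      (Representation.Coinvariants.ker (ρF.comp H.subtype)).comap g := by
    refine Submodule.span_le.2 ?_
    rintro _ ⟨⟨s, y⟩, rfl⟩
    exact Submodule.subset_span ⟨(s, g y), by simp [hg]⟩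
  rw [h1]
  exact h2 hm'

end IsFlabbyFamily

end Functionals

/-! ### Existence of flabby resolutions. -/

section Existence

variable {G M : Type} [Group G] [Finite G] [AddCommGroup M]

/-- A finite group has finitely many subgroups, and the invariant functionals of each form a
finitely generated group. Generators for all subgroups, closed up under translation, are enough. -/
theorem exists_isFlabbyFamily [Module.Finite ℤ M] [Module.Free ℤ M] (ρ : Representation ℤ G M) :
    ∃ (ι : Type) (_ : Finite ι) (_ : MulAction G ι) (ω : ι → M →ₗ[ℤ] ℤ), IsFlabbyFamily ρ ω := by
  classical
  let inv : Subgroup G → Submodule ℤ (M →ₗ[ℤ] ℤ) := fun H =>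
    { carrier := {x | ∀ s ∈ H, ∀ m, x (ρ s m) = x m}
      add_mem' := fun hx hy s hs m => by simp [hx s hs, hy s hs]
      zero_mem' := fun s hs m => rfl
      smul_mem' := fun c x hx s hs m => by simp [hx s hs] }
  have hgen : ∀ H, ∃ S : Finset (M →ₗ[ℤ] ℤ), Submodule.span ℤ (S : Set (M →ₗ[ℤ] ℤ)) = inv H :=
    fun H => IsNoetherian.noetherian (inv H)
  choose gen hgen using hgen
  have gen_inv : ∀ H, ∀ k ∈ gen H, ∀ s ∈ H, ∀ m, k (ρ s m) = k m := by
    intro H k hk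
    have : k ∈ inv H := by
      rw [← hgen]
      exact Submodule.subset_span hk
    exact this
  let Ω : Set (M →ₗ[ℤ] ℤ) :=
    Set.range fun a : (Σ H, {k // k ∈ gen H}) × G => (a.1.2 : M →ₗ[ℤ] ℤ) ∘ₗ ρ a.2
  have hΩ : ∀ (s : G) (x : Ω), (x : M →ₗ[ℤ] ℤ) ∘ₗ ρ s⁻¹ ∈ Ω := by
    rintro s ⟨_, ⟨k, g⟩, rfl⟩
    refine ⟨(k, g * s⁻¹), ?_⟩
    ext m
    simp
  let act : MulAction G Ω :=
    { smul := fun s x => ⟨_, hΩ s x⟩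
      one_smul := fun x => Subtype.ext (LinearMap.ext fun m => by
        change (x : M →ₗ[ℤ] ℤ) (ρ 1⁻¹ m) = _
        simp)
      mul_smul := fun s t x => Subtype.ext (LinearMap.ext fun m => by
        change (x : M →ₗ[ℤ] ℤ) (ρ (s * t)⁻¹ m) = (x : M →ₗ[ℤ] ℤ) (ρ t⁻¹ (ρ s⁻¹ m))
        simp) }
  have smul_apply : ∀ (s : G) (x : Ω) (m : M),
      ((s • x : Ω) : M →ₗ[ℤ] ℤ) m = (x : M →ₗ[ℤ] ℤ) (ρ s⁻¹ m) := fun s x m => rfl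
  refine ⟨Ω, (Set.finite_range _).to_subtype, act, Subtype.val, ⟨fun s x m => ?_, fun H x hx => ?_⟩⟩
  · rw [smul_apply, ← Module.End.mul_apply, ← map_mul]
    simp
  · have hmem : x ∈ Submodule.span ℤ (gen H : Set (M →ₗ[ℤ] ℤ)) := by
      rw [hgen]
      exact hx
    obtain ⟨a, -, ha⟩ := Submodule.mem_span_finset.1 hmem
    have := Fintype.ofFinite Ω
    -- Chosen generators for `H` are fixed points of `H`; coefficients supported on them are
    -- therefore automatically `H`-invariant.
    have fixed : ∀ s ∈ H, ∀ k : Ω, (k : M →ₗ[ℤ] ℤ) ∈ gen H → s • k = k := by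
      intro s hs k hk
      refine Subtype.ext (LinearMap.ext fun m => ?_)
      rw [smul_apply, gen_inv H _ hk _ (inv_mem hs)]
    refine ⟨fun k => if (k : M →ₗ[ℤ] ℤ) ∈ gen H then a k else 0, fun s hs k => ?_, fun m => ?_⟩
    · by_cases hk : (k : M →ₗ[ℤ] ℤ) ∈ gen H
      · rw [fixed s hs k hk]
      · beta_reduce
        have : ((s • k : Ω) : M →ₗ[ℤ] ℤ) ∉ gen H := by
          intro h
          have := fixed _ (inv_mem hs) _ h
          rw [inv_smul_smul] at this
          exact hk (this ▸ h)
        rw [if_neg hk, if_neg this]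
    · rw [← ha, LinearMap.sum_apply, finsum_eq_sum_of_fintype]
      have hsub : ∀ k ∈ gen H, k ∈ Ω := by
        intro k hk
        refine ⟨(⟨H, k, hk⟩, 1), ?_⟩
        ext m
        simp
      simp only [ite_mul, zero_mul]
      rw [← Finset.sum_filter]
      refine Finset.sum_bij' (fun k hk => ⟨k, hsub k hk⟩) (fun k _ => k) ?_ ?_ ?_ ?_ ?_
      · intro k hk
        simpa using hk
      · intro k hk
        simpa using hk
      · intro k hk
        rfl
      · intro k hk
        rfl
      · intro k hk
        simp

/-- Every lattice over a finite group has a flabby resolution. -/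
theorem nonempty_flabbyResolution [Module.Finite ℤ M] [Module.Free ℤ M]
    (ρ : Representation ℤ G M) : Nonempty (FlabbyResolution ρ) := by
  obtain ⟨ι, hι, act, ω, h⟩ := exists_isFlabbyFamily ρ
  let f := LinearMap.pi ω
  have hle : ∀ s, LinearMap.range f ≤ (LinearMap.range f).comap (functionRep ℤ G ι s) := by
    rintro s _ ⟨m, rfl⟩
    exact ⟨ρ s m, h.equivariant_pi s m⟩
  have ex : Function.Exact f (LinearMap.range f).mkQ := LinearMap.exact_map_mkQ_range f
  have sur := (LinearMap.range f).mkQ_surjective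
  let ρF := (functionRep ℤ G ι).quotient (LinearMap.range f) hle
  have hg : ∀ s v, (LinearMap.range f).mkQ (functionRep ℤ G ι s v) =
    ρF s ((LinearMap.range f).mkQ v) := fun s v => rfl
  have tf := h.isTorsionFree _ ex sur
  exact ⟨{
    P := ι → ℤ
    repP := functionRep ℤ G ι
    F := (ι → ℤ) ⧸ LinearMap.range f
    repF := ρF
    f := ⟨f, fun s => LinearMap.ext (h.equivariant_pi s)⟩
    g := ⟨(LinearMap.range f).mkQ, fun s => LinearMap.ext (hg s)⟩
    permutation_P := isPermutationRep_functionRep ℤ G ι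
    lattice_F := ⟨inferInstance, Module.free_of_finite_type_torsion_free'⟩
    flabby_F := (isFlabbyRep_iff _).2 (h.normKernelsVanish _ hg ex sur)
    injective_f := h.injective_pi
    exact_fg := ex
    surjective_g := sur }⟩

end Existence

/-! ### Direct sums of representations and the exchange property of local summands. -/

section DirectSums

namespace Representation

variable {R G : Type*} [CommRing R] [Group G]
variable {A B C D X : Type*} [AddCommGroup A] [Module R A] [AddCommGroup B] [Module R B]
  [AddCommGroup C] [Module R C] [AddCommGroup D] [Module R D] [AddCommGroup X] [Module R X]

theorem Equiv.map_apply {α : Representation R G A} {β : Representation R G B} (e : Equiv α β)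
    (g : G) (v : A) : e (α g v) = β g (e v) :=
  LinearMap.congr_fun (e.isIntertwining' g) v

theorem nonempty_equiv_prodComm (α : Representation R G A) (β : Representation R G B) :
    Nonempty (Equiv (α.prod β) (β.prod α)) :=
  ⟨Equiv.mk (LinearEquiv.prodComm R A B) fun _ => rfl⟩

theorem nonempty_equiv_prodAssoc (α : Representation R G A) (β : Representation R G B)
    (γ : Representation R G C) :
    Nonempty (Equiv ((α.prod β).prod γ) (α.prod (β.prod γ))) :=
  ⟨Equiv.mk (LinearEquiv.prodAssoc R A B C) fun _ => rfl⟩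

theorem nonempty_equiv_prodCongr {α : Representation R G A} {β : Representation R G B}
    {γ : Representation R G C} {δ : Representation R G D} (h : Nonempty (Equiv α β))
    (h' : Nonempty (Equiv γ δ)) : Nonempty (Equiv (α.prod γ) (β.prod δ)) := by
  obtain ⟨e⟩ := h
  obtain ⟨e'⟩ := h'
  refine ⟨Equiv.mk (e.toLinearEquiv.prodCongr e'.toLinearEquiv) fun g => LinearMap.ext fun v => ?_⟩
  exact Prod.ext (e.map_apply g v.1) (e'.map_apply g v.2)

theorem nonempty_equiv_of_subsingleton_right (α : Representation R G A) (β : Representation R G B)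
    [Subsingleton B] : Nonempty (Equiv (α.prod β) α) :=
  have : Unique B := Unique.mk ⟨0⟩ fun _ => Subsingleton.elim _ _
  ⟨Equiv.mk LinearEquiv.prodUnique fun _ => rfl⟩

/-- Every equivariant endomorphism is invertible, or its difference from the identity is. -/
def IsLocal (ρ : Representation R G X) : Prop :=
  Nontrivial X ∧ ∀ f : X →ₗ[R] X, (∀ g v, f (ρ g v) = ρ g (f v)) →
    Function.Bijective f ∨ Function.Bijective (LinearMap.id - f : X →ₗ[R] X)

/-- If the composite `X → B → X` is an automorphism, then `X` splits off `B` with complement the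
kernel of the retraction `w`. Dividing `B ⊕ C` by the image of `X` gives `A` on one side and this
complement plus `C` on the other. -/
theorem nonempty_equiv_prod_of_bijective {α : Representation R G A} {β : Representation R G B}
    {γ : Representation R G C} {χ : Representation R G X}
    (Φ : Equiv (α.prod χ) (β.prod γ))
    (h : Function.Bijective fun x : X => (Φ.symm ((Φ (0, x)).1, 0)).2) :
    ∃ (B' : Submodule R B) (β' : Representation R G B'),
      Nonempty (Equiv β (β'.prod χ)) ∧ Nonempty (Equiv α (β'.prod γ)) := by
  let ΦL : (A × X) ≃ₗ[R] (B × C) := Φ.toLinearEquiv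
  let i : X →ₗ[R] B := LinearMap.fst R B C ∘ₗ ΦL.toLinearMap ∘ₗ LinearMap.inr R A X
  let j : X →ₗ[R] C := LinearMap.snd R B C ∘ₗ ΦL.toLinearMap ∘ₗ LinearMap.inr R A X
  let p : B →ₗ[R] X := LinearMap.snd R A X ∘ₗ ΦL.symm.toLinearMap ∘ₗ LinearMap.inl R B C
  have hΦ : ∀ g v, ΦL ((α.prod χ) g v) = (β.prod γ) g (ΦL v) := fun g v => Φ.map_apply g v
  have hΦ' : ∀ g v, ΦL.symm ((β.prod γ) g v) = (α.prod χ) g (ΦL.symm v) :=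
    fun g v => Φ.symm.map_apply g v
  have hi : ∀ g x, i (χ g x) = β g (i x) := fun g x => by
    have := hΦ g (0, x)
    simp only [prod_apply_apply, map_zero] at this
    exact congrArg Prod.fst this
  have hj : ∀ g x, j (χ g x) = γ g (j x) := fun g x => by
    have := hΦ g (0, x)
    simp only [prod_apply_apply, map_zero] at this
    exact congrArg Prod.snd this
  have hp : ∀ g b, p (β g b) = χ g (p b) := fun g x => by
    have := hΦ' g (x, 0)
    simp only [prod_apply_apply, map_zero] at this
    exact congrArg Prod.snd this
  let u : X ≃ₗ[R] X := LinearEquiv.ofBijective (p ∘ₗ i) h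
  have hu : ∀ g x, u.symm (χ g x) = χ g (u.symm x) := by
    intro g x
    rw [LinearEquiv.symm_apply_eq]
    have hu0 : ∀ x, u x = p (i x) := fun _ => rfl
    rw [hu0, hi, hp, ← hu0, LinearEquiv.apply_symm_apply]
  let w : B →ₗ[R] X := u.symm.toLinearMap ∘ₗ p
  have hw : ∀ g b, w (β g b) = χ g (w b) := fun g b => by
    simp only [w, LinearMap.comp_apply, hp, LinearEquiv.coe_coe, hu]
  have hwi : ∀ x, w (i x) = x := fun x => u.symm_apply_apply x
  let K : Subrepresentation β := ⟨LinearMap.ker w, fun g v hv => by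
    rw [LinearMap.mem_ker] at hv ⊢
    rw [hw, hv, map_zero]⟩
  let r : B →ₗ[R] LinearMap.ker w := (LinearMap.id - i ∘ₗ w : B →ₗ[R] B).codRestrict _ fun b => by
    simp [hwi]
  have hr : ∀ b, (r b : B) = b - i (w b) := fun b => rfl
  have hrg : ∀ g b, r (β g b) = K.toRepresentation g (r b) := by
    intro g b
    apply Subtype.ext
    change (r (β g b) : B) = β g (r b)
    rw [hr, hr, map_sub, hw, hi]
  have hr1 : ∀ b : LinearMap.ker w, r b = b := by
    intro b
    apply Subtype.ext
    rw [hr, LinearMap.mem_ker.1 b.2, map_zero, sub_zero]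
  have hri : ∀ x, r (i x) = 0 := by
    intro x
    apply Subtype.ext
    rw [hr, hwi, sub_self]
    rfl
  refine ⟨LinearMap.ker w, K.toRepresentation, ?_, ?_⟩
  · refine nonempty_equiv_of_ker_eq (ρ := β) LinearMap.id (r.prod w) (fun _ _ => rfl) ?_
      Function.surjective_id ?_ ?_
    · intro g v
      exact Prod.ext (hrg g v) (hw g v)
    · rintro ⟨b, x⟩
      refine ⟨b + i x, Prod.ext ?_ ?_⟩
      · change r (b + i x) = b
        rw [map_add, hr1, hri, add_zero]
      · change w (b + i x) = x
        rw [map_add, hwi, LinearMap.mem_ker.1 b.2, zero_add]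
    · refine Submodule.ext fun b => ?_
      suffices b = 0 ↔ r b = 0 ∧ w b = 0 by simpa using this
      constructor
      · rintro rfl
        simp
      · rintro ⟨h1, h2⟩
        have := congrArg Subtype.val h1
        rwa [hr, h2, map_zero, sub_zero] at this
  · refine nonempty_equiv_of_ker_eq (ρ := β.prod γ)
      (LinearMap.fst R A X ∘ₗ ΦL.symm.toLinearMap)
      ((r ∘ₗ LinearMap.fst R B C).prod
        (LinearMap.snd R B C - j ∘ₗ w ∘ₗ LinearMap.fst R B C)) ?_ ?_ ?_ ?_ ?_
    · intro g v
      exact congrArg Prod.fst (hΦ' g v)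
    -- The correction by `j ∘ w` in the second coordinate makes this projection kill exactly the
    -- image of `X`, which lies diagonally in `B ⊕ C`.
    · intro g v
      refine Prod.ext (hrg g v.1) ?_
      change γ g v.2 - j (w (β g v.1)) = γ g (v.2 - j (w v.1))
      rw [hw, hj, map_sub]
    · intro a
      exact ⟨ΦL (a, 0), by simp⟩
    · rintro ⟨b, c⟩
      refine ⟨(b, c), Prod.ext (hr1 b) ?_⟩
      change c - j (w b) = c
      rw [LinearMap.mem_ker.1 b.2, map_zero, sub_zero]
    · refine Submodule.ext ?_
      rintro ⟨b, c⟩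
      suffices (ΦL.symm (b, c)).1 = 0 ↔ r b = 0 ∧ c - j (w b) = 0 by simpa using this
      constructor
      · intro h0
        obtain ⟨x, hx⟩ : ∃ x, ΦL (0, x) = (b, c) :=
          ⟨(ΦL.symm (b, c)).2, by
            rw [← LinearEquiv.eq_symm_apply]
            exact Prod.ext h0.symm rfl⟩
        have hb : b = i x := (congrArg Prod.fst hx).symm
        have hc : c = j x := (congrArg Prod.snd hx).symm
        rw [hb, hc, hri, hwi, sub_self]
        exact ⟨rfl, rfl⟩
      · rintro ⟨h1, h2⟩
        have h1' : b = i (w b) := by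
          have := congrArg Subtype.val h1
          rwa [hr, ZeroMemClass.coe_zero, sub_eq_zero] at this
        have : (b, c) = ΦL (0, w b) := Prod.ext h1' (sub_eq_zero.1 h2)
        rw [this, LinearEquiv.symm_apply_apply]

/-- A local summand of a direct sum `B ⊕ C` can be split off from `B` or from `C`, without
changing the complement. -/
theorem IsLocal.cancel {α : Representation R G A} {β : Representation R G B}
    {γ : Representation R G C} {χ : Representation R G X} (hX : χ.IsLocal)
    (h : Nonempty (Equiv (α.prod χ) (β.prod γ))) :
    (∃ (B' : Submodule R B) (β' : Representation R G B'),
      Nonempty (Equiv β (β'.prod χ)) ∧ Nonempty (Equiv α (β'.prod γ))) ∨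
    (∃ (C' : Submodule R C) (γ' : Representation R G C'),
      Nonempty (Equiv γ (γ'.prod χ)) ∧ Nonempty (Equiv α (β.prod γ'))) := by
  obtain ⟨Φ⟩ := h
  let ΦL : (A × X) ≃ₗ[R] (B × C) := Φ.toLinearEquiv
  -- The part of the identity of `X` that passes through `B`; its complement passes through `C`, and
  -- locality makes one of the two an automorphism.
  let f : X →ₗ[R] X := LinearMap.snd R A X ∘ₗ ΦL.symm.toLinearMap ∘ₗ LinearMap.inl R B C ∘ₗ
    LinearMap.fst R B C ∘ₗ ΦL.toLinearMap ∘ₗ LinearMap.inr R A X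
  have hf : ∀ x, f x = (Φ.symm ((Φ (0, x)).1, 0)).2 := fun _ => rfl
  have hf' : ∀ x, (LinearMap.id - f : X →ₗ[R] X) x = (Φ.symm (0, (Φ (0, x)).2)).2 := by
    intro x
    have h1 : Φ.symm ((Φ (0, x)).1, 0) + Φ.symm (0, (Φ (0, x)).2) = (0, x) := by
      rw [← map_add, Prod.mk_add_mk, add_zero, zero_add]
      exact Φ.symm_apply_apply (0, x)
    rw [LinearMap.sub_apply, hf, LinearMap.id_apply, sub_eq_iff_eq_add']
    exact (congrArg Prod.snd h1).symm
  have hcomm : ∀ g v, f (χ g v) = χ g (f v) := by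
    intro g v
    have h1 : Φ (0, χ g v) = (β.prod γ) g (Φ (0, v)) := by
      rw [← Φ.map_apply]
      simp
    have h2 : Φ.symm (β g (Φ (0, v)).1, 0) = (α.prod χ) g (Φ.symm ((Φ (0, v)).1, 0)) := by
      rw [← Φ.symm.map_apply]
      simp
    rw [hf, hf, h1]
    exact congrArg Prod.snd h2
  rcases hX.2 f hcomm with hb | hb
  · exact Or.inl (nonempty_equiv_prod_of_bijective Φ hb)
  · right
    let e : Equiv (β.prod γ) (γ.prod β) := Equiv.mk (LinearEquiv.prodComm R B C) fun _ => rfl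
    have hb' : Function.Bijective
        fun x : X => ((Φ.trans e).symm (((Φ.trans e) (0, x)).1, 0)).2 := by
      convert hb using 1
      ext x
      rw [hf']
      rfl
    obtain ⟨C', γ', h1, h2⟩ := nonempty_equiv_prod_of_bijective (Φ.trans e) hb'
    obtain ⟨a⟩ := h2
    obtain ⟨c⟩ := nonempty_equiv_prodComm γ' β
    exact ⟨C', γ', h1, ⟨a.trans c⟩⟩

end Representation

end DirectSums

/-! ### Reduction modulo `p` and invariant functionals of `p`-groups. -/

section ModP

variable {p : ℕ} [Fact p.Prime] {V ι : Type*} [AddCommGroup V] [Module ℤ_[p] V] [Fintype ι]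
  [DecidableEq ι]

/-- The reduction modulo `p` of the matrix of an endomorphism of a `ℤ_p`-lattice. -/
noncomputable def redMatrix (b : Module.Basis ι ℤ_[p] V) :
    Module.End ℤ_[p] V →+* Matrix ι ι (ZMod p) :=
  (PadicInt.toZMod (p := p)).mapMatrix.comp (LinearMap.toMatrixAlgEquiv b : _ →+* _)

theorem redMatrix_apply (b : Module.Basis ι ℤ_[p] V) (f : Module.End ℤ_[p] V) (i j : ι) :
    redMatrix b f i j = PadicInt.toZMod (b.repr (f (b j)) i) := by
  simp [redMatrix, LinearMap.toMatrixAlgEquiv_apply]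

/-- The ring `ℤ_p` is local with residue field `ZMod p`, so a determinant with nonzero reduction is
a unit. -/
theorem bijective_of_det_redMatrix_ne_zero (b : Module.Basis ι ℤ_[p] V)
    (f : Module.End ℤ_[p] V) (h : (redMatrix b f).det ≠ 0) : Function.Bijective f := by
  have h1 : (redMatrix b f).det = PadicInt.toZMod (LinearMap.toMatrix b b f).det := by
    rw [RingHom.map_det]
    rfl
  have h2 : IsUnit (LinearMap.toMatrix b b f).det := by
    by_contra hn
    rw [h1] at h
    apply h
    rw [← RingHom.mem_ker, PadicInt.ker_toZMod]
    exact hn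
  exact (LinearEquiv.ofIsUnitDet h2).bijective

/-- For a `p`-group, an equivariant endomorphism that is not bijective is annihilated by a nonzero
invariant functional modulo `p`. -/
theorem exists_invariant_vecMul_eq_zero {S : Type*} [Group S] (hS : IsPGroup p S)
    (ρ : Representation ℤ_[p] S V) (b : Module.Basis ι ℤ_[p] V) (f : Module.End ℤ_[p] V)
    (hf : ∀ s v, f (ρ s v) = ρ s (f v)) (hn : ¬ Function.Bijective f) :
    ∃ l : ι → ZMod p, l ≠ 0 ∧ Matrix.vecMul l (redMatrix b f) = 0 ∧
      ∀ s, Matrix.vecMul l (redMatrix b (ρ s)) = l := by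
  have hcomm : ∀ s, redMatrix b (ρ s) * redMatrix b f = redMatrix b f * redMatrix b (ρ s) := by
    intro s
    rw [← map_mul, ← map_mul]
    congr 1
    exact LinearMap.ext fun v => (hf s v).symm
  have hdet : (redMatrix b f).det = 0 := by
    by_contra h
    exact hn (bijective_of_det_redMatrix_ne_zero b f h)
  obtain ⟨l, hl, hlf⟩ := Matrix.exists_vecMul_eq_zero_iff.2 hdet
  -- The functionals killed by `f` modulo `p` form a nonzero finite `ZMod p`-space stable under the
  -- `p`-group. Its cardinality is divisible by `p` and zero is fixed, so there is another fixed
  -- point.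
  let K : Submodule (ZMod p) (ι → ZMod p) := LinearMap.ker (Matrix.vecMulLinear (redMatrix b f))
  have hK : ∀ {x}, x ∈ K ↔ Matrix.vecMul x (redMatrix b f) = 0 := Iff.rfl
  let act : MulAction S K :=
    { smul := fun s x => ⟨Matrix.vecMul x (redMatrix b (ρ s⁻¹)), by
        rw [hK, Matrix.vecMul_vecMul, hcomm, ← Matrix.vecMul_vecMul, hK.1 x.2,
          Matrix.zero_vecMul]⟩
      one_smul := fun x => Subtype.ext (by
        change Matrix.vecMul (x : ι → ZMod p) (redMatrix b (ρ 1⁻¹)) = x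
        rw [inv_one, map_one, map_one, Matrix.vecMul_one])
      mul_smul := fun s t x => Subtype.ext (by
        change Matrix.vecMul (x : ι → ZMod p) (redMatrix b (ρ (s * t)⁻¹)) =
          Matrix.vecMul (Matrix.vecMul (x : ι → ZMod p) (redMatrix b (ρ t⁻¹)))
            (redMatrix b (ρ s⁻¹))
        rw [Matrix.vecMul_vecMul, ← map_mul, ← map_mul, mul_inv_rev]) }
  have smul_coe : ∀ (s : S) (x : K), ((s • x : K) : ι → ZMod p) =
    Matrix.vecMul (x : ι → ZMod p) (redMatrix b (ρ s⁻¹)) := fun _ _ => rfl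
  have : Nontrivial K := ⟨⟨l, hlf⟩, 0, fun h => hl (congrArg Subtype.val h)⟩
  have hcard : p ∣ Nat.card K := by
    rw [Module.natCard_eq_pow_finrank (K := ZMod p), Nat.card_zmod]
    exact dvd_pow_self p (Module.finrank_pos (R := ZMod p) (M := K)).ne'
  have h0 : (0 : K) ∈ MulAction.fixedPoints S K := by
    intro s
    apply Subtype.ext
    rw [smul_coe, ZeroMemClass.coe_zero, Matrix.zero_vecMul]
  obtain ⟨x, hx, hx0⟩ := hS.exists_fixed_point_of_prime_dvd_card_of_fixed_point K hcard h0
  refine ⟨x, fun h => hx0 (Subtype.ext h.symm), hK.1 x.2, fun s => ?_⟩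
  have := congrArg Subtype.val (hx s⁻¹)
  rwa [smul_coe, inv_inv] at this

/-- Transitive permutation lattices of a `p`-group over `ℤ_p` are local. -/
theorem isLocal_functionRep {S κ : Type*} [Group S] (hS : IsPGroup p S) [MulAction S κ] [Finite κ]
    [Nonempty κ] [MulAction.IsPretransitive S κ] : (functionRep ℤ_[p] S κ).IsLocal := by
  classical
  have := Fintype.ofFinite κ
  refine ⟨inferInstance, fun f hf => ?_⟩
  let b := Pi.basisFun ℤ_[p] κ
  obtain ⟨a⟩ := ‹Nonempty κ›
  have key : ∀ f : Module.End ℤ_[p] (κ → ℤ_[p]),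
      (∀ s v, f (functionRep ℤ_[p] S κ s v) = functionRep ℤ_[p] S κ s (f v)) →
      ∑ i, redMatrix b f i a ≠ 0 → Function.Bijective f := by
    intro f hf h
    by_contra hn
    obtain ⟨l, hl, hlf, hls⟩ := exists_invariant_vecMul_eq_zero hS _ b f hf hn
    -- By transitivity an invariant functional is constant, and a nonzero constant functional killed
    -- by `f` forces the column sum at `a` to vanish.
    have hconst : ∀ j, l j = l a := by
      intro j
      obtain ⟨s, rfl⟩ := MulAction.exists_smul_eq S a j
      have := congrFun (hls s) a
      simp only [Matrix.vecMul, dotProduct, redMatrix_apply, b, Pi.basisFun_apply,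
        functionRep_single, Pi.basisFun_repr] at this
      rw [← this, Finset.sum_eq_single (s • a)]
      · simp
      · intro i _ hi
        simp [hi]
      · simp
    have h2 := congrFun hlf a
    simp only [Matrix.vecMul, dotProduct, hconst, ← Finset.mul_sum, Pi.zero_apply] at h2
    have h3 := (mul_eq_zero.1 h2).resolve_right h
    exact hl (funext fun j => (hconst j).trans h3)
  by_cases h : ∑ i, redMatrix b f i a = 0
  · right
    refine key (LinearMap.id - f) (fun s v => by simp [hf]) ?_
    -- Column sums of `f` and `id - f` at `a` add up to `1`, so they cannot both vanish.
    have h1 : redMatrix b (LinearMap.id - f) = 1 - redMatrix b f := by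
      rw [map_sub, ← Module.End.one_eq_id, map_one]
    rw [h1]
    simp only [Matrix.sub_apply, Finset.sum_sub_distrib, h, sub_zero, Matrix.one_apply]
    simp
  · exact Or.inl (key f hf h)

end ModP

/-! ### Permutation summands and splitting along orbits. -/

section PermutationSummands

variable {R G : Type} [CommRing R] [Group G] {V W K : Type} [AddCommGroup V]
  [Module R V] [AddCommGroup W] [Module R W] [AddCommGroup K] [Module R K]

theorem IsPermutationRep.of_equiv {ρ : Representation R G V} {σ : Representation R G W}
    (h : IsPermutationRep ρ) (e : Representation.Equiv ρ σ) : IsPermutationRep σ := by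
  obtain ⟨ι, hι, b, hb⟩ := h
  refine ⟨ι, hι, b.map e.toLinearEquiv, fun g i => ?_⟩
  obtain ⟨j, hj⟩ := hb g i
  refine ⟨j, ?_⟩
  simp only [Module.Basis.map_apply]
  rw [← hj]
  exact (e.map_apply g (b i)).symm

theorem IsPermutationRep.prod {ρ : Representation R G V} {σ : Representation R G W}
    (h : IsPermutationRep ρ) (h' : IsPermutationRep σ) : IsPermutationRep (ρ.prod σ) := by
  obtain ⟨ι, hι, b, hb⟩ := h
  obtain ⟨κ, hκ, c, hc⟩ := h'
  refine ⟨ι ⊕ κ, inferInstance, b.prod c, fun g i => ?_⟩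
  rcases i with i | i
  · obtain ⟨j, hj⟩ := hb g i
    exact ⟨Sum.inl j, by simp [hj]⟩
  · obtain ⟨j, hj⟩ := hc g i
    exact ⟨Sum.inr j, by simp [hj]⟩

theorem IsPermutationRep.exists_equiv_functionRep [Nontrivial R] {ρ : Representation R G V}
    (h : IsPermutationRep ρ) : ∃ (ι : Type) (_ : Finite ι) (_ : MulAction G ι),
      Nonempty (Representation.Equiv ρ (functionRep R G ι)) := by
  obtain ⟨ι, hι, act, b, hb⟩ := h.exists_mulAction
  have := Fintype.ofFinite ι
  refine ⟨ι, hι, act, ⟨Representation.Equiv.mk b.equivFun fun g => LinearMap.ext fun v => ?_⟩⟩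
  ext i
  have := b.repr_permutation_smul hb g v (g⁻¹ • i)
  rw [smul_inv_smul] at this
  simpa [functionRep_apply] using this

/-- A permutation lattice splits along an orbit. -/
theorem nonempty_equiv_functionRep_orbit (G : Type) [Group G] {κ : Type} [MulAction G κ] (a : κ) :
    ∃ C : SubMulAction G κ, (C : Set κ) = (MulAction.orbit G a)ᶜ ∧
      Nonempty (Representation.Equiv (functionRep R G κ)
        ((functionRep R G (MulAction.orbit G a)).prod (functionRep R G C))) := by
  classical
  let C : SubMulAction G κ := ⟨(MulAction.orbit G a)ᶜ, fun g x hx => by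
    rintro ⟨s, hs⟩
    refine hx ⟨g⁻¹ * s, ?_⟩
    change (g⁻¹ * s) • a = x
    rw [mul_smul, inv_smul_eq_iff]
    exact hs⟩
  refine ⟨C, rfl, ?_⟩
  refine Representation.nonempty_equiv_of_ker_eq (ρ := functionRep R G κ) LinearMap.id
    ((LinearMap.funLeft R R Subtype.val).prod (LinearMap.funLeft R R Subtype.val))
    (fun _ _ => rfl) (fun _ _ => rfl) Function.surjective_id ?_ ?_
  · rintro ⟨x, y⟩
    refine ⟨fun i => if h : i ∈ MulAction.orbit G a then x ⟨i, h⟩ else y ⟨i, h⟩,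
      Prod.ext ?_ ?_⟩
    · ext i
      exact dif_pos i.2
    · ext i
      exact dif_neg i.2
  · refine (Submodule.ext fun v => ?_)
    rw [LinearMap.mem_ker, LinearMap.mem_ker]
    constructor
    · intro h
      rw [LinearMap.id_apply] at h
      rw [h, map_zero]
    · intro h
      ext i
      by_cases hi : i ∈ MulAction.orbit G a
      · exact congrFun (congrArg Prod.fst h) ⟨i, hi⟩
      · exact congrFun (congrArg Prod.snd h) ⟨i, hi⟩

theorem HasNoPermutationSummand.subsingleton {τ : Representation R G V}
    (h : HasNoPermutationSummand τ) {σ : Representation R G W} {κ : Representation R G K}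
    (e : Representation.Equiv τ (σ.prod κ)) (hκ : IsPermutationRep κ) : Subsingleton K := by
  let U : Subrepresentation τ := ⟨LinearMap.ker (LinearMap.fst R W K ∘ₗ e.toLinearEquiv.toLinearMap),
    fun g v hv => by
      have : (e v).1 = 0 := hv
      change (e (τ g v)).1 = 0
      rw [e.map_apply]
      change σ g (e v).1 = 0
      rw [this, map_zero]⟩
  let U' : Subrepresentation τ :=
    ⟨LinearMap.ker (LinearMap.snd R W K ∘ₗ e.toLinearEquiv.toLinearMap), fun g v hv => by
      have : (e v).2 = 0 := hv
      change (e (τ g v)).2 = 0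
      rw [e.map_apply]
      change κ g (e v).2 = 0
      rw [this, map_zero]⟩
  have hU : ∀ v, v ∈ U ↔ (e v).1 = 0 := fun v => Iff.rfl
  have hU' : ∀ v, v ∈ U' ↔ (e v).2 = 0 := fun v => Iff.rfl
  have inj : Function.Injective e := e.toLinearEquiv.injective
  have hc : IsCompl U U' := by
    constructor
    · intro X hX hX' v hv
      have h1 := (hU v).1 (hX hv)
      have h2 := (hU' v).1 (hX' hv)
      have : v = 0 := inj (by rw [map_zero]; exact Prod.ext h1 h2)
      rw [this]
      exact zero_mem (⊥ : Submodule R V)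
    · intro X hX hX' v _
      have h1 : e.symm (0, (e v).2) ∈ U := by
        rw [hU, e.apply_symm_apply]
      have h2 : e.symm ((e v).1, 0) ∈ U' := by
        rw [hU', e.apply_symm_apply]
      have h3 : v = e.symm (0, (e v).2) + e.symm ((e v).1, 0) := by
        rw [← map_add, Prod.mk_add_mk, zero_add, add_zero]
        exact (e.symm_apply_apply v).symm
      rw [h3]
      exact add_mem (S := Submodule R V) (s := X.toSubmodule) (hX h1) (hX' h2)
  have hperm : IsPermutationRep U.toRepresentation := by
    let l : K →ₗ[R] U.toSubmodule :=
      (e.toLinearEquiv.symm.toLinearMap ∘ₗ LinearMap.inr R W K).codRestrict _ fun k => by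
        change (e (e.symm (0, k))).1 = 0
        rw [e.apply_symm_apply]
    have hl : ∀ k, (l k : V) = e.symm (0, k) := fun k => rfl
    have hb : Function.Bijective l := by
      constructor
      · intro x y hxy
        have := congrArg (fun u : U.toSubmodule => (e u).2) hxy
        simpa [hl, e.apply_symm_apply] using this
      · intro u
        refine ⟨(e u).2, Subtype.ext ?_⟩
        have : (e u).1 = 0 := u.2
        rw [hl, ← this]
        exact e.symm_apply_apply _
    refine hκ.of_equiv (Representation.Equiv.mk (LinearEquiv.ofBijective l hb) fun g => ?_)
    refine LinearMap.ext fun k => Subtype.ext ?_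
    change e.symm (0, κ g k) = τ g (e.symm (0, k))
    rw [← e.symm.map_apply]
    simp
  have hbot := h U U' hc hperm
  refine subsingleton_of_forall_eq 0 fun k => ?_
  have h1 : e.symm (0, k) ∈ U := by rw [hU, e.apply_symm_apply]
  rw [hbot] at h1
  have h2 : e.symm (0, k) = 0 := h1
  have h3 := congrArg e h2
  rw [e.apply_symm_apply, map_zero] at h3
  exact congrArg Prod.snd h3

/-- The projection to a factor, or its complementary projection, is an automorphism; the factor it
kills is then zero. -/
theorem Representation.IsLocal.subsingleton_or {ρ : Representation R G V} (h : ρ.IsLocal)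
    {σ : Representation R G W} {κ : Representation R G K}
    (e : Representation.Equiv ρ (σ.prod κ)) : Subsingleton W ∨ Subsingleton K := by
  let f : V →ₗ[R] V := e.toLinearEquiv.symm.toLinearMap ∘ₗ LinearMap.inl R W K ∘ₗ
    LinearMap.fst R W K ∘ₗ e.toLinearEquiv.toLinearMap
  have hf : ∀ v, f v = e.symm ((e v).1, 0) := fun _ => rfl
  rcases h.2 f (fun g v => by
    rw [hf, hf, e.map_apply, ← e.symm.map_apply]
    simp) with hb | hb
  · right
    refine subsingleton_of_forall_eq 0 fun k => ?_
    have h1 : f (e.symm (0, k)) = f 0 := by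
      rw [hf, e.apply_symm_apply, map_zero]
      exact map_zero e.symm
    have h3 := congrArg e (hb.1 h1)
    rw [e.apply_symm_apply, map_zero] at h3
    exact congrArg Prod.snd h3
  · left
    refine subsingleton_of_forall_eq 0 fun w => ?_
    have h1 : (LinearMap.id - f : V →ₗ[R] V) (e.symm (w, 0)) = (LinearMap.id - f : V →ₗ[R] V) 0 := by
      rw [LinearMap.sub_apply, hf, e.apply_symm_apply, map_zero]
      exact sub_self _
    have h3 := congrArg e (hb.1 h1)
    rw [e.apply_symm_apply, map_zero] at h3
    exact congrArg Prod.fst h3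

end PermutationSummands

/-! ### Cancellation of permutation lattices over the `p`-adic integers. -/

section Cancellation

open Representation

variable {p : ℕ} [Fact p.Prime] {S : Type} [Group S]

/-- The orbits of `κ` are peeled off one at a time. If none is left, `χ` would be a nonzero
permutation summand of `β`, which is excluded. -/
theorem exists_equiv_prod_of_isLocal (hS : IsPGroup p S) {X : Type} [AddCommGroup X]
    [Module ℤ_[p] X] {χ : Representation ℤ_[p] S X} (hX : χ.IsLocal) (hXp : IsPermutationRep χ)
    {B : Type} [AddCommGroup B] [Module ℤ_[p] B] {β : Representation ℤ_[p] S B}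
    (hB : HasNoPermutationSummand β) (n : ℕ) :
    ∀ (κ : Type) [Finite κ] [MulAction S κ], Nat.card κ ≤ n →
    ∀ (A : Type) [AddCommGroup A] [Module ℤ_[p] A] (α : Representation ℤ_[p] S A),
      Nonempty (Equiv (α.prod χ) (β.prod (functionRep ℤ_[p] S κ))) →
      ∃ (Q : Type) (_ : AddCommGroup Q) (_ : Module ℤ_[p] Q) (σ : Representation ℤ_[p] S Q),
        IsPermutationRep σ ∧ Nonempty (Equiv α (β.prod σ)) := by
  have hXn : ¬ Subsingleton X := not_subsingleton_iff_nontrivial.2 hX.1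
  induction n with
  | zero =>
    intro κ _ _ hκ A _ _ α ⟨e⟩
    have : IsEmpty κ := Finite.card_eq_zero_iff.1 (Nat.le_zero.1 hκ)
    obtain ⟨e'⟩ := nonempty_equiv_of_subsingleton_right β (functionRep ℤ_[p] S κ)
    exact absurd (hB.subsingleton (e.trans e').symm hXp) hXn
  | succ n ih =>
    intro κ _ _ hκ A _ _ α ⟨e⟩
    rcases isEmpty_or_nonempty κ with _ | ⟨⟨a⟩⟩
    · obtain ⟨e'⟩ := nonempty_equiv_of_subsingleton_right β (functionRep ℤ_[p] S κ)
      exact absurd (hB.subsingleton (e.trans e').symm hXp) hXn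
    obtain ⟨C, hC, ⟨e1⟩⟩ := nonempty_equiv_functionRep_orbit (R := ℤ_[p]) S a
    have : Nonempty (MulAction.orbit S a) := ⟨⟨a, MulAction.mem_orbit_self a⟩⟩
    have hloc : (functionRep ℤ_[p] S (MulAction.orbit S a)).IsLocal := isLocal_functionRep hS
    obtain ⟨e2⟩ := nonempty_equiv_prodComm (functionRep ℤ_[p] S (MulAction.orbit S a))
      (functionRep ℤ_[p] S C)
    obtain ⟨e3⟩ := nonempty_equiv_prodCongr ⟨Representation.Equiv.refl β⟩ ⟨e1.trans e2⟩
    obtain ⟨e4⟩ := nonempty_equiv_prodAssoc β (functionRep ℤ_[p] S C)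
      (functionRep ℤ_[p] S (MulAction.orbit S a))
    -- Either `χ` splits off `β` plus the remaining orbits, and induction applies to the complement,
    -- or it splits off the lattice of the peeled orbit. The latter is local, so its complement is
    -- zero.
    rcases hX.cancel ⟨(e.trans e3).trans e4.symm⟩ with
      ⟨B', β', ⟨e5⟩, ⟨e6⟩⟩ | ⟨C', γ', ⟨e5⟩, ⟨e6⟩⟩
    · have hcard : Nat.card C ≤ n := by
        have h1 : Nat.card C < Nat.card κ := by
          have h2 : Set.ncard (C : Set κ) < Nat.card κ := by
            rw [← Set.ncard_univ]
            refine Set.ncard_lt_ncard ?_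
            rw [hC, Set.ssubset_univ_iff]
            intro h
            have : a ∈ (MulAction.orbit S a)ᶜ := h ▸ Set.mem_univ a
            exact this (MulAction.mem_orbit_self a)
          exact h2
        omega
      obtain ⟨Q, _, _, σ, hσ, ⟨e7⟩⟩ := ih C hcard B' β' ⟨e5.symm⟩
      refine ⟨Q × (MulAction.orbit S a → ℤ_[p]), inferInstance, inferInstance,
        σ.prod (functionRep ℤ_[p] S (MulAction.orbit S a)),
        hσ.prod (isPermutationRep_functionRep _ _ _), ?_⟩
      obtain ⟨e8⟩ := nonempty_equiv_prodCongr ⟨e7⟩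
        ⟨Representation.Equiv.refl (functionRep ℤ_[p] S (MulAction.orbit S a))⟩
      obtain ⟨e9⟩ := nonempty_equiv_prodAssoc β σ (functionRep ℤ_[p] S (MulAction.orbit S a))
      exact ⟨(e6.trans e8).trans e9⟩
    · have := (hloc.subsingleton_or e5).resolve_right hXn
      obtain ⟨e7⟩ := nonempty_equiv_of_subsingleton_right (β.prod (functionRep ℤ_[p] S C)) γ'
      exact ⟨_, _, _, functionRep ℤ_[p] S C, isPermutationRep_functionRep _ _ _, ⟨e6.trans e7⟩⟩

/-- Permutation lattices cancel from a direct sum with a lattice without permutation summands. -/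
theorem exists_equiv_prod_of_isPermutationRep (hS : IsPGroup p S)
    {B : Type} [AddCommGroup B] [Module ℤ_[p] B] {β : Representation ℤ_[p] S B}
    (hB : HasNoPermutationSummand β) {X C : Type} [AddCommGroup X] [Module ℤ_[p] X]
    [AddCommGroup C] [Module ℤ_[p] C] {χ : Representation ℤ_[p] S X}
    {γ : Representation ℤ_[p] S C} (hχ : IsPermutationRep χ) (hγ : IsPermutationRep γ)
    {A : Type} [AddCommGroup A] [Module ℤ_[p] A] {α : Representation ℤ_[p] S A}
    (h : Nonempty (Equiv (α.prod χ) (β.prod γ))) :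
    ∃ (Q : Type) (_ : AddCommGroup Q) (_ : Module ℤ_[p] Q) (σ : Representation ℤ_[p] S Q),
      IsPermutationRep σ ∧ Nonempty (Equiv α (β.prod σ)) := by
  obtain ⟨ι, hι, act, ⟨eχ⟩⟩ := hχ.exists_equiv_functionRep
  obtain ⟨e0⟩ := h
  obtain ⟨e1⟩ := nonempty_equiv_prodCongr ⟨Representation.Equiv.refl α⟩ ⟨eχ⟩
  replace h : Nonempty (Equiv (α.prod (functionRep ℤ_[p] S ι)) (β.prod γ)) := ⟨e1.symm.trans e0⟩
  clear eχ e1 e0 hχ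
  obtain ⟨n, hn⟩ : ∃ n, Nat.card ι ≤ n := ⟨_, le_rfl⟩
  induction n generalizing ι C with
  | zero =>
    have : IsEmpty ι := Finite.card_eq_zero_iff.1 (Nat.le_zero.1 hn)
    obtain ⟨e⟩ := h
    obtain ⟨e'⟩ := nonempty_equiv_of_subsingleton_right α (functionRep ℤ_[p] S ι)
    exact ⟨C, _, _, γ, hγ, ⟨e'.symm.trans e⟩⟩
  | succ n ih =>
    obtain ⟨e⟩ := h
    rcases isEmpty_or_nonempty ι with _ | ⟨⟨a⟩⟩
    · obtain ⟨e'⟩ := nonempty_equiv_of_subsingleton_right α (functionRep ℤ_[p] S ι)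
      exact ⟨C, _, _, γ, hγ, ⟨e'.symm.trans e⟩⟩
    obtain ⟨D, hD, ⟨e1⟩⟩ := nonempty_equiv_functionRep_orbit (R := ℤ_[p]) S a
    have : Nonempty (MulAction.orbit S a) := ⟨⟨a, MulAction.mem_orbit_self a⟩⟩
    have hloc : (functionRep ℤ_[p] S (MulAction.orbit S a)).IsLocal := isLocal_functionRep hS
    obtain ⟨e2⟩ := nonempty_equiv_prodComm (functionRep ℤ_[p] S (MulAction.orbit S a))
      (functionRep ℤ_[p] S D)
    obtain ⟨e3⟩ := nonempty_equiv_prodCongr ⟨Representation.Equiv.refl α⟩ ⟨e1.trans e2⟩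
    obtain ⟨e4⟩ := nonempty_equiv_prodAssoc α (functionRep ℤ_[p] S D)
      (functionRep ℤ_[p] S (MulAction.orbit S a))
    obtain ⟨κ, hκ, actκ, ⟨eγ⟩⟩ := hγ.exists_equiv_functionRep
    obtain ⟨e5⟩ := nonempty_equiv_prodCongr ⟨Representation.Equiv.refl β⟩ ⟨eγ⟩
    obtain ⟨Q, _, _, σ, hσ, ⟨e6⟩⟩ := exists_equiv_prod_of_isLocal hS hloc
      (isPermutationRep_functionRep _ _ _) hB _ κ le_rfl _ (α.prod (functionRep ℤ_[p] S D))
      ⟨((e3.trans e4.symm).symm.trans e).trans e5⟩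
    have hcard : Nat.card D ≤ n := by
      have h1 : Set.ncard (D : Set ι) < Nat.card ι := by
        rw [← Set.ncard_univ]
        refine Set.ncard_lt_ncard ?_
        rw [hD, Set.ssubset_univ_iff]
        intro h
        have : a ∈ (MulAction.orbit S a)ᶜ := h ▸ Set.mem_univ a
        exact this (MulAction.mem_orbit_self a)
      have h2 : Nat.card D < Nat.card ι := h1
      omega
    exact ih hσ D inferInstance inferInstance ⟨e6⟩ hcard

/-- Lattices without permutation summands that agree up to permutation lattices are isomorphic. -/
theorem nonempty_equiv_of_hasNoPermutationSummand (hS : IsPGroup p S)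
    {A B X C : Type} [AddCommGroup A] [Module ℤ_[p] A] [AddCommGroup B] [Module ℤ_[p] B]
    [AddCommGroup X] [Module ℤ_[p] X] [AddCommGroup C] [Module ℤ_[p] C]
    {α : Representation ℤ_[p] S A} {β : Representation ℤ_[p] S B} {χ : Representation ℤ_[p] S X}
    {γ : Representation ℤ_[p] S C} (hA : HasNoPermutationSummand α)
    (hB : HasNoPermutationSummand β) (hχ : IsPermutationRep χ) (hγ : IsPermutationRep γ)
    (h : Nonempty (Equiv (α.prod χ) (β.prod γ))) : Nonempty (Equiv α β) := by
  obtain ⟨Q, _, _, σ, hσ, ⟨e⟩⟩ := exists_equiv_prod_of_isPermutationRep hS hB hχ hγ h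
  have := hA.subsingleton e hσ
  obtain ⟨e'⟩ := nonempty_equiv_of_subsingleton_right β σ
  exact ⟨e.trans e'⟩

end Cancellation

/-! ### Indecomposability through idempotents. -/

section Indecomposable

variable {R G V W : Type*} [CommRing R] [Group G] [AddCommGroup V] [Module R V] [AddCommGroup W]
  [Module R W]

theorem Subrepresentation.isCompl_iff {ρ : Representation R G V} {U U' : Subrepresentation ρ} :
    IsCompl U U' ↔ IsCompl U.toSubmodule U'.toSubmodule := by
  rw [_root_.isCompl_iff, _root_.isCompl_iff, disjoint_iff, disjoint_iff, codisjoint_iff, codisjoint_iff,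
    ← Subrepresentation.toSubmodule_inf, ← Subrepresentation.toSubmodule_sup]
  exact and_congr Subrepresentation.toSubmodule_injective.eq_iff.symm
    Subrepresentation.toSubmodule_injective.eq_iff.symm

/-- Idempotent endomorphisms, unlike pairs of complementary submodules, can be reduced to matrices
modulo `2`. -/
theorem isIndecomposableRep_iff {ρ : Representation R G V} :
    IsIndecomposableRep ρ ↔ Nontrivial V ∧ ∀ e : V →ₗ[R] V, (∀ g v, e (ρ g v) = ρ g (e v)) →
      (∀ v, e (e v) = e v) → e = 0 ∨ e = LinearMap.id := by
  refine and_congr Iff.rfl ⟨fun h e he hee => ?_, fun h U U' hU => ?_⟩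
  · let U : Subrepresentation ρ := ⟨LinearMap.range e, by
      rintro g _ ⟨v, rfl⟩
      exact ⟨ρ g v, he g v⟩⟩
    let U' : Subrepresentation ρ := ⟨LinearMap.ker e, fun g v hv => by
      rw [LinearMap.mem_ker] at hv ⊢
      rw [he, hv, map_zero]⟩
    have hc : IsCompl U U' := Subrepresentation.isCompl_iff.2
      (LinearMap.IsIdempotentElem.isCompl (LinearMap.ext hee))
    rcases h U U' hc with h | h
    · left
      exact LinearMap.range_eq_bot.1 (congrArg Subrepresentation.toSubmodule h)
    · right
      ext v
      have : LinearMap.ker e = ⊥ := congrArg Subrepresentation.toSubmodule h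
      exact LinearMap.ker_eq_bot.1 this (hee v)
  · have hc := Subrepresentation.isCompl_iff.1 hU
    let e := U.toSubmodule.projection U'.toSubmodule hc
    have decomp : ∀ v, ∃ x ∈ U.toSubmodule, ∃ y ∈ U'.toSubmodule, x + y = v := fun v =>
      Submodule.mem_sup.1 (hc.sup_eq_top ▸ Submodule.mem_top)
    have hx : ∀ x ∈ U.toSubmodule, e x = x := fun x hx => Submodule.projection_apply_left hc ⟨x, hx⟩
    have hy : ∀ y ∈ U'.toSubmodule, e y = 0 := fun y hy => Submodule.projection_apply_right hc ⟨y, hy⟩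
    rcases h e (fun g v => by
      obtain ⟨x, hxU, y, hyU, rfl⟩ := decomp v
      rw [map_add, map_add, map_add, hx _ (U.apply_mem_toSubmodule g hxU), hx _ hxU,
        hy _ (U'.apply_mem_toSubmodule g hyU), hy _ hyU, add_zero, add_zero]) (fun v => by
      obtain ⟨x, hxU, y, hyU, rfl⟩ := decomp v
      rw [map_add, hx _ hxU, hy _ hyU, add_zero, hx _ hxU]) with h | h
    · left
      apply Subrepresentation.toSubmodule_injective
      refine (Submodule.eq_bot_iff _).2 fun x hxU => ?_
      rw [← hx x hxU, h, LinearMap.zero_apply]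
    · right
      apply Subrepresentation.toSubmodule_injective
      refine (Submodule.eq_bot_iff _).2 fun y hyU => ?_
      rw [← hy y hyU, h, LinearMap.id_apply]

theorem IsIndecomposableRep.of_equiv {ρ : Representation R G V} {σ : Representation R G W}
    (h : IsIndecomposableRep ρ) (φ : Representation.Equiv ρ σ) : IsIndecomposableRep σ := by
  rw [isIndecomposableRep_iff] at h ⊢
  refine ⟨φ.toLinearEquiv.symm.toEquiv.nontrivial_congr.2 h.1, fun e he hee => ?_⟩
  let e' : V →ₗ[R] V := φ.toLinearEquiv.symm.toLinearMap ∘ₗ e ∘ₗ φ.toLinearEquiv.toLinearMap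
  have he' : ∀ v, e' v = φ.symm (e (φ v)) := fun _ => rfl
  have key : ∀ w, e w = φ (e' (φ.symm w)) := fun w => by
    rw [he', φ.apply_symm_apply, φ.apply_symm_apply]
  rcases h.2 e' (fun g v => by rw [he', he', φ.map_apply, he, φ.symm.map_apply])
    (fun v => by rw [he', he', φ.apply_symm_apply, hee]) with h | h
  · left
    ext w
    rw [key, h, LinearMap.zero_apply, map_zero, LinearMap.zero_apply]
  · right
    ext w
    rw [key, h, LinearMap.id_apply, φ.apply_symm_apply, LinearMap.id_apply]

/-- An indecomposable lattice of odd rank greater than one over a `2`-group is not a permutation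
lattice. -/
theorem IsIndecomposableRep.hasNoPermutationSummand [Nontrivial R]
    {ρ : Representation R G V} (h : IsIndecomposableRep ρ) (hG : IsPGroup 2 G)
    (hodd : Odd (Module.finrank R V)) (hne : Module.finrank R V ≠ 1) :
    HasNoPermutationSummand ρ := by
  intro U U' hU hperm
  refine (h.2 U U' hU).resolve_right fun hU' => ?_
  have hc := Subrepresentation.isCompl_iff.1 hU
  have htop : U.toSubmodule = ⊤ := by
    have : U'.toSubmodule = ⊥ := congrArg Subrepresentation.toSubmodule hU'
    rw [this] at hc
    exact eq_top_of_isCompl_bot hc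
  obtain ⟨ι, hι, act, b, hb⟩ := hperm.exists_mulAction
  let B : Module.Basis ι R V := b.map (LinearEquiv.ofTop U.toSubmodule htop)
  have hB : ∀ g i, ρ g (B i) = B (g • i) := fun g i => congrArg Subtype.val (hb g i)
  have hcard : Module.finrank R V = Nat.card ι := Module.finrank_eq_nat_card_basis B
  rw [hcard] at hodd hne
  have : Fact (Nat.Prime 2) := ⟨Nat.prime_two⟩
  -- A `2`-group acting on a set of odd size has a fixed point. The projection to that basis vector
  -- is an equivariant idempotent, which is neither `0` nor `1` when the rank exceeds one.
  obtain ⟨a, ha⟩ := hG.nonempty_fixed_point_of_prime_not_dvd_card ι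
    (Nat.two_dvd_ne_zero.2 (Nat.odd_iff.1 hodd))
  rcases (isIndecomposableRep_iff.1 h).2 ((B.coord a).smulRight (B a)) (fun g v => by
      have := B.repr_permutation_smul hB g v a
      rw [ha g] at this
      simp [this, hB, ha g]) (fun v => by simp) with h0 | h1
  · have := LinearMap.congr_fun h0 (B a)
    simp [B.ne_zero] at this
  · obtain ⟨j, hj⟩ : ∃ j, j ≠ a := by
      by_contra! hall
      have : Subsingleton ι := ⟨fun x y => (hall x).trans (hall y).symm⟩
      exact hne (Nat.card_eq_one_iff_unique.2 ⟨this, ⟨a⟩⟩)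
    have := LinearMap.congr_fun h1 (B j)
    simp [hj.symm] at this
    exact B.ne_zero j this.symm

end Indecomposable

/-! ### Extension of scalars to the `p`-adic integers. -/

section PadicExtension

variable {p : ℕ} [Fact p.Prime] {G A B : Type} [Group G] [AddCommGroup A] [AddCommGroup B]

theorem padicExtension_tmul (ρ : Representation ℤ G A) (g : G) (x : ℤ_[p]) (a : A) :
    padicExtension p ρ g (x ⊗ₜ a) = x ⊗ₜ ρ g a := rfl

theorem nonempty_equiv_padicExtension {ρ : Representation ℤ G A} {σ : Representation ℤ G B}
    (e : Representation.Equiv ρ σ) :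
    Nonempty (Representation.Equiv (padicExtension p ρ) (padicExtension p σ)) := by
  refine ⟨Representation.Equiv.mk (e.toLinearEquiv.baseChange ℤ ℤ_[p] A B) fun g => ?_⟩
  refine TensorProduct.AlgebraTensorModule.ext fun x a => ?_
  change x ⊗ₜ[ℤ] e (ρ g a) = x ⊗ₜ[ℤ] σ g (e a)
  rw [e.map_apply]

theorem nonempty_equiv_padicExtension_prod (ρ : Representation ℤ G A)
    (σ : Representation ℤ G B) :
    Nonempty (Representation.Equiv (padicExtension p (ρ.prod σ))
      ((padicExtension p ρ).prod (padicExtension p σ))) := by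
  refine ⟨Representation.Equiv.mk (TensorProduct.prodRight ℤ ℤ_[p] ℤ_[p] A B) fun g => ?_⟩
  refine TensorProduct.AlgebraTensorModule.ext fun x a => ?_
  rfl

theorem IsPermutationRep.padicExtension {ρ : Representation ℤ G A} (h : IsPermutationRep ρ) :
    IsPermutationRep (_root_.padicExtension p ρ) := by
  obtain ⟨ι, hι, b, hb⟩ := h
  refine ⟨ι, hι, b.baseChange ℤ_[p], fun g i => ?_⟩
  obtain ⟨j, hj⟩ := hb g i
  exact ⟨j, by rw [Module.Basis.baseChange_apply, Module.Basis.baseChange_apply, padicExtension_tmul, hj]⟩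

end PadicExtension

/-! ### Reduction to one resolution over a Sylow subgroup. -/

section Reduction

variable {G M : Type} [Group G] [Finite G] [AddCommGroup M]

/-- The lattice `ρ` has a flabby resolution, each of them yields a `2`-part of the flabby class,
and this `2`-part is unique, faithful and indecomposable of rank `n`. -/
def HasFaithfulIndecomposableTwoPart (ρ : Representation ℤ G M) (S : Sylow 2 G) (n : ℕ) : Prop :=
  Nonempty (FlabbyResolution ρ) ∧
  (∀ E : FlabbyResolution ρ,
    ∃ (N : Type) (_ : AddCommGroup N) (_ : Module ℤ_[2] N) (τ : Representation ℤ_[2] S N),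
      IsPPart 2 E S τ) ∧
  (∀ (E E' : FlabbyResolution ρ)
    (N : Type) [AddCommGroup N] [Module ℤ_[2] N] (τ : Representation ℤ_[2] S N)
    (N' : Type) [AddCommGroup N'] [Module ℤ_[2] N'] (τ' : Representation ℤ_[2] S N'),
    IsPPart 2 E S τ → IsPPart 2 E' S τ' → Nonempty (Representation.Equiv τ τ')) ∧
  (∀ (E : FlabbyResolution ρ)
    (N : Type) [AddCommGroup N] [Module ℤ_[2] N] (τ : Representation ℤ_[2] S N),
    IsPPart 2 E S τ →
      IsLatticeRep τ ∧ Function.Injective τ ∧ IsIndecomposableRep τ ∧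
        Module.finrank ℤ_[2] N = n)

/-- If the restriction of a `G`-lattice to a Sylow `2`-subgroup has a flabby resolution whose
cokernel becomes indecomposable of odd rank `n > 1` over `ℤ₂`, then that cokernel is the `2`-part
of every flabby resolution of the `G`-lattice. -/
theorem two_part_of_resolution [Module.Finite ℤ M] [Module.Free ℤ M] (ρ : Representation ℤ G M)
    (S : Sylow 2 G) {P F : Type} [AddCommGroup P] [AddCommGroup F] {ρP : Representation ℤ S P}
    {ρF : Representation ℤ S F} (hP : IsPermutationRep ρP) [Module.IsTorsionFree ℤ F]
    [Module.Finite ℤ F] (f : M →ₗ[ℤ] P) (g : P →ₗ[ℤ] F)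
    (hf : ∀ (s : S) v, f (ρ s v) = ρP s (f v))
    (hg : ∀ s v, g (ρP s v) = ρF s (g v)) (inj : Function.Injective f) (ex : Function.Exact f g)
    (sur : Function.Surjective g) (hF : NormKernelsVanish ρF)
    (hind : IsIndecomposableRep (padicExtension 2 ρF))
    (hinj : Function.Injective (padicExtension 2 ρF)) (n : ℕ)
    (hrank : Module.finrank ℤ F = n) (hodd : Odd n) (hne : n ≠ 1) :
    HasFaithfulIndecomposableTwoPart ρ S n := by
  have hS : IsPGroup 2 S := S.isPGroup'
  have hfree : Module.Free ℤ F := Module.free_of_finite_type_torsion_free'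
  have hrank' : Module.finrank ℤ_[2] (ℤ_[2] ⊗[ℤ] F) = n := by
    rw [Module.finrank_baseChange, hrank]
  have hno : HasNoPermutationSummand (padicExtension 2 ρF) :=
    hind.hasNoPermutationSummand hS (hrank'.symm ▸ hodd) (hrank'.symm ▸ hne)
  have main : ∀ E : FlabbyResolution ρ,
      ∃ (Q : Type) (_ : AddCommGroup Q) (_ : Module ℤ_[2] Q) (σ : Representation ℤ_[2] S Q),
        IsPermutationRep σ ∧
        Nonempty (Representation.Equiv
          ((padicExtension 2 E.repF).comp (S : Subgroup G).subtype)
          ((padicExtension 2 ρF).prod σ)) := by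
    intro E
    have := E.lattice_F.1
    have := E.lattice_F.2
    have hPE : IsPermutationRep (E.repP.comp (S : Subgroup G).subtype) := by
      obtain ⟨ι, hι, b, hb⟩ := E.permutation_P
      exact ⟨ι, hι, b, fun g i => hb g i⟩
    -- The restriction of `E` to `S` is still a flabby resolution, so it can be compared with the
    -- given one; only afterwards are scalars extended and permutation lattices cancelled.
    obtain ⟨e⟩ := nonempty_equiv_of_flabby_resolutions (ρM := ρ.comp (S : Subgroup G).subtype)
      (ρF := E.repF.comp (S : Subgroup G).subtype) hPE hP
      E.f.toLinearMap E.g.toLinearMap (fun s v => E.f.isIntertwining _ _ s v)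
      (fun s v => E.g.isIntertwining _ _ s v) E.injective_f E.exact_fg E.surjective_g
      (((isFlabbyRep_iff _).1 E.flabby_F).comp_subtype S) f g hf hg inj ex sur hF
    obtain ⟨e1⟩ := nonempty_equiv_padicExtension (p := 2) e
    obtain ⟨e2⟩ := nonempty_equiv_padicExtension_prod (p := 2)
      (E.repF.comp (S : Subgroup G).subtype) ρP
    obtain ⟨e3⟩ := nonempty_equiv_padicExtension_prod (p := 2) ρF
      (E.repP.comp (S : Subgroup G).subtype)
    exact exists_equiv_prod_of_isPermutationRep hS hno hP.padicExtension hPE.padicExtension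
      ⟨(e2.symm.trans e1).trans e3⟩
  have uniq : ∀ (E : FlabbyResolution ρ)
      (N : Type) [AddCommGroup N] [Module ℤ_[2] N] (τ : Representation ℤ_[2] S N),
      IsPPart 2 E S τ → Nonempty (Representation.Equiv (padicExtension 2 ρF) τ) := by
    rintro E N _ _ τ ⟨hτ, Q, _, _, σ, hσ, ⟨e⟩⟩
    obtain ⟨Q', _, _, σ', hσ', ⟨e'⟩⟩ := main E
    exact nonempty_equiv_of_hasNoPermutationSummand hS hno hτ hσ' hσ ⟨e'.symm.trans e⟩
  refine ⟨nonempty_flabbyResolution ρ, fun E => ?_, ?_, ?_⟩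
  · exact ⟨_, _, _, padicExtension 2 ρF, hno, main E⟩
  · intro E E' N _ _ τ N' _ _ τ' h h'
    obtain ⟨e⟩ := uniq E N τ h
    obtain ⟨e'⟩ := uniq E' N' τ' h'
    exact ⟨e.symm.trans e'⟩
  · intro E N _ _ τ h
    obtain ⟨e⟩ := uniq E N τ h
    refine ⟨⟨Module.Finite.equiv e.toLinearEquiv, Module.Free.of_equiv e.toLinearEquiv⟩, ?_,
      hind.of_equiv e, ?_⟩
    · intro s t hst
      apply hinj
      refine LinearMap.ext fun v => ?_
      apply e.toLinearEquiv.injective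
      exact (e.map_apply s v).trans ((LinearMap.congr_fun hst (e v)).trans (e.map_apply t v).symm)
    · rw [← hrank', e.toLinearEquiv.finrank_eq]

end Reduction

/-! ### The cokernel of a graph embedding and its explicit action. -/

section GraphCokernel

open Matrix

variable {S : Type} [Group S] {n r : ℕ}

/-- The contragredient of an integral matrix representation, on row vectors. -/
def rowRep (θ : S →* GL (Fin n) ℤ) : Representation ℤ S (Fin n → ℤ) where
  toFun s := vecMulLinear ((θ s)⁻¹ : GL (Fin n) ℤ).1
  map_one' := by
    refine LinearMap.ext fun x => ?_
    simp
  map_mul' s t := by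
    refine LinearMap.ext fun x => ?_
    simp [vecMul_vecMul]

theorem rowRep_apply (θ : S →* GL (Fin n) ℤ) (s : S) (x : Fin n → ℤ) :
    rowRep θ s x = x ᵥ* ((θ s)⁻¹ : GL (Fin n) ℤ).1 := rfl

/-- The matrix whose rows are the unit vectors and the rows of `W`. -/
abbrev withUnitRows (W : Matrix (Fin r) (Fin n) ℤ) : Matrix (Fin n ⊕ Fin r) (Fin n) ℤ :=
  fromRows 1 W

/-- The cokernel of the inclusion of the graph of `W`. -/
def graphCokernel (W : Matrix (Fin r) (Fin n) ℤ) : (Fin n ⊕ Fin r → ℤ) →ₗ[ℤ] (Fin r → ℤ) :=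
  LinearMap.funLeft ℤ ℤ Sum.inr - W.mulVecLin ∘ₗ LinearMap.funLeft ℤ ℤ Sum.inl

theorem graphCokernel_apply (W : Matrix (Fin r) (Fin n) ℤ) (p : Fin n ⊕ Fin r → ℤ) :
    graphCokernel W p = p ∘ Sum.inr - W *ᵥ (p ∘ Sum.inl) := rfl

theorem graphCokernel_elim_zero (W : Matrix (Fin r) (Fin n) ℤ) (y : Fin r → ℤ) :
    graphCokernel W (Sum.elim 0 y) = y := by
  rw [graphCokernel_apply, Sum.elim_comp_inr, Sum.elim_comp_inl, mulVec_zero, sub_zero]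

theorem exact_graphCokernel (W : Matrix (Fin r) (Fin n) ℤ) :
    Function.Exact (withUnitRows W).mulVecLin (graphCokernel W) := by
  intro p
  rw [graphCokernel_apply, sub_eq_zero]
  constructor
  · intro h
    refine ⟨p ∘ Sum.inl, ?_⟩
    rw [mulVecLin_apply, fromRows_mulVec, one_mulVec, ← h, Sum.elim_comp_inl_inr]
  · rintro ⟨x, rfl⟩
    rw [mulVecLin_apply, fromRows_mulVec, Sum.elim_comp_inr, Sum.elim_comp_inl, one_mulVec]

theorem surjective_graphCokernel (W : Matrix (Fin r) (Fin n) ℤ) :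
    Function.Surjective (graphCokernel W) := fun y => ⟨_, graphCokernel_elim_zero W y⟩

/-- The functionals given by the unit vectors and the rows of `W`. -/
def rowFunctional (W : Matrix (Fin r) (Fin n) ℤ) (i : Fin n ⊕ Fin r) : (Fin n → ℤ) →ₗ[ℤ] ℤ :=
  LinearMap.proj i ∘ₗ (withUnitRows W).mulVecLin

theorem rowFunctional_apply (W : Matrix (Fin r) (Fin n) ℤ) (i : Fin n ⊕ Fin r) (x : Fin n → ℤ) :
    rowFunctional W i x = x ⬝ᵥ withUnitRows W i :=
  dotProduct_comm (withUnitRows W i) x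

/-- A matrix group permuting the unit vectors and the rows of `W`, together with an equivariant
choice of an expression of each vector as a combination of them. -/
structure EquivariantExpansion (W : Matrix (Fin r) (Fin n) ℤ) (θ : S →* GL (Fin n) ℤ)
    [MulAction S (Fin n ⊕ Fin r)] (c : (Fin n → ℤ) → Fin n ⊕ Fin r → ℤ) : Prop where
  row_smul : ∀ (s : S) i, withUnitRows W (s • i) = (θ s).1 *ᵥ withUnitRows W i
  coeff_smul : ∀ (s : S) v i, c ((θ s).1 *ᵥ v) (s • i) = c v i
  coeff_vecMul : ∀ v, c v ᵥ* withUnitRows W = v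

namespace EquivariantExpansion

variable {W : Matrix (Fin r) (Fin n) ℤ} {θ : S →* GL (Fin n) ℤ} [MulAction S (Fin n ⊕ Fin r)]
  {c : (Fin n → ℤ) → Fin n ⊕ Fin r → ℤ}

/-- A functional is the dot product with a vector `v`, and its invariance means that `H` fixes `v`.
Equivariance of the chosen expansion then makes the coefficients of `v` invariant. -/
theorem isFlabbyFamily (h : EquivariantExpansion W θ c) :
    IsFlabbyFamily (rowRep θ) (rowFunctional W) where
  equivariant s i m := by
    rw [rowFunctional_apply, rowFunctional_apply, h.row_smul, rowRep_apply, dotProduct_mulVec,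
      vecMul_vecMul, ← Units.val_mul, inv_mul_cancel, Units.val_one, vecMul_one]
  exists_coeff H x hx := by
    let v : Fin n → ℤ := fun i => x (Pi.single i 1)
    have hv : ∀ m, x m = m ⬝ᵥ v := by
      intro m
      conv_lhs => rw [pi_eq_sum_univ' m, map_sum]
      refine Finset.sum_congr rfl fun i _ => ?_
      rw [map_smul, smul_eq_mul]
    have hfix : ∀ s ∈ H, (θ s).1 *ᵥ v = v := by
      intro s hs
      have : ((θ s)⁻¹ : GL (Fin n) ℤ).1 *ᵥ v = v := by
        refine dotProduct_eq _ _ fun m => ?_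
        rw [dotProduct_comm, dotProduct_mulVec, ← rowRep_apply, ← hv, hx s hs, hv, dotProduct_comm]
      conv_lhs => rw [← this]
      rw [mulVec_mulVec, ← Units.val_mul, mul_inv_cancel, Units.val_one, one_mulVec]
    refine ⟨c v, fun s hs i => ?_, fun m => ?_⟩
    · conv_lhs => rw [← hfix s hs]
      exact h.coeff_smul s v i
    · rw [finsum_eq_sum_of_fintype, hv]
      conv_lhs => rw [← h.coeff_vecMul v]
      rw [dotProduct_comm, ← dotProduct_mulVec]
      rfl

/-- The graph is a stable sublattice. This makes the recipe of lifting by zero, acting and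
projecting independent of the lift, and hence an action. -/
theorem map_smul_range (h : EquivariantExpansion W θ c) (s : S) (p : Fin n ⊕ Fin r → ℤ)
    (hp : graphCokernel W p = 0) : graphCokernel W (functionRep ℤ S _ s p) = 0 := by
  obtain ⟨x, rfl⟩ := (exact_graphCokernel W p).1 hp
  refine (exact_graphCokernel W _).2 ⟨rowRep θ s x, ?_⟩
  exact h.isFlabbyFamily.equivariant_pi s x

/-- The action on `Fin r → ℤ` identified with the cokernel of the graph of `W`. -/
def cokernelRep (h : EquivariantExpansion W θ c) : Representation ℤ S (Fin r → ℤ) where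
  toFun s := graphCokernel W ∘ₗ functionRep ℤ S _ s ∘ₗ
    { toFun := fun y => Sum.elim 0 y
      map_add' := fun x y => by
        ext (i | i) <;> simp
      map_smul' := fun a x => by
        ext (i | i) <;> simp }
  map_one' := by
    refine LinearMap.ext fun y => ?_
    change graphCokernel W (functionRep ℤ S _ 1 (Sum.elim 0 y)) = y
    rw [map_one, Module.End.one_apply, graphCokernel_elim_zero]
  map_mul' s t := by
    refine LinearMap.ext fun y => ?_
    change graphCokernel W (functionRep ℤ S _ (s * t) (Sum.elim 0 y)) =
      graphCokernel W (functionRep ℤ S _ s (Sum.elim 0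
        (graphCokernel W (functionRep ℤ S _ t (Sum.elim 0 y)))))
    rw [← sub_eq_zero, ← map_sub, map_mul, Module.End.mul_apply, ← map_sub]
    refine h.map_smul_range s _ ?_
    rw [map_sub, graphCokernel_elim_zero, sub_self]

theorem cokernelRep_apply (h : EquivariantExpansion W θ c) (s : S) (y : Fin r → ℤ) :
    h.cokernelRep s y = graphCokernel W (functionRep ℤ S _ s (Sum.elim 0 y)) := rfl

theorem graphCokernel_functionRep (h : EquivariantExpansion W θ c) (s : S)
    (p : Fin n ⊕ Fin r → ℤ) :
    graphCokernel W (functionRep ℤ S _ s p) = h.cokernelRep s (graphCokernel W p) := by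
  rw [cokernelRep_apply, ← sub_eq_zero, ← map_sub, ← map_sub]
  refine h.map_smul_range s _ ?_
  rw [map_sub, graphCokernel_elim_zero, sub_self]

/-- In the cokernel, the basis vector of `ℤ^(n+r)` at a unit index `i` becomes minus the `i`-th
column of `W`. The matrices of the action can therefore be read off from the permutation. -/
theorem cokernelRep_single (h : EquivariantExpansion W θ c) (s : S) (l k : Fin r) :
    h.cokernelRep s (Pi.single l 1) k =
      Sum.elim (fun i => -W k i) (fun l' => if k = l' then 1 else 0) (s • Sum.inr l : Fin n ⊕ Fin r) := by
  have : Sum.elim (0 : Fin n → ℤ) (Pi.single l 1) = (Pi.single (Sum.inr l) 1 : Fin n ⊕ Fin r → ℤ) := by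
    ext (i | i) <;> simp [Pi.single_apply]
  rw [cokernelRep_apply, this, functionRep_single, graphCokernel_apply]
  rcases (s • Sum.inr l : Fin n ⊕ Fin r) with i | l'
  · have : (Pi.single (Sum.inl i) 1 : Fin n ⊕ Fin r → ℤ) ∘ Sum.inl = Pi.single i 1 := by
      ext j
      simp [Pi.single_apply]
    simp [this]
  · have : (Pi.single (Sum.inr l') 1 : Fin n ⊕ Fin r → ℤ) ∘ Sum.inl = 0 := by
      ext j
      simp
    simp [this, Pi.single_apply]

/-- If `s` acts trivially it cannot move row `l` to a unit index `i`: column `i` of `W` would then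
vanish outside `l`. So all rows are fixed, including the negatives of the unit vectors, and `θ s` is
the identity. -/
theorem injective_cokernelRep (h : EquivariantExpansion W θ c) (hθ : Function.Injective θ)
    (hcol : ∀ l i, ∃ k, k ≠ l ∧ W k i ≠ 0) (hneg : ∀ i, ∃ k, W k = -Pi.single i 1) :
    Function.Injective h.cokernelRep := by
  rw [injective_iff_map_eq_one]
  intro s hs
  have hfix : ∀ l, (s • Sum.inr l : Fin n ⊕ Fin r) = Sum.inr l := by
    intro l
    have key := fun k => h.cokernelRep_single s l k
    rw [hs] at key
    rcases hl : (s • Sum.inr l : Fin n ⊕ Fin r) with i | l'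
    · obtain ⟨k, hk, hki⟩ := hcol l i
      have := key k
      rw [hl] at this
      simp [hk] at this
      exact (hki this).elim
    · have := key l
      rw [hl] at this
      simp at this
      rw [this]
  apply hθ
  rw [map_one]
  ext a i
  obtain ⟨k, hk⟩ := hneg i
  have := h.row_smul s (Sum.inr k)
  rw [hfix] at this
  change W k = _ *ᵥ W k at this
  rw [hk, mulVec_neg, neg_inj, mulVec_single_one] at this
  rw [← col_apply (θ s).1 i a, ← this]
  simp [Pi.single_apply, one_apply]

end EquivariantExpansion

end GraphCokernel

/-! ### Certificates of indecomposability modulo `2`. -/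

section Certificates

open Matrix

/-- A triple `(g, i, j)` stands for the `(j, i)` entry of `X * A g - A g * X`, written as a linear
form in the entries of `X`; a list stands for the sum of these vanishing forms. -/
theorem sum_mul_eq_zero_of_commute {R ι γ : Type*} [CommRing R] [Fintype ι] [DecidableEq ι]
    (A : γ → Matrix ι ι R) (X : Matrix ι ι R) (hX : ∀ g, X * A g = A g * X)
    (L : List (γ × ι × ι)) :
    ∑ a, ∑ b, (L.map fun t => (if a = t.2.2 then A t.1 b t.2.1 else 0) -
      (if b = t.2.1 then A t.1 t.2.2 a else 0)).sum * X a b = 0 := by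
  induction L with
  | nil => simp
  | cons t L ih =>
    simp only [List.map_cons, List.sum_cons, add_mul, Finset.sum_add_distrib, ih, add_zero,
      sub_mul, Finset.sum_sub_distrib, ite_mul, zero_mul]
    have h1 : ∑ a, ∑ b, (if a = t.2.2 then A t.1 b t.2.1 * X a b else 0) =
        (X * A t.1) t.2.2 t.2.1 := by
      rw [Finset.sum_eq_single t.2.2 (fun a _ ha => by simp [ha]) (by simp)]
      simp [mul_apply, mul_comm]
    have h2 : ∑ a, ∑ b, (if b = t.2.1 then A t.1 t.2.2 a * X a b else 0) =
        (A t.1 * X) t.2.2 t.2.1 := by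
      simp [mul_apply]
    rw [h1, h2, hX, sub_self]

/-- A finite certificate that an idempotent commuting with all `A g` acts as `0` or `1` on the row
vectors fixed by all `A g`. The fixed row vectors are the functions of `orbit`; the `j`-th one is
detected at the index `rep j`. The list `cert k j` expresses the `(k, j)` entry of the action on
them, corrected by the `(0, 0)` entry if `k = j`, through commutators. -/
structure LocalTopCertificate {r m t : ℕ} (A : Fin t → Matrix (Fin r) (Fin r) (ZMod 2))
    (orbit : Fin r → Fin (m + 1)) (rep : Fin (m + 1) → Fin r)
    (cert : Fin (m + 1) → Fin (m + 1) → List (Fin t × Fin r × Fin r)) : Prop where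
  orbit_rep : ∀ k, orbit (rep k) = k
  fixed : ∀ g k b, ∑ a, (if orbit a = k then A g a b else 0) = if orbit b = k then 1 else 0
  eq_rep : ∀ l : Fin r → ZMod 2, (∀ g, l ᵥ* A g = l) → ∀ a, l a = l (rep (orbit a))
  certified : ∀ k j a b, j ≠ 0 →
    ((cert k j).map fun t => (if a = t.2.2 then A t.1 b t.2.1 else 0) -
      (if b = t.2.1 then A t.1 t.2.2 a else 0)).sum =
      (if orbit a = k ∧ b = rep j then 1 else 0) -
        (if k = j ∧ orbit a = 0 ∧ b = rep 0 then 1 else 0)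

/-- Let `T` be the matrix of `X` on the fixed row vectors, in the basis of orbit indicators. The
certificate gives every column but the first the shape of a scalar matrix, and idempotency modulo
`2` settles the first. -/
theorem LocalTopCertificate.idempotent {r m t : ℕ} {A : Fin t → Matrix (Fin r) (Fin r) (ZMod 2)}
    {orbit : Fin r → Fin (m + 1)} {rep : Fin (m + 1) → Fin r}
    {cert : Fin (m + 1) → Fin (m + 1) → List (Fin t × Fin r × Fin r)}
    (h : LocalTopCertificate A orbit rep cert) (X : Matrix (Fin r) (Fin r) (ZMod 2))
    (hX : ∀ g, X * A g = A g * X) (hXX : X * X = X) :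
    (∀ l : Fin r → ZMod 2, (∀ g, l ᵥ* A g = l) → l ᵥ* X = 0) ∨
      (∀ l : Fin r → ZMod 2, (∀ g, l ᵥ* A g = l) → l ᵥ* X = l) := by
  let e : Fin (m + 1) → Fin r → ZMod 2 := fun k a => if orbit a = k then 1 else 0
  have he : ∀ k g, e k ᵥ* A g = e k := by
    intro k g
    ext b
    simpa [e, vecMul, dotProduct] using h.fixed g k b
  let T : Fin (m + 1) → Fin (m + 1) → ZMod 2 := fun k j => (e k ᵥ* X) (rep j)
  have heX : ∀ k a, (e k ᵥ* X) a = T k (orbit a) := fun k a =>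
    h.eq_rep _ (fun g => by rw [vecMul_vecMul, hX, ← vecMul_vecMul, he]) a
  have hsum : ∀ (f : Fin (m + 1) → ZMod 2) a,
      ((fun b => f (orbit b)) ᵥ* X) a = ∑ k, f k * T k (orbit a) := by
    intro f a
    simp only [← heX, vecMul, dotProduct, Finset.mul_sum]
    rw [Finset.sum_comm]
    refine Finset.sum_congr rfl fun b _ => ?_
    simp [e]
  have hTT : ∀ k j, ∑ i, T k i * T i j = T k j := by
    intro k j
    have h1 : e k ᵥ* X = fun b => T k (orbit b) := funext (heX k)
    have h2 : e k ᵥ* X ᵥ* X = e k ᵥ* X := by rw [vecMul_vecMul, hXX]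
    have h3 := congrFun h2 (rep j)
    rw [heX, h1, hsum, h.orbit_rep] at h3
    exact h3
  have hT : ∀ k j, j ≠ 0 → T k j = if k = j then T 0 0 else 0 := by
    intro k j hj
    have h1 := sum_mul_eq_zero_of_commute A X hX (cert k j)
    simp only [h.certified k j _ _ hj, sub_mul, Finset.sum_sub_distrib, ite_mul, one_mul,
      zero_mul, ite_and] at h1
    simp only [T, e, vecMul, dotProduct, ite_mul, one_mul, zero_mul]
    rw [sub_eq_zero] at h1
    split_ifs with hkj
    · subst hkj
      simpa [← Finset.sum_filter] using h1
    · simpa [hkj, ← Finset.sum_filter] using h1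
  -- Expanding `T² = T` at `(k, 0)` leaves only the terms through `0` and `k`. They are equal
  -- because `T k k = T 0 0`, so they cancel in characteristic two.
  have hT0 : ∀ k, k ≠ 0 → T k 0 = 0 := by
    intro k hk
    rw [← hTT k 0, Finset.sum_eq_add (0 : Fin (m + 1)) k hk.symm ?_ (by simp) (by simp),
      hT k k hk, if_pos rfl, mul_comm, ← two_mul]
    · have : (2 : ZMod 2) = 0 := rfl
      rw [this, zero_mul]
    · rintro i - ⟨hi, hik⟩
      rw [hT k i hi, if_neg hik.symm, zero_mul]
  have hTs : ∀ k j, T k j = if k = j then T 0 0 else 0 := by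
    intro k j
    rcases eq_or_ne j 0 with rfl | hj
    · split_ifs with hk
      · rw [hk]
      · exact hT0 k hk
    · exact hT k j hj
  have key : ∀ l : Fin r → ZMod 2, (∀ g, l ᵥ* A g = l) → ∀ a, (l ᵥ* X) a = l a * T 0 0 := by
    intro l hl a
    have h1 : l = fun b => (l ∘ rep) (orbit b) := funext (h.eq_rep l hl)
    conv_lhs => rw [h1, hsum]
    rw [Finset.sum_eq_single (orbit a) (fun k _ hk => by rw [hTs, if_neg hk, mul_zero]) (by simp),
      hTs, if_pos rfl, Function.comp_apply, ← h.eq_rep l hl a]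
  have h01 : ∀ x : ZMod 2, x = 0 ∨ x = 1 := by decide
  rcases h01 (T 0 0) with h0 | h0
  · left
    intro l hl
    ext a
    rw [key l hl, h0, mul_zero, Pi.zero_apply]
  · right
    intro l hl
    ext a
    rw [key l hl, h0, mul_one]

/-- Functionals fixed by `S` modulo `2` are fixed by all the `A g`. If an idempotent acts as `0` on
them, its complement annihilates no nonzero invariant functional and is bijective; if it acts as
`1`, it is itself bijective. A bijective idempotent is the identity. -/
theorem LocalTopCertificate.isIndecomposableRep {S : Type} [Group S] (hS : IsPGroup 2 S)
    {r m t : ℕ} {ρ : Representation ℤ S (Fin r → ℤ)} {A : Fin t → Matrix (Fin r) (Fin r) (ZMod 2)}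
    {orbit : Fin r → Fin (m + 1)} {rep : Fin (m + 1) → Fin r}
    {cert : Fin (m + 1) → Fin (m + 1) → List (Fin t × Fin r × Fin r)}
    (h : LocalTopCertificate A orbit rep cert)
    (hA : ∀ g, ∃ s, ∀ k l, ((ρ s (Pi.single l 1) k : ℤ) : ZMod 2) = A g k l) :
    IsIndecomposableRep (padicExtension 2 ρ) := by
  let b := (Pi.basisFun ℤ (Fin r)).baseChange ℤ_[2]
  have hred : ∀ s k l, redMatrix b (padicExtension 2 ρ s) k l =
      ((ρ s (Pi.single l 1) k : ℤ) : ZMod 2) := by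
    intro s k l
    rw [redMatrix_apply, Module.Basis.baseChange_apply, padicExtension_tmul,
      Module.Basis.baseChange_repr_tmul, Pi.basisFun_repr, Pi.basisFun_apply]
    simp
  rw [isIndecomposableRep_iff]
  refine ⟨?_, fun e he hee => ?_⟩
  · exact ⟨b (rep 0), 0, b.ne_zero _⟩
  have hcomm : ∀ g, redMatrix b e * A g = A g * redMatrix b e := by
    intro g
    obtain ⟨s, hs⟩ := hA g
    have : A g = redMatrix b (padicExtension 2 ρ s) := by
      ext k l
      rw [hred, hs]
    rw [this, ← map_mul, ← map_mul]
    exact congrArg _ (LinearMap.ext (he s))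
  have hinv : ∀ l : Fin r → ZMod 2,
      (∀ s, l ᵥ* redMatrix b (padicExtension 2 ρ s) = l) → ∀ g, l ᵥ* A g = l := by
    intro l hl g
    obtain ⟨s, hs⟩ := hA g
    have : A g = redMatrix b (padicExtension 2 ρ s) := by
      ext k l
      rw [hred, hs]
    rw [this, hl]
  have hidem : redMatrix b e * redMatrix b e = redMatrix b e := by
    rw [← map_mul]
    exact congrArg _ (LinearMap.ext hee)
  rcases h.idempotent _ hcomm hidem with h0 | h1
  · left
    have hb : Function.Bijective (LinearMap.id - e : Module.End ℤ_[2] (ℤ_[2] ⊗[ℤ] (Fin r → ℤ))) := by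
      by_contra hn
      obtain ⟨l, hl, hle, hls⟩ := exists_invariant_vecMul_eq_zero hS (padicExtension 2 ρ) b
        (LinearMap.id - e)
        (fun s v => by simp [he]) hn
      rw [map_sub, ← Module.End.one_eq_id, map_one, vecMul_sub, vecMul_one, h0 l (hinv l hls), sub_zero] at hle
      exact hl hle
    refine LinearMap.ext fun v => ?_
    obtain ⟨w, rfl⟩ := hb.2 v
    simp [hee]
  · right
    have hb : Function.Bijective e := by
      by_contra hn
      obtain ⟨l, hl, hle, hls⟩ := exists_invariant_vecMul_eq_zero hS (padicExtension 2 ρ) b e he hn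
      rw [h1 l (hinv l hls)] at hle
      exact hl hle
    exact LinearMap.ext fun v => hb.1 (hee v)

end Certificates

/-! ### From finite families of vectors to the two-part. -/

section CertifiedFamilies

open Matrix

/-- The reduction modulo `2` of the action on the cokernel of the graph of `W` of a matrix which
permutes the unit vectors and the rows of `W` as `σ` does. -/
def cokernelMatrix {n r : ℕ} (W : Matrix (Fin r) (Fin n) ℤ)
    (σ : Fin n ⊕ Fin r → Fin n ⊕ Fin r) : Matrix (Fin r) (Fin r) (ZMod 2) := fun k l =>
  Sum.elim (fun i => -(W k i : ZMod 2)) (fun l' => if k = l' then 1 else 0) (σ (Sum.inr l))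

/-- An invariant functional takes equal values on two rows exchanged by a generator. The hypothesis
links every row to one of smaller index until the representative is reached, so strong induction
applies. -/
theorem eq_rep_of_forest {n r m t : ℕ} (W : Matrix (Fin r) (Fin n) ℤ)
    (σ : Fin t → Fin n ⊕ Fin r → Fin n ⊕ Fin r) (orbit : Fin r → Fin m) (rep : Fin m → Fin r)
    (h : ∀ a, a = rep (orbit a) ∨ ∃ g b, b < a ∧ orbit b = orbit a ∧
      (σ g (Sum.inr a) = Sum.inr b ∨ σ g (Sum.inr b) = Sum.inr a))
    (l : Fin r → ZMod 2) (hl : ∀ g, l ᵥ* cokernelMatrix W (σ g) = l) (a : Fin r) :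
    l a = l (rep (orbit a)) := by
  have key : ∀ g a b, σ g (Sum.inr a) = Sum.inr b → l b = l a := by
    intro g a b hab
    have := congrFun (hl g) a
    simpa [vecMul, dotProduct, cokernelMatrix, hab] using this
  induction a using WellFoundedLT.induction with
  | ind a ih =>
    rcases h a with ha | ⟨g, b, hb, hab, hg⟩
    · exact congrArg l ha
    · rw [← hab, ← ih b hb]
      exact hg.elim (fun hg => (key g a b hg).symm) (key g b a)

/-- The entries of the unit vectors and the rows of `W`. -/
def rowEntry {n r : ℕ} (W : Matrix (Fin r) (Fin n) ℤ) (i : Fin n ⊕ Fin r) (k : Fin n) : ℤ :=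
  withUnitRows W i k

/-- A finite family of row vectors stable under the matrices `γ g`, which permute it as `σ g` does,
with an equivariant choice of expressions of all vectors as combinations of the family. -/
structure ExpansionCertificate {n r t : ℕ} (γ : Fin t → GL (Fin n) ℤ)
    (W : Matrix (Fin r) (Fin n) ℤ) (σ : Fin t → Fin n ⊕ Fin r → Fin n ⊕ Fin r)
    (c : (Fin n → ℤ) → Fin n ⊕ Fin r → ℤ) : Prop where
  injective_rows : ∀ i j, (∀ k, rowEntry W i k = rowEntry W j k) → i = j
  row_gen : ∀ g i, withUnitRows W (σ g i) = (γ g).1 *ᵥ withUnitRows W i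
  coeff_gen : ∀ g v i, c ((γ g).1 *ᵥ v) (σ g i) = c v i
  coeff_vecMul : ∀ v, c v ᵥ* withUnitRows W = v
  column_ne_zero : ∀ l i, ∃ k, k ≠ l ∧ rowEntry W (Sum.inr k) i ≠ 0
  neg_unit : ∀ i, ∃ k, ∀ j, rowEntry W (Sum.inr k) j = if j = i then -1 else 0

theorem ExpansionCertificate.eq_of_rows_eq {n r t : ℕ} {γ : Fin t → GL (Fin n) ℤ}
    {W : Matrix (Fin r) (Fin n) ℤ} {σ : Fin t → Fin n ⊕ Fin r → Fin n ⊕ Fin r}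
    {c : (Fin n → ℤ) → Fin n ⊕ Fin r → ℤ} (h : ExpansionCertificate γ W σ c)
    {i j : Fin n ⊕ Fin r} (hij : withUnitRows W i = withUnitRows W j) : i = j :=
  h.injective_rows i j fun k => congrFun hij k

/-- Equivariance is checked on generators only and propagates through the generated group. -/
theorem ExpansionCertificate.exists_perm {n r t : ℕ} {γ : Fin t → GL (Fin n) ℤ}
    {W : Matrix (Fin r) (Fin n) ℤ} {σ : Fin t → Fin n ⊕ Fin r → Fin n ⊕ Fin r}
    {c : (Fin n → ℤ) → Fin n ⊕ Fin r → ℤ} (h : ExpansionCertificate γ W σ c)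
    (x : GL (Fin n) ℤ) (hx : x ∈ Subgroup.closure (Set.range γ)) :
    ∀ i, ∃ j, withUnitRows W j = x.1 *ᵥ withUnitRows W i ∧ ∀ v, c (x.1 *ᵥ v) j = c v i := by
  induction hx using Subgroup.closure_induction with
  | mem x hx =>
    obtain ⟨g, rfl⟩ := hx
    exact fun i => ⟨σ g i, h.row_gen g i, fun v => h.coeff_gen g v i⟩
  | one => exact fun i => ⟨i, by simp, by simp⟩
  | mul x y _ _ hx hy =>
    intro i
    obtain ⟨j, hj, hj'⟩ := hy i
    obtain ⟨k, hk, hk'⟩ := hx j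
    refine ⟨k, ?_, fun v => ?_⟩
    · rw [hk, hj, mulVec_mulVec, Units.val_mul]
    · rw [Units.val_mul, ← mulVec_mulVec, hk', hj']
  | inv x _ hx =>
    choose f hf hf' using hx
    have hinv : ∀ v, (x⁻¹).1 *ᵥ (x.1 *ᵥ v) = v := fun v => by
      rw [mulVec_mulVec, ← Units.val_mul, inv_mul_cancel, Units.val_one, one_mulVec]
    have hinv' : ∀ v, x.1 *ᵥ ((x⁻¹).1 *ᵥ v) = v := fun v => by
      rw [mulVec_mulVec, ← Units.val_mul, mul_inv_cancel, Units.val_one, one_mulVec]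
    have hinj : Function.Injective f := fun i j hij => h.eq_of_rows_eq (by
      rw [← hinv (withUnitRows W i), ← hf, hij, hf, hinv])
    intro i
    -- The family is finite, so the injective map it induces is a permutation and can be inverted.
    obtain ⟨j, rfl⟩ := Finite.surjective_of_injective hinj i
    exact ⟨j, by rw [hf, hinv], fun v => by rw [← hf', hinv']⟩

/-- The rows are pairwise distinct, so the index to which an element sends a row is determined and
the action laws hold. -/
theorem ExpansionCertificate.exists_expansion {S : Type} [Group S] {n r t : ℕ}
    {γ : Fin t → GL (Fin n) ℤ}
    {W : Matrix (Fin r) (Fin n) ℤ} {σ : Fin t → Fin n ⊕ Fin r → Fin n ⊕ Fin r}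
    {c : (Fin n → ℤ) → Fin n ⊕ Fin r → ℤ} (h : ExpansionCertificate γ W σ c)
    (θ : S →* GL (Fin n) ℤ) (hθ : ∀ s, θ s ∈ Subgroup.closure (Set.range γ)) :
    ∃ _ : MulAction S (Fin n ⊕ Fin r), EquivariantExpansion W θ c := by
  choose f hf hf' using fun s => h.exists_perm (θ s) (hθ s)
  let act : MulAction S (Fin n ⊕ Fin r) :=
    { smul := f
      one_smul := fun i => h.eq_of_rows_eq ((hf 1 i).trans (by simp))
      mul_smul := fun s s' i => h.eq_of_rows_eq ((hf _ i).trans (by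
        rw [map_mul, Units.val_mul, ← mulVec_mulVec, ← hf s' i]
        exact (hf s _).symm)) }
  exact ⟨act,
    { row_smul := hf
      coeff_smul := fun s v i => hf' s i v
      coeff_vecMul := h.coeff_vecMul }⟩

/-- If a Sylow `2`-subgroup of `G ≤ GL(n, ℤ)` is conjugate to a matrix group with a certified
family of `n + r` vectors, then the `2`-part of the flabby class of the lattice of `G` is faithful
and indecomposable of rank `r`. -/
theorem ExpansionCertificate.two_part {n r t m : ℕ} {γ : Fin t → GL (Fin n) ℤ}
    {W : Matrix (Fin r) (Fin n) ℤ} {σ : Fin t → Fin n ⊕ Fin r → Fin n ⊕ Fin r}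
    {c : (Fin n → ℤ) → Fin n ⊕ Fin r → ℤ} (h : ExpansionCertificate γ W σ c)
    {orbit : Fin r → Fin (m + 1)} {rep : Fin (m + 1) → Fin r}
    {cert : Fin (m + 1) → Fin (m + 1) → List (Fin t × Fin r × Fin r)}
    (hc : LocalTopCertificate (fun g => cokernelMatrix W (σ g)) orbit rep cert)
    (hodd : Odd r) (hne : r ≠ 1)
    (G : Subgroup (GL (Fin n) ℤ)) [Finite G] (S : Sylow 2 G)
    (hS : ∃ u : GL (Fin n) ℤ, (S : Subgroup G).map G.subtype =
      (Subgroup.closure (Set.range γ)).map (MulAut.conj u).toMonoidHom) :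
    HasFaithfulIndecomposableTwoPart (latticeRep G) S r := by
  obtain ⟨u, hu⟩ := hS
  let θ : S →* GL (Fin n) ℤ := (MulAut.conj u⁻¹).toMonoidHom.comp
    (G.subtype.comp (S : Subgroup G).subtype)
  have θ_apply : ∀ s : S, θ s = u⁻¹ * ((s : G) : GL (Fin n) ℤ) * u := fun s => by simp [θ]
  have hθ : Function.Injective θ :=
    (MulAut.conj u⁻¹).injective.comp (Subtype.val_injective.comp Subtype.val_injective)
  have hmem : ∀ s, θ s ∈ Subgroup.closure (Set.range γ) := by
    intro s
    have : ((s : G) : GL (Fin n) ℤ) ∈ (S : Subgroup G).map G.subtype := ⟨s, s.2, rfl⟩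
    rw [hu] at this
    obtain ⟨x, hx, hxs⟩ := this
    rw [θ_apply, ← hxs]
    simpa [mul_assoc] using hx
  have hsur : ∀ g, ∃ s, θ s = γ g := by
    intro g
    have : MulAut.conj u (γ g) ∈ (S : Subgroup G).map G.subtype := by
      rw [hu]
      exact ⟨γ g, Subgroup.subset_closure ⟨g, rfl⟩, rfl⟩
    obtain ⟨s, hs, hsg⟩ := this
    refine ⟨⟨s, hs⟩, ?_⟩
    rw [θ_apply]
    change u⁻¹ * G.subtype s * u = _
    rw [hsg]
    simp [mul_assoc]
  obtain ⟨act, he⟩ := h.exists_expansion θ hmem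
  have hfl := he.isFlabbyFamily
  -- Right multiplication by `u` turns the action of `S` into that of its conjugate, in whose basis
  -- the family is written.
  let ψ : (Fin n → ℤ) ≃ₗ[ℤ] (Fin n → ℤ) :=
    LinearEquiv.ofLinearMap (vecMulLinear u.1) (vecMulLinear (u⁻¹).1)
      (LinearMap.ext fun x => by
        change x ᵥ* (u⁻¹).1 ᵥ* u.1 = x
        rw [vecMul_vecMul, ← Units.val_mul, inv_mul_cancel, Units.val_one, vecMul_one])
      (LinearMap.ext fun x => by
        change x ᵥ* u.1 ᵥ* (u⁻¹).1 = x
        rw [vecMul_vecMul, ← Units.val_mul, mul_inv_cancel, Units.val_one, vecMul_one])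
  have hψ : ∀ (s : S) x, ψ (latticeRep G s x) = rowRep θ s (ψ x) := by
    intro s x
    change x ᵥ* (((s : G) : GL (Fin n) ℤ)⁻¹).1 ᵥ* u.1 = x ᵥ* u.1 ᵥ* ((θ s)⁻¹).1
    rw [vecMul_vecMul, vecMul_vecMul, ← Units.val_mul, ← Units.val_mul, θ_apply]
    simp [mul_assoc]
  have hfin : Finite S := inferInstance
  have hgen : ∀ g, ∃ s, ∀ k l, ((he.cokernelRep s (Pi.single l 1) k : ℤ) : ZMod 2) =
      cokernelMatrix W (σ g) k l := by
    intro g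
    obtain ⟨s, hs⟩ := hsur g
    refine ⟨s, fun k l => ?_⟩
    have : s • (Sum.inr l : Fin n ⊕ Fin r) = σ g (Sum.inr l) := h.eq_of_rows_eq (by
      rw [he.row_smul, hs, h.row_gen])
    rw [he.cokernelRep_single, this, cokernelMatrix]
    rcases σ g (Sum.inr l) with i | i <;> simp
  have hinj := he.injective_cokernelRep hθ h.column_ne_zero fun i => (h.neg_unit i).imp fun k hk => by
    ext j
    exact (hk j).trans (by simp [Pi.single_apply, neg_ite])
  refine two_part_of_resolution (latticeRep G) S
    (isPermutationRep_functionRep ℤ S (Fin n ⊕ Fin r))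
    ((LinearMap.pi (rowFunctional W)) ∘ₗ ψ.toLinearMap) (graphCokernel W) (fun s v => ?_)
    he.graphCokernel_functionRep (hfl.injective_pi.comp ψ.injective) (fun p => ?_)
    (surjective_graphCokernel W)
    (hfl.normKernelsVanish (graphCokernel W) he.graphCokernel_functionRep
      (exact_graphCokernel W) (surjective_graphCokernel W))
    (hc.isIndecomposableRep S.isPGroup' hgen) ?_ r (by simp) hodd hne
  · change LinearMap.pi (rowFunctional W) (ψ (latticeRep G s v)) = _
    rw [hψ, hfl.equivariant_pi]
    rfl
  · rw [exact_graphCokernel W p]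
    change _ ↔ p ∈ Set.range (LinearMap.pi (rowFunctional W) ∘ ψ)
    rw [ψ.surjective.range_comp]
    rfl
  · intro s s' hss
    apply hinj
    refine LinearMap.ext fun v => ?_
    -- Faithfulness survives the extension of scalars because `ℤ` embeds in `ℤ₂`: coordinates are
    -- compared on pure tensors `1 ⊗ v`.
    have h1 := LinearMap.congr_fun hss (1 ⊗ₜ v)
    rw [padicExtension_tmul, padicExtension_tmul] at h1
    let b := (Pi.basisFun ℤ (Fin r)).baseChange ℤ_[2]
    ext k
    have h2 := congrArg (fun w => b.repr w k) h1
    simp only [b, Module.Basis.baseChange_repr_tmul, Pi.basisFun_repr] at h2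
    simpa using h2

end CertifiedFamilies

/-! ### The fourteen indicator vectors and their canonical expansions. -/

namespace N3

/-- The matrix `a₁` in the basis in which the matrices of `b₁`, `b₂`, `r` are given. -/
def alpha : GL (Fin 3) ℤ :=
  ⟨!![-1, 0, 1; 0, -1, 1; 0, 0, 1], !![-1, 0, 1; 0, -1, 1; 0, 0, 1], by decide, by decide⟩

/-- The matrix `q` in the basis in which the matrices of `b₁`, `b₂`, `r` are given. -/
def kappa : GL (Fin 3) ℤ :=
  ⟨!![0, 1, 0; 0, 1, -1; -1, 1, 0], !![1, 0, -1; 1, 0, 0; 1, -1, 0], by decide, by decide⟩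

/-! With `d = 0` added as a fourth coordinate, an integral vector is the sum over the proper
nonempty subsets `A` of its coordinates of the indicator vectors of `A` (modulo `(1, 1, 1, 1)`),
with coefficients `max 0 (min A - max Aᶜ)`. -/

def coeff₁ (a b c d : ℤ) : ℤ := max 0 (a - max b (max c d))

def coeff₂ (a b c d : ℤ) : ℤ := max 0 (min a b - max c d)

def coeff₃ (a b c d : ℤ) : ℤ := max 0 (min a (min b c) - d)

/-- The coefficients of the fourteen indicator vectors, in the order `e₁`, `e₂`, `e₃`, `(1, 1, 1)`,
their negatives, `(0, 1, 1)`, `(1, 0, 1)`, `(1, 1, 0)`, their negatives. -/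
def coeffs (v : Fin 3 → ℤ) : Fin 14 → ℤ :=
  ![coeff₁ (v 0) (v 1) (v 2) 0,
    coeff₁ (v 1) (v 0) (v 2) 0,
    coeff₁ (v 2) (v 0) (v 1) 0,
    coeff₃ (v 0) (v 1) (v 2) 0,
    coeff₃ (v 1) (v 2) 0 (v 0),
    coeff₃ (v 0) (v 2) 0 (v 1),
    coeff₃ (v 0) (v 1) 0 (v 2),
    coeff₁ 0 (v 0) (v 1) (v 2),
    coeff₂ (v 1) (v 2) (v 0) 0,
    coeff₂ (v 0) (v 2) (v 1) 0,
    coeff₂ (v 0) (v 1) (v 2) 0,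
    coeff₂ (v 0) 0 (v 1) (v 2),
    coeff₂ (v 1) 0 (v 0) (v 2),
    coeff₂ (v 2) 0 (v 0) (v 1)]

/-- The fourteen indicator vectors. -/
def indicators : Fin 14 → Fin 3 → ℤ :=
  ![![1, 0, 0],
    ![0, 1, 0],
    ![0, 0, 1],
    ![1, 1, 1],
    ![-1, 0, 0],
    ![0, -1, 0],
    ![0, 0, -1],
    ![-1, -1, -1],
    ![0, 1, 1],
    ![1, 0, 1],
    ![1, 1, 0],
    ![0, -1, -1],
    ![-1, 0, -1],
    ![-1, -1, 0]]

/-- Only superlevel sets of the four coordinates contribute, each with the gap between consecutive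
values, and these gaps telescope. -/
theorem sum_coeffs (v : Fin 3 → ℤ) (d : Fin 3) : ∑ k, coeffs v k * indicators k d = v d := by
  simp only [Fin.sum_univ_succ, Fin.sum_univ_zero]
  fin_cases d <;>
    simp [indicators, coeffs] <;> simp only [coeff₁, coeff₂, coeff₃] <;> grind

/-- A certificate for a family containing the unit vectors and their negatives, given by
expressions of the fourteen indicator vectors as sums of members of the family. -/
theorem expansionCertificate {r t : ℕ} {γ : Fin t → GL (Fin 3) ℤ}
    {W : Matrix (Fin r) (Fin 3) ℤ} {σ : Fin t → Fin 3 ⊕ Fin r → Fin 3 ⊕ Fin r}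
    (τ : Fin t → Fin 14 → Fin 14) (expr : Fin 14 → Finset (Fin 3 ⊕ Fin r))
    (hτ : ∀ g v k, coeffs ((γ g).1.mulVec v) (τ g k) = coeffs v k)
    (injτ : ∀ g k k', τ g k = τ g k' → k = k')
    (hexpr : ∀ g k i, σ g i ∈ expr (τ g k) ↔ i ∈ expr k)
    (sum_expr : ∀ k d, (∑ i, if i ∈ expr k then rowEntry W i d else 0) = indicators k d)
    (inj : ∀ i j, (∀ k, rowEntry W i k = rowEntry W j k) → i = j)
    (row_gen : ∀ g i, withUnitRows W (σ g i) = (γ g).1.mulVec (withUnitRows W i))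
    (col : ∀ l i, ∃ k, k ≠ l ∧ rowEntry W (Sum.inr k) i ≠ 0)
    (neg : ∀ i, ∃ k, ∀ j, rowEntry W (Sum.inr k) j = if j = i then -1 else 0) :
    ExpansionCertificate γ W σ (fun v i => ∑ k, if i ∈ expr k then coeffs v k else 0) where
  injective_rows := inj
  row_gen := row_gen
  column_ne_zero := col
  neg_unit := neg
  coeff_gen g v i := by
    refine (Fintype.sum_bijective (τ g) (Finite.injective_iff_bijective.1 fun k k' => injτ g k k')
      _ _ fun k => ?_).symm
    simp only [hτ, hexpr]
  coeff_vecMul v := by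
    ext d
    simp only [Matrix.vecMul, dotProduct, Finset.sum_mul]
    rw [Finset.sum_comm]
    conv_rhs => rw [← sum_coeffs v d]
    refine Finset.sum_congr rfl fun k _ => ?_
    rw [← sum_expr, Finset.mul_sum]
    refine Finset.sum_congr rfl fun i _ => ?_
    simp only [rowEntry, ite_mul, zero_mul, mul_ite, mul_zero]

/-- On `ℤ⁴/(1,1,1,1)` the matrix `alpha` is minus the exchange of the last two coordinates.
Permuting coordinates permutes the subsets `A`, negation exchanges `A` with its complement, and both
respect the coefficient `max 0 (min A - max Aᶜ)`; this is the source of all the equivariance lemmas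
that follow. -/
def alphaPerm : Fin 14 → Fin 14 := ![4, 5, 3, 2, 0, 1, 7, 6, 9, 8, 13, 12, 11, 10]

theorem coeffs_alpha (v : Fin 3 → ℤ) (k : Fin 14) :
    coeffs ((alpha : GL (Fin 3) ℤ).1.mulVec v) (alphaPerm k) = coeffs v k := by
  have h : (alpha : GL (Fin 3) ℤ).1.mulVec v = ![-v 0 + v 2, -v 1 + v 2, v 2] := by
    ext i
    fin_cases i <;> simp [alpha, Matrix.mulVec, dotProduct, Fin.sum_univ_succ]
  fin_cases k <;>
    simp only [alphaPerm, Fin.zero_eta, Fin.mk_one, Fin.reduceFinMk, h, coeffs, coeff₁, coeff₂,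
      coeff₃, Matrix.cons_val, Matrix.cons_val_zero, Matrix.cons_val_one] <;>
    omega

def b₁Perm : Fin 14 → Fin 14 := ![7, 2, 1, 4, 3, 6, 5, 0, 8, 12, 13, 11, 9, 10]

theorem coeffs_b₁ (v : Fin 3 → ℤ) (k : Fin 14) :
    coeffs ((b₁ : GL (Fin 3) ℤ).1.mulVec v) (b₁Perm k) = coeffs v k := by
  have h : (b₁ : GL (Fin 3) ℤ).1.mulVec v = ![-v 0, -v 0 + v 2, -v 0 + v 1] := by
    ext i
    fin_cases i <;> simp [b₁, Matrix.mulVec, dotProduct, Fin.sum_univ_succ]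
  fin_cases k <;>
    simp only [b₁Perm, Fin.zero_eta, Fin.mk_one, Fin.reduceFinMk, h, coeffs, coeff₁, coeff₂,
      coeff₃, Matrix.cons_val, Matrix.cons_val_zero, Matrix.cons_val_one] <;>
    omega

def b₂Perm : Fin 14 → Fin 14 := ![1, 0, 7, 6, 5, 4, 3, 2, 11, 12, 10, 8, 9, 13]

theorem coeffs_b₂ (v : Fin 3 → ℤ) (k : Fin 14) :
    coeffs ((b₂ : GL (Fin 3) ℤ).1.mulVec v) (b₂Perm k) = coeffs v k := by
  have h : (b₂ : GL (Fin 3) ℤ).1.mulVec v = ![v 1 - v 2, v 0 - v 2, -v 2] := by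
    ext i
    fin_cases i <;> simp [b₂, Matrix.mulVec, dotProduct, Fin.sum_univ_succ] <;> ring
  fin_cases k <;>
    simp only [b₂Perm, Fin.zero_eta, Fin.mk_one, Fin.reduceFinMk, h, coeffs, coeff₁, coeff₂,
      coeff₃, Matrix.cons_val, Matrix.cons_val_zero, Matrix.cons_val_one] <;>
    omega

/-- Here `kappa` is minus a `4`-cycle of the coordinates, so it exchanges singletons with
three-element subsets. -/
def kappaPerm : Fin 14 → Fin 14 := ![6, 3, 5, 0, 2, 7, 1, 4, 9, 11, 10, 12, 8, 13]

theorem coeffs_kappa (v : Fin 3 → ℤ) (k : Fin 14) :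
    coeffs ((kappa : GL (Fin 3) ℤ).1.mulVec v) (kappaPerm k) = coeffs v k := by
  have h : (kappa : GL (Fin 3) ℤ).1.mulVec v = ![v 1, v 1 - v 2, -v 0 + v 1] := by
    ext i
    fin_cases i <;> simp [kappa, Matrix.mulVec, dotProduct, Fin.sum_univ_succ]; ring
  fin_cases k <;>
    simp only [kappaPerm, Fin.zero_eta, Fin.mk_one, Fin.reduceFinMk, h, coeffs, coeff₁, coeff₂,
      coeff₃, Matrix.cons_val, Matrix.cons_val_zero, Matrix.cons_val_one] <;>
    omega

def negKappaPerm : Fin 14 → Fin 14 := ![2, 7, 1, 4, 6, 3, 5, 0, 12, 8, 13, 9, 11, 10]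

theorem coeffs_negKappa (v : Fin 3 → ℤ) (k : Fin 14) :
    coeffs ((-kappa : GL (Fin 3) ℤ).1.mulVec v) (negKappaPerm k) = coeffs v k := by
  have h : (-kappa : GL (Fin 3) ℤ).1.mulVec v = ![-v 1, -v 1 + v 2, v 0 - v 1] := by
    ext i
    fin_cases i <;> simp [kappa, Matrix.mulVec, dotProduct, Fin.sum_univ_succ] <;> ring
  fin_cases k <;>
    simp only [negKappaPerm, Fin.zero_eta, Fin.mk_one, Fin.reduceFinMk, h, coeffs, coeff₁, coeff₂,
      coeff₃, Matrix.cons_val, Matrix.cons_val_zero, Matrix.cons_val_one] <;>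
    omega

def negOnePerm : Fin 14 → Fin 14 := ![4, 5, 6, 7, 0, 1, 2, 3, 11, 12, 13, 8, 9, 10]

theorem coeffs_negOne (v : Fin 3 → ℤ) (k : Fin 14) :
    coeffs ((-1 : GL (Fin 3) ℤ).1.mulVec v) (negOnePerm k) = coeffs v k := by
  have h : (-1 : GL (Fin 3) ℤ).1.mulVec v = ![-v 0, -v 1, -v 2] := by
    ext i
    fin_cases i <;> simp [Matrix.neg_mulVec]
  fin_cases k <;>
    simp only [negOnePerm, Fin.zero_eta, Fin.mk_one, Fin.reduceFinMk, h, coeffs, coeff₁, coeff₂,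
      coeff₃, Matrix.cons_val, Matrix.cons_val_zero, Matrix.cons_val_one] <;>
    omega


/-! ### The seven certified families. -/

/-- The vectors complementing the unit vectors in the family for `kleinGens`. -/
def kleinRows : Matrix (Fin 5) (Fin 3) ℤ :=
  !![-1, -1, -1; 0, 0, -1; 1, 1, 1; -1, 0, 0; 0, -1, 0]

def kleinGens : Fin 2 → GL (Fin 3) ℤ := ![alpha, N3.b₂]

def kleinPerm : Fin 2 → Fin 3 ⊕ Fin 5 → Fin 3 ⊕ Fin 5 :=
  ![Sum.elim ![Sum.inr 3, Sum.inr 4, Sum.inr 2]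
      ![Sum.inr 1, Sum.inr 0, Sum.inl 2, Sum.inl 0, Sum.inl 1],
    Sum.elim ![Sum.inl 1, Sum.inl 0, Sum.inr 0]
      ![Sum.inl 2, Sum.inr 2, Sum.inr 1, Sum.inr 4, Sum.inr 3]]

/-- Expressions of the indicator vectors as sums of vectors in the family. -/
def kleinExpr : Fin 14 → Finset (Fin 3 ⊕ Fin 5) :=
  ![{Sum.inl 0},
    {Sum.inl 1},
    {Sum.inl 2},
    {Sum.inr 2},
    {Sum.inr 3},
    {Sum.inr 4},
    {Sum.inr 1},
    {Sum.inr 0},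
    {Sum.inr 2, Sum.inr 3},
    {Sum.inl 2, Sum.inl 0},
    {Sum.inr 2, Sum.inr 1},
    {Sum.inr 1, Sum.inr 4},
    {Sum.inr 0, Sum.inl 1},
    {Sum.inl 2, Sum.inr 0}]

def kleinOrbit : Fin 5 → Fin 2 := ![0, 0, 0, 1, 1]

def kleinRep : Fin 2 → Fin 5 := ![0, 3]

/-- The entries for `j = 0` are empty because only the columns `j ≠ 0` are certified; the first
column of an idempotent follows from the others. -/
def kleinCert : Fin 2 → Fin 2 → List (Fin 2 × Fin 5 × Fin 5) :=
  ![![[],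
      [(1, 2, 1), (0, 2, 1), (0, 3, 1)]],
    ![[],
      [(0, 0, 4), (1, 0, 4), (0, 3, 2), (0, 4, 3), (1, 0, 2), (0, 2, 2)]]]

theorem klein_localTop : LocalTopCertificate (fun g => cokernelMatrix kleinRows (kleinPerm g))
    kleinOrbit kleinRep kleinCert where
  orbit_rep := by decide
  fixed := by decide +kernel
  eq_rep := eq_rep_of_forest _ _ _ _ (by decide +kernel)
  certified := by decide +kernel

theorem klein_expansion :
    ExpansionCertificate kleinGens kleinRows kleinPerm
      fun v i => ∑ k, if i ∈ kleinExpr k then coeffs v k else 0 :=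
  expansionCertificate ![alphaPerm, b₂Perm] kleinExpr
    (fun g => by fin_cases g <;> [exact coeffs_alpha; exact coeffs_b₂])
    (by decide +kernel) (by decide +kernel) (by decide +kernel) (by decide +kernel)
    (by decide +kernel) (by decide +kernel) (by decide +kernel)

/-- The vectors complementing the unit vectors in the family for `kleinNegGens`. -/
def kleinNegRows : Matrix (Fin 9) (Fin 3) ℤ :=
  !![-1, -1, -1; 0, 0, -1; 1, 1, 1; -1, 0, 0; 0, -1, 0; -1, 0, -1; 0, -1, -1; 0, 1, 1; 1, 0, 1]

def kleinNegGens : Fin 3 → GL (Fin 3) ℤ := ![alpha, N3.b₂, -1]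

/-- With `-1` among the generators, part of the two-element indicators joins the family; the two
remaining ones are sums of an opposite pair of coordinate indicators. -/
def kleinNegPerm : Fin 3 → Fin 3 ⊕ Fin 9 → Fin 3 ⊕ Fin 9 :=
  ![Sum.elim ![Sum.inr 3, Sum.inr 4, Sum.inr 2]
      ![Sum.inr 1, Sum.inr 0, Sum.inl 2, Sum.inl 0, Sum.inl 1, Sum.inr 6, Sum.inr 5, Sum.inr 8,
        Sum.inr 7],
    Sum.elim ![Sum.inl 1, Sum.inl 0, Sum.inr 0]
      ![Sum.inl 2, Sum.inr 2, Sum.inr 1, Sum.inr 4, Sum.inr 3, Sum.inr 8, Sum.inr 7, Sum.inr 6,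
        Sum.inr 5],
    Sum.elim ![Sum.inr 3, Sum.inr 4, Sum.inr 1]
      ![Sum.inr 2, Sum.inl 2, Sum.inr 0, Sum.inl 0, Sum.inl 1, Sum.inr 8, Sum.inr 7, Sum.inr 6,
        Sum.inr 5]]

/-- Expressions of the indicator vectors as sums of vectors in the family. -/
def kleinNegExpr : Fin 14 → Finset (Fin 3 ⊕ Fin 9) :=
  ![{Sum.inl 0},
    {Sum.inl 1},
    {Sum.inl 2},
    {Sum.inr 2},
    {Sum.inr 3},
    {Sum.inr 4},
    {Sum.inr 1},
    {Sum.inr 0},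
    {Sum.inr 7},
    {Sum.inr 8},
    {Sum.inr 1, Sum.inr 2},
    {Sum.inr 6},
    {Sum.inr 5},
    {Sum.inr 0, Sum.inl 2}]

def kleinNegOrbit : Fin 9 → Fin 3 := ![0, 0, 0, 1, 1, 2, 2, 2, 2]

def kleinNegRep : Fin 3 → Fin 9 := ![0, 3, 5]

def kleinNegCert : Fin 3 → Fin 3 → List (Fin 3 × Fin 9 × Fin 9) :=
  ![![[],
      [(2, 3, 1), (0, 3, 1)],
      [(1, 5, 1), (2, 5, 1)]],
    ![[],
      [(0, 2, 4), (2, 5, 1), (2, 2, 2), (1, 0, 4), (2, 0, 3), (1, 5, 0), (0, 3, 1), (2, 3, 0)],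
      [(1, 8, 3), (2, 8, 4)]],
    ![[],
      [(2, 3, 6), (0, 3, 6), (2, 3, 7), (0, 3, 7)],
      [(0, 5, 6), (0, 6, 1), (2, 1, 2), (1, 1, 8), (2, 5, 0), (0, 8, 3), (0, 0, 5), (2, 1, 7), (0,
        2, 2), (1, 0, 3), (2, 0, 6), (0, 6, 8), (0, 2, 7), (1, 8, 7), (1, 0, 6), (1, 6, 6)]]]

theorem kleinNeg_localTop : LocalTopCertificate (fun g => cokernelMatrix kleinNegRows (kleinNegPerm g))
    kleinNegOrbit kleinNegRep kleinNegCert where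
  orbit_rep := by decide
  fixed := by decide +kernel
  eq_rep := eq_rep_of_forest _ _ _ _ (by decide +kernel)
  certified := by decide +kernel

theorem kleinNeg_expansion :
    ExpansionCertificate kleinNegGens kleinNegRows kleinNegPerm
      fun v i => ∑ k, if i ∈ kleinNegExpr k then coeffs v k else 0 :=
  expansionCertificate ![alphaPerm, b₂Perm, negOnePerm] kleinNegExpr
    (fun g => by fin_cases g <;> [exact coeffs_alpha; exact coeffs_b₂; exact coeffs_negOne])
    (by decide +kernel) (by decide +kernel) (by decide +kernel) (by decide +kernel)
    (by decide +kernel) (by decide +kernel) (by decide +kernel)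

/-- The vectors complementing the unit vectors in the family for `boxNegGens`. -/
def boxNegRows : Matrix (Fin 11) (Fin 3) ℤ :=
  !![-1, -1, -1; 1, 1, 1; -1, 0, 0; 0, -1, 0; 0, 0, -1; -1, -1, 0; 1, 1, 0; -1, 0, -1; 1, 0, 1; 0,
    -1, -1; 0, 1, 1]

/-- Here all fourteen indicator vectors are members, so the coefficients are exactly the canonical
ones. -/
def boxNegGens : Fin 3 → GL (Fin 3) ℤ := ![N3.b₁, N3.b₂, -1]

def boxNegPerm : Fin 3 → Fin 3 ⊕ Fin 11 → Fin 3 ⊕ Fin 11 :=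
  ![Sum.elim ![Sum.inr 0, Sum.inl 2, Sum.inl 1]
      ![Sum.inl 0, Sum.inr 2, Sum.inr 1, Sum.inr 4, Sum.inr 3, Sum.inr 6, Sum.inr 5, Sum.inr 8,
        Sum.inr 7, Sum.inr 9, Sum.inr 10],
    Sum.elim ![Sum.inl 1, Sum.inl 0, Sum.inr 0]
      ![Sum.inl 2, Sum.inr 4, Sum.inr 3, Sum.inr 2, Sum.inr 1, Sum.inr 5, Sum.inr 6, Sum.inr 8,
        Sum.inr 7, Sum.inr 10, Sum.inr 9],
    Sum.elim ![Sum.inr 2, Sum.inr 3, Sum.inr 4]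
      ![Sum.inr 1, Sum.inr 0, Sum.inl 0, Sum.inl 1, Sum.inl 2, Sum.inr 6, Sum.inr 5, Sum.inr 8,
        Sum.inr 7, Sum.inr 10, Sum.inr 9]]

/-- Expressions of the indicator vectors as sums of vectors in the family. -/
def boxNegExpr : Fin 14 → Finset (Fin 3 ⊕ Fin 11) :=
  ![{Sum.inl 0},
    {Sum.inl 1},
    {Sum.inl 2},
    {Sum.inr 1},
    {Sum.inr 2},
    {Sum.inr 3},
    {Sum.inr 4},
    {Sum.inr 0},
    {Sum.inr 10},
    {Sum.inr 8},
    {Sum.inr 6},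
    {Sum.inr 9},
    {Sum.inr 7},
    {Sum.inr 5}]

def boxNegOrbit : Fin 11 → Fin 4 := ![0, 0, 0, 0, 0, 1, 1, 2, 2, 3, 3]

def boxNegRep : Fin 4 → Fin 11 := ![0, 5, 7, 9]

def boxNegCert : Fin 4 → Fin 4 → List (Fin 3 × Fin 11 × Fin 11) :=
  ![![[],
      [(0, 5, 0), (2, 5, 0)],
      [(2, 7, 0), (0, 7, 0)],
      [(0, 9, 3), (0, 9, 2)]],
    ![[],
      [(2, 0, 6), (1, 5, 2), (2, 5, 6), (1, 7, 6), (0, 0, 6), (2, 0, 0), (0, 1, 6), (2, 0, 5)],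
      [(2, 8, 5), (1, 8, 6), (2, 7, 3), (1, 8, 3)],
      [(1, 10, 3), (2, 10, 3), (2, 10, 5), (1, 10, 6)]],
    ![[],
      [(0, 5, 5), (2, 5, 5), (1, 5, 2), (1, 5, 7)],
      [(2, 1, 8), (2, 1, 1), (1, 6, 7), (0, 7, 5), (2, 7, 5), (0, 1, 7), (2, 0, 8), (2, 7, 2), (0,
        7, 7), (2, 0, 3), (0, 6, 7), (1, 8, 3), (0, 0, 7)],
      [(0, 9, 7), (1, 9, 10), (0, 9, 4), (2, 9, 10)]],
    ![[],
      [(1, 5, 10), (0, 5, 5), (2, 5, 5), (1, 5, 2)],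
      [(0, 8, 10), (2, 8, 9), (0, 7, 4), (2, 8, 3)],
      [(2, 0, 9), (2, 0, 2), (0, 10, 4), (0, 7, 10), (1, 1, 10), (2, 1, 1), (2, 10, 9), (1, 0,
        10), (2, 1, 9)]]]

theorem boxNeg_localTop : LocalTopCertificate (fun g => cokernelMatrix boxNegRows (boxNegPerm g))
    boxNegOrbit boxNegRep boxNegCert where
  orbit_rep := by decide
  fixed := by decide +kernel
  eq_rep := eq_rep_of_forest _ _ _ _ (by decide +kernel)
  certified := by decide +kernel

theorem boxNeg_expansion :
    ExpansionCertificate boxNegGens boxNegRows boxNegPerm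
      fun v i => ∑ k, if i ∈ boxNegExpr k then coeffs v k else 0 :=
  expansionCertificate ![b₁Perm, b₂Perm, negOnePerm] boxNegExpr
    (fun g => by fin_cases g <;> [exact coeffs_b₁; exact coeffs_b₂; exact coeffs_negOne])
    (by decide +kernel) (by decide +kernel) (by decide +kernel) (by decide +kernel)
    (by decide +kernel) (by decide +kernel) (by decide +kernel)

/-- The vectors complementing the unit vectors in the family for `cyclicNegGens`. -/
def cyclicNegRows : Matrix (Fin 11) (Fin 3) ℤ :=
  !![-1, -1, -1; -1, 0, 0; 0, -1, 0; 1, 1, 1; 0, 0, -1; -1, 0, -1; 0, -1, -1; 0, 1, 1; 1, 0,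
    1; -1, -1, 0; 1, 1, 0]

/-- `N3.b₂` is the square of `kappa`; this redundant generator provides its commutator entries and
orbit links directly. The same holds in the dihedral families. -/
def cyclicNegGens : Fin 3 → GL (Fin 3) ℤ := ![kappa, -1, N3.b₂]

def cyclicNegPerm : Fin 3 → Fin 3 ⊕ Fin 11 → Fin 3 ⊕ Fin 11 :=
  ![Sum.elim ![Sum.inr 4, Sum.inr 3, Sum.inr 2]
      ![Sum.inr 1, Sum.inl 2, Sum.inr 0, Sum.inl 0, Sum.inl 1, Sum.inr 7, Sum.inr 5, Sum.inr 8,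
        Sum.inr 6, Sum.inr 9, Sum.inr 10],
    Sum.elim ![Sum.inr 1, Sum.inr 2, Sum.inr 4]
      ![Sum.inr 3, Sum.inl 0, Sum.inl 1, Sum.inr 0, Sum.inl 2, Sum.inr 8, Sum.inr 7, Sum.inr 6,
        Sum.inr 5, Sum.inr 10, Sum.inr 9],
    Sum.elim ![Sum.inl 1, Sum.inl 0, Sum.inr 0]
      ![Sum.inl 2, Sum.inr 2, Sum.inr 1, Sum.inr 4, Sum.inr 3, Sum.inr 8, Sum.inr 7, Sum.inr 6,
        Sum.inr 5, Sum.inr 9, Sum.inr 10]]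

/-- Expressions of the indicator vectors as sums of vectors in the family. -/
def cyclicNegExpr : Fin 14 → Finset (Fin 3 ⊕ Fin 11) :=
  ![{Sum.inl 0},
    {Sum.inl 1},
    {Sum.inl 2},
    {Sum.inr 3},
    {Sum.inr 1},
    {Sum.inr 2},
    {Sum.inr 4},
    {Sum.inr 0},
    {Sum.inr 7},
    {Sum.inr 8},
    {Sum.inr 10},
    {Sum.inr 6},
    {Sum.inr 5},
    {Sum.inr 9}]

def cyclicNegOrbit : Fin 11 → Fin 3 := ![0, 0, 0, 0, 0, 1, 1, 1, 1, 2, 2]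

def cyclicNegRep : Fin 3 → Fin 11 := ![0, 5, 9]

def cyclicNegCert : Fin 3 → Fin 3 → List (Fin 3 × Fin 11 × Fin 11) :=
  ![![[],
      [(2, 5, 0), (1, 5, 0)],
      [(0, 9, 0)]],
    ![[],
      [(2, 8, 0), (2, 7, 6), (1, 6, 7), (1, 4, 6), (2, 3, 7), (2, 5, 5), (1, 5, 5), (0, 6, 5), (2,
        8, 7), (1, 0, 0), (2, 0, 7), (1, 6, 0), (1, 4, 7), (0, 5, 6)],
      [(0, 9, 8), (0, 9, 5)]],
    ![[],
      [(2, 5, 10), (1, 8, 9), (1, 5, 1), (2, 5, 2)],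
      [(1, 0, 4), (2, 8, 9), (2, 9, 1), (1, 0, 3), (0, 0, 9), (0, 3, 9), (1, 9, 9)]]]

theorem cyclicNeg_localTop : LocalTopCertificate (fun g => cokernelMatrix cyclicNegRows (cyclicNegPerm g))
    cyclicNegOrbit cyclicNegRep cyclicNegCert where
  orbit_rep := by decide
  fixed := by decide +kernel
  eq_rep := eq_rep_of_forest _ _ _ _ (by decide +kernel)
  certified := by decide +kernel

theorem cyclicNeg_expansion :
    ExpansionCertificate cyclicNegGens cyclicNegRows cyclicNegPerm
      fun v i => ∑ k, if i ∈ cyclicNegExpr k then coeffs v k else 0 :=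
  expansionCertificate ![kappaPerm, negOnePerm, b₂Perm] cyclicNegExpr
    (fun g => by fin_cases g <;> [exact coeffs_kappa; exact coeffs_negOne; exact coeffs_b₂])
    (by decide +kernel) (by decide +kernel) (by decide +kernel) (by decide +kernel)
    (by decide +kernel) (by decide +kernel) (by decide +kernel)

/-- The vectors complementing the unit vectors in the family for `dihedralGens`. -/
def dihedralRows : Matrix (Fin 7) (Fin 3) ℤ :=
  !![-1, -1, -1; -1, 0, 0; 0, -1, 0; 0, 0, -1; 1, 1, 1; 1, 1, 0; -1, -1, 0]

def dihedralGens : Fin 3 → GL (Fin 3) ℤ := ![kappa, alpha, N3.b₂]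

def dihedralPerm : Fin 3 → Fin 3 ⊕ Fin 7 → Fin 3 ⊕ Fin 7 :=
  ![Sum.elim ![Sum.inr 3, Sum.inr 4, Sum.inr 2]
      ![Sum.inr 1, Sum.inl 2, Sum.inr 0, Sum.inl 1, Sum.inl 0, Sum.inr 5, Sum.inr 6],
    Sum.elim ![Sum.inr 1, Sum.inr 2, Sum.inr 4]
      ![Sum.inr 3, Sum.inl 0, Sum.inl 1, Sum.inr 0, Sum.inl 2, Sum.inr 6, Sum.inr 5],
    Sum.elim ![Sum.inl 1, Sum.inl 0, Sum.inr 0]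
      ![Sum.inl 2, Sum.inr 2, Sum.inr 1, Sum.inr 4, Sum.inr 3, Sum.inr 5, Sum.inr 6]]

/-- Expressions of the indicator vectors as sums of vectors in the family. -/
def dihedralExpr : Fin 14 → Finset (Fin 3 ⊕ Fin 7) :=
  ![{Sum.inl 0},
    {Sum.inl 1},
    {Sum.inl 2},
    {Sum.inr 4},
    {Sum.inr 1},
    {Sum.inr 2},
    {Sum.inr 3},
    {Sum.inr 0},
    {Sum.inr 1, Sum.inr 4},
    {Sum.inl 0, Sum.inl 2},
    {Sum.inr 5},
    {Sum.inr 3, Sum.inr 2},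
    {Sum.inl 1, Sum.inr 0},
    {Sum.inr 6}]

def dihedralOrbit : Fin 7 → Fin 2 := ![0, 0, 0, 0, 0, 1, 1]

def dihedralRep : Fin 2 → Fin 7 := ![0, 5]

def dihedralCert : Fin 2 → Fin 2 → List (Fin 3 × Fin 7 × Fin 7) :=
  ![![[],
      [(0, 5, 0)]],
    ![[],
      [(0, 4, 6), (1, 5, 6), (2, 3, 3), (0, 0, 6), (2, 0, 4), (2, 5, 2), (1, 0, 0)]]]

theorem dihedral_localTop : LocalTopCertificate (fun g => cokernelMatrix dihedralRows (dihedralPerm g))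
    dihedralOrbit dihedralRep dihedralCert where
  orbit_rep := by decide
  fixed := by decide +kernel
  eq_rep := eq_rep_of_forest _ _ _ _ (by decide +kernel)
  certified := by decide +kernel

theorem dihedral_expansion :
    ExpansionCertificate dihedralGens dihedralRows dihedralPerm
      fun v i => ∑ k, if i ∈ dihedralExpr k then coeffs v k else 0 :=
  expansionCertificate ![kappaPerm, alphaPerm, b₂Perm] dihedralExpr
    (fun g => by fin_cases g <;> [exact coeffs_kappa; exact coeffs_alpha; exact coeffs_b₂])
    (by decide +kernel) (by decide +kernel) (by decide +kernel) (by decide +kernel)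
    (by decide +kernel) (by decide +kernel) (by decide +kernel)

/-- The vectors complementing the unit vectors in the family for `dihedralNegGens`. -/
def dihedralNegRows : Matrix (Fin 7) (Fin 3) ℤ :=
  !![-1, -1, -1; 0, 0, -1; 1, 1, 1; -1, 0, 0; 0, -1, 0; 1, 1, 0; -1, -1, 0]

def dihedralNegGens : Fin 3 → GL (Fin 3) ℤ := ![-kappa, alpha, N3.b₂]

def dihedralNegPerm : Fin 3 → Fin 3 ⊕ Fin 7 → Fin 3 ⊕ Fin 7 :=
  ![Sum.elim ![Sum.inl 2, Sum.inr 0, Sum.inl 1]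
      ![Sum.inl 0, Sum.inr 4, Sum.inr 3, Sum.inr 1, Sum.inr 2, Sum.inr 6, Sum.inr 5],
    Sum.elim ![Sum.inr 3, Sum.inr 4, Sum.inr 2]
      ![Sum.inr 1, Sum.inr 0, Sum.inl 2, Sum.inl 0, Sum.inl 1, Sum.inr 6, Sum.inr 5],
    Sum.elim ![Sum.inl 1, Sum.inl 0, Sum.inr 0]
      ![Sum.inl 2, Sum.inr 2, Sum.inr 1, Sum.inr 4, Sum.inr 3, Sum.inr 5, Sum.inr 6]]

/-- Expressions of the indicator vectors as sums of vectors in the family. -/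
def dihedralNegExpr : Fin 14 → Finset (Fin 3 ⊕ Fin 7) :=
  ![{Sum.inl 0},
    {Sum.inl 1},
    {Sum.inl 2},
    {Sum.inr 2},
    {Sum.inr 3},
    {Sum.inr 4},
    {Sum.inr 1},
    {Sum.inr 0},
    {Sum.inl 1, Sum.inr 2, Sum.inr 6},
    {Sum.inr 4, Sum.inl 2, Sum.inr 5},
    {Sum.inr 5},
    {Sum.inr 1, Sum.inl 0, Sum.inr 6},
    {Sum.inr 0, Sum.inr 3, Sum.inr 5},
    {Sum.inr 6}]

def dihedralNegOrbit : Fin 7 → Fin 2 := ![0, 0, 0, 0, 0, 1, 1]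

def dihedralNegRep : Fin 2 → Fin 7 := ![0, 5]

def dihedralNegCert : Fin 2 → Fin 2 → List (Fin 3 × Fin 7 × Fin 7) :=
  ![![[],
      [(2, 5, 1), (2, 5, 3)]],
    ![[],
      [(2, 0, 0), (2, 5, 3), (1, 0, 0), (1, 3, 6), (1, 5, 5), (1, 3, 5), (0, 0, 6), (0, 2, 6)]]]

theorem dihedralNeg_localTop : LocalTopCertificate (fun g => cokernelMatrix dihedralNegRows (dihedralNegPerm g))
    dihedralNegOrbit dihedralNegRep dihedralNegCert where
  orbit_rep := by decide
  fixed := by decide +kernel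
  eq_rep := eq_rep_of_forest _ _ _ _ (by decide +kernel)
  certified := by decide +kernel

theorem dihedralNeg_expansion :
    ExpansionCertificate dihedralNegGens dihedralNegRows dihedralNegPerm
      fun v i => ∑ k, if i ∈ dihedralNegExpr k then coeffs v k else 0 :=
  expansionCertificate ![negKappaPerm, alphaPerm, b₂Perm] dihedralNegExpr
    (fun g => by fin_cases g <;> [exact coeffs_negKappa; exact coeffs_alpha; exact coeffs_b₂])
    (by decide +kernel) (by decide +kernel) (by decide +kernel) (by decide +kernel)
    (by decide +kernel) (by decide +kernel) (by decide +kernel)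

/-- The vectors complementing the unit vectors in the family for `dihedralFullGens`. -/
def dihedralFullRows : Matrix (Fin 11) (Fin 3) ℤ :=
  !![-1, -1, -1; -1, 0, 0; 0, -1, 0; 0, 0, -1; 1, 1, 1; -1, 0, -1; 0, -1, -1; 0, 1, 1; 1, 0,
    1; -1, -1, 0; 1, 1, 0]

def dihedralFullGens : Fin 4 → GL (Fin 3) ℤ := ![kappa, alpha, -1, N3.b₂]

def dihedralFullPerm : Fin 4 → Fin 3 ⊕ Fin 11 → Fin 3 ⊕ Fin 11 :=
  ![Sum.elim ![Sum.inr 3, Sum.inr 4, Sum.inr 2]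
      ![Sum.inr 1, Sum.inl 2, Sum.inr 0, Sum.inl 1, Sum.inl 0, Sum.inr 7, Sum.inr 5, Sum.inr 8,
        Sum.inr 6, Sum.inr 9, Sum.inr 10],
    Sum.elim ![Sum.inr 1, Sum.inr 2, Sum.inr 4]
      ![Sum.inr 3, Sum.inl 0, Sum.inl 1, Sum.inr 0, Sum.inl 2, Sum.inr 6, Sum.inr 5, Sum.inr 8,
        Sum.inr 7, Sum.inr 10, Sum.inr 9],
    Sum.elim ![Sum.inr 1, Sum.inr 2, Sum.inr 3]
      ![Sum.inr 4, Sum.inl 0, Sum.inl 1, Sum.inl 2, Sum.inr 0, Sum.inr 8, Sum.inr 7, Sum.inr 6,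
        Sum.inr 5, Sum.inr 10, Sum.inr 9],
    Sum.elim ![Sum.inl 1, Sum.inl 0, Sum.inr 0]
      ![Sum.inl 2, Sum.inr 2, Sum.inr 1, Sum.inr 4, Sum.inr 3, Sum.inr 8, Sum.inr 7, Sum.inr 6,
        Sum.inr 5, Sum.inr 9, Sum.inr 10]]

/-- Expressions of the indicator vectors as sums of vectors in the family. -/
def dihedralFullExpr : Fin 14 → Finset (Fin 3 ⊕ Fin 11) :=
  ![{Sum.inl 0},
    {Sum.inl 1},
    {Sum.inl 2},
    {Sum.inr 4},
    {Sum.inr 1},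
    {Sum.inr 2},
    {Sum.inr 3},
    {Sum.inr 0},
    {Sum.inr 7},
    {Sum.inr 8},
    {Sum.inr 10},
    {Sum.inr 6},
    {Sum.inr 5},
    {Sum.inr 9}]

def dihedralFullOrbit : Fin 11 → Fin 3 := ![0, 0, 0, 0, 0, 1, 1, 1, 1, 2, 2]

def dihedralFullRep : Fin 3 → Fin 11 := ![0, 5, 9]

def dihedralFullCert : Fin 3 → Fin 3 → List (Fin 4 × Fin 11 × Fin 11) :=
  ![![[],
      [(2, 5, 0), (3, 5, 0)],
      [(0, 9, 0)]],
    ![[],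
      [(0, 6, 7), (2, 0, 5), (2, 0, 8), (2, 6, 6), (0, 5, 5), (3, 4, 5), (2, 5, 6), (3, 7, 4), (2,
        5, 0), (2, 0, 0), (3, 8, 7), (3, 7, 7), (2, 6, 3), (3, 5, 5), (0, 6, 0), (3, 0, 5)],
      [(3, 9, 5), (3, 9, 7)]],
    ![[],
      [(2, 5, 2), (3, 8, 1), (3, 5, 9), (2, 5, 9)],
      [(3, 5, 9), (3, 9, 2), (2, 0, 4), (2, 0, 3), (0, 0, 9), (2, 9, 9), (0, 4, 9)]]]

theorem dihedralFull_localTop : LocalTopCertificate (fun g => cokernelMatrix dihedralFullRows (dihedralFullPerm g))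
    dihedralFullOrbit dihedralFullRep dihedralFullCert where
  orbit_rep := by decide
  fixed := by decide +kernel
  eq_rep := eq_rep_of_forest _ _ _ _ (by decide +kernel)
  certified := by decide +kernel

theorem dihedralFull_expansion :
    ExpansionCertificate dihedralFullGens dihedralFullRows dihedralFullPerm
      fun v i => ∑ k, if i ∈ dihedralFullExpr k then coeffs v k else 0 :=
  expansionCertificate ![kappaPerm, alphaPerm, negOnePerm, b₂Perm] dihedralFullExpr
    (fun g => by fin_cases g <;> [exact coeffs_kappa; exact coeffs_alpha; exact coeffs_negOne; exact coeffs_b₂])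
    (by decide +kernel) (by decide +kernel) (by decide +kernel) (by decide +kernel)
    (by decide +kernel) (by decide +kernel) (by decide +kernel)

end N3

/-! ### Identification of the Sylow subgroups. -/

section SylowCertificates

namespace N3

def dihedralMatrix : Fin 16 → Matrix (Fin 3) (Fin 3) ℤ :=
  ![!![1, 0, 0; 0, 1, 0; 0, 0, 1],
    !![-1, 0, 0; -1, 0, 1; -1, 1, 0],
    !![-1, 0, 0; 0, -1, 0; 0, 0, -1],
    !![-1, 0, 1; -1, 0, 0; -1, 1, 0],
    !![-1, 0, 1; 0, -1, 1; 0, 0, 1],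
    !![0, -1, 0; -1, 0, 0; 0, 0, -1],
    !![0, -1, 0; 0, -1, 1; 1, -1, 0],
    !![0, -1, 1; -1, 0, 1; 0, 0, 1],
    !![0, -1, 1; 0, -1, 0; 1, -1, 0],
    !![0, 1, -1; 0, 1, 0; -1, 1, 0],
    !![0, 1, -1; 1, 0, -1; 0, 0, -1],
    !![0, 1, 0; 0, 1, -1; -1, 1, 0],
    !![0, 1, 0; 1, 0, 0; 0, 0, 1],
    !![1, 0, -1; 0, 1, -1; 0, 0, -1],
    !![1, 0, -1; 1, 0, 0; 1, -1, 0],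
    !![1, 0, 0; 1, 0, -1; 1, -1, 0]]

/-- The group of order `16` containing `b₁`, `b₂`, `r`, `-1`. -/
def dihedralGroup : Subgroup (GL (Fin 3) ℤ) where
  carrier := {x | ∃ k, x.1 = dihedralMatrix k}
  one_mem' := ⟨0, by decide⟩
  mul_mem' := by
    rintro x y ⟨k, hk⟩ ⟨l, hl⟩
    have : ∀ k l, ∃ m, dihedralMatrix k * dihedralMatrix l = dihedralMatrix m := by decide +kernel
    rw [Set.mem_ofPred_eq, Units.val_mul, hk, hl]
    exact this k l
  inv_mem' := by
    rintro x ⟨k, hk⟩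
    have : ∀ k, ∃ m, dihedralMatrix m * dihedralMatrix k = 1 := by decide +kernel
    obtain ⟨m, hm⟩ := this k
    refine ⟨m, ?_⟩
    rw [← hk] at hm
    rw [← Units.inv_eq_of_mul_eq_one_left (u := x) hm]

/-- Exponent four serves twice: it makes the candidate subgroup a `2`-group, and it lets inverses of
generators be replaced by cubes. -/
theorem pow_four_of_mem_dihedralGroup {x : GL (Fin 3) ℤ} (hx : x ∈ dihedralGroup) : x ^ 4 = 1 := by
  obtain ⟨k, hk⟩ := hx
  have : ∀ k, dihedralMatrix k * dihedralMatrix k * (dihedralMatrix k * dihedralMatrix k) = 1 := by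
    decide +kernel
  apply Units.ext
  rw [Units.val_pow_eq_pow_val, hk, Units.val_one, ← this k]
  simp only [pow_succ, pow_zero, one_mul, mul_assoc]

instance : Finite dihedralGroup := by
  refine Finite.of_injective (β := Fin 16) (fun x => x.2.choose) fun x y hxy => ?_
  apply Subtype.ext
  apply Units.ext
  have hx := x.2.choose_spec
  have hy := y.2.choose_spec
  rw [hx, hy]
  exact congrArg dihedralMatrix hxy

/-- The product of a word in the matrices `ν k`. -/
def wordProd {s : ℕ} (ν : Fin s → GL (Fin 3) ℤ) (w : List (Fin s)) : Matrix (Fin 3) (Fin 3) ℤ :=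
  (w.map fun k => (ν k).1).prod

theorem mem_closure_of_wordProd {s : ℕ} {ν : Fin s → GL (Fin 3) ℤ} (w : List (Fin s))
    {x : GL (Fin 3) ℤ} (hx : x.1 = wordProd ν w) : x ∈ Subgroup.closure (Set.range ν) := by
  have : x = (w.map ν).prod := by
    apply Units.ext
    rw [hx, wordProd, ← Units.coeHom_apply, map_list_prod, List.map_map]
    rfl
  rw [this]
  refine Subgroup.list_prod_mem _ fun y hy => ?_
  obtain ⟨k, -, rfl⟩ := List.mem_map.1 hy
  exact Subgroup.subset_closure ⟨k, rfl⟩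

/-- Words showing that the group `N` generated by `ν` is the union of the cosets `K`, `c K` and
`c⁻¹ K` of the subgroup `K` generated by `γ`. A generator of `N` is either `c` or an element of
`K`, in which case words for its products with powers of `c` are given. -/
structure CosetCertificate {s t : ℕ} (ν : Fin s → GL (Fin 3) ℤ) (γ : Fin t → GL (Fin 3) ℤ)
    (c : GL (Fin 3) ℤ) (into : Fin t → List (Fin s))
    (words : Fin s → List (Fin t) × (Bool × List (Fin t)) × (Bool × List (Fin t))) :
    Prop where
  mem_dihedral : ∀ g, ∃ k, (γ g).1 = dihedralMatrix k
  mem_closure : ∀ g, (γ g).1 = wordProd ν (into g)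
  cube : c.1 * c.1 * c.1 = 1
  -- The Booleans record the permutation of cosets: with `true` the generator maps `cK`,
  -- respectively `c⁻¹K`, to itself, and with `false` it sends it to the other of these two cosets.
  coset : ∀ n, (ν n).1 = c.1 ∨ (ν n).1 = wordProd γ (words n).1 ∧
    (bif (words n).2.1.1 then (c⁻¹).1 else c.1) * (ν n).1 * c.1 = wordProd γ (words n).2.1.2 ∧
    (bif (words n).2.2.1 then c.1 else (c⁻¹).1) * (ν n).1 * (c⁻¹).1 = wordProd γ (words n).2.2.2

namespace CosetCertificate

variable {s t : ℕ} {ν : Fin s → GL (Fin 3) ℤ} {γ : Fin t → GL (Fin 3) ℤ} {c : GL (Fin 3) ℤ}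
  {into : Fin t → List (Fin s)}
  {words : Fin s → List (Fin t) × (Bool × List (Fin t)) × (Bool × List (Fin t))}

theorem closure_le_dihedralGroup (h : CosetCertificate ν γ c into words) :
    Subgroup.closure (Set.range γ) ≤ dihedralGroup := by
  rw [Subgroup.closure_le]
  rintro _ ⟨g, rfl⟩
  exact h.mem_dihedral g

theorem closure_le (h : CosetCertificate ν γ c into words) :
    Subgroup.closure (Set.range γ) ≤ Subgroup.closure (Set.range ν) := by
  rw [Subgroup.closure_le]
  rintro _ ⟨g, rfl⟩
  exact mem_closure_of_wordProd _ (h.mem_closure g)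

theorem pow_three (h : CosetCertificate ν γ c into words) : c * c * c = 1 :=
  Units.ext h.cube

/-- The union of the three cosets is stable under left multiplication by the generators and their
inverses, and it contains the identity. -/
theorem mem_coset (h : CosetCertificate ν γ c into words) {x : GL (Fin 3) ℤ}
    (hx : x ∈ Subgroup.closure (Set.range ν)) :
    x ∈ Subgroup.closure (Set.range γ) ∨ c⁻¹ * x ∈ Subgroup.closure (Set.range γ) ∨
      c * x ∈ Subgroup.closure (Set.range γ) := by
  set K := Subgroup.closure (Set.range γ) with hK
  let P : GL (Fin 3) ℤ → Prop := fun x => x ∈ K ∨ c⁻¹ * x ∈ K ∨ c * x ∈ K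
  have hcc : c * c = c⁻¹ := eq_inv_of_mul_eq_one_left h.pow_three
  have hcc' : c⁻¹ * c⁻¹ = c := by rw [← hcc, mul_assoc, ← mul_assoc c c c, h.pow_three, mul_one]
  have h1 : ∀ x, P x → P (c * x) := by
    rintro x (hx | hx | hx)
    · exact Or.inr (Or.inl (by rwa [inv_mul_cancel_left]))
    · exact Or.inr (Or.inr (by rwa [← mul_assoc, hcc]))
    · exact Or.inl hx
  have h2 : ∀ x, P x → P (c⁻¹ * x) := by
    rintro x (hx | hx | hx)
    · exact Or.inr (Or.inr (by rwa [mul_inv_cancel_left]))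
    · exact Or.inl hx
    · exact Or.inr (Or.inl (by rwa [← mul_assoc, hcc']))
  have h3 : ∀ n, ν n = c ∨ (ν n ∈ K ∧ ∀ x, P x → P (ν n * x)) := by
    intro n
    have hn := h.coset n
    generalize words n = p at hn
    obtain ⟨w, ⟨b, w'⟩, ⟨b', w''⟩⟩ := p
    rcases hn with hn | ⟨hn, hn', hn''⟩
    · exact Or.inl (Units.ext hn)
    · have hk : ν n ∈ K := mem_closure_of_wordProd w hn
      refine Or.inr ⟨hk, ?_⟩
      rintro x (hx | hx | hx)
      · exact Or.inl (mul_mem hk hx)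
      · cases b
        · have : c * ν n * c ∈ K := mem_closure_of_wordProd w' hn'
          refine Or.inr (Or.inr ?_)
          simpa [mul_assoc] using mul_mem this hx
        · have : c⁻¹ * ν n * c ∈ K := mem_closure_of_wordProd w' hn'
          refine Or.inr (Or.inl ?_)
          simpa [mul_assoc] using mul_mem this hx
      · cases b'
        · have : c⁻¹ * ν n * c⁻¹ ∈ K := mem_closure_of_wordProd w'' hn''
          refine Or.inr (Or.inl ?_)
          simpa [mul_assoc] using mul_mem this hx
        · have : c * ν n * c⁻¹ ∈ K := mem_closure_of_wordProd w'' hn''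
          refine Or.inr (Or.inr ?_)
          simpa [mul_assoc] using mul_mem this hx
  induction hx using Subgroup.closure_induction_left with
  | one => exact Or.inl (one_mem K)
  | mul_left y hy x _ ih =>
    obtain ⟨n, rfl⟩ := hy
    rcases h3 n with hn | ⟨-, hn⟩
    · rw [hn]
      exact h1 x ih
    · exact hn x ih
  | inv_mul_cancel y hy x _ ih =>
    obtain ⟨n, rfl⟩ := hy
    rcases h3 n with hn | ⟨hk, hn⟩
    · rw [hn]
      exact h2 x ih
    · have h4 := pow_four_of_mem_dihedralGroup (h.closure_le_dihedralGroup hk)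
      -- The inverse is a cube, so stability under the generator itself, used three times, is
      -- enough.
      have : (ν n)⁻¹ = ν n * (ν n * ν n) := by
        rw [inv_eq_iff_mul_eq_one, ← h4]
        simp only [_root_.pow_succ, pow_zero, one_mul, mul_assoc]
      rw [this, mul_assoc, mul_assoc]
      exact hn _ (hn _ (hn _ ih))

theorem finite (h : CosetCertificate ν γ c into words) :
    Finite (Subgroup.closure (Set.range ν)) := by
  have hK : (Subgroup.closure (Set.range γ) : Set (GL (Fin 3) ℤ)).Finite :=
    (Set.toFinite (Set.range ((↑) : dihedralGroup → GL (Fin 3) ℤ))).subset fun x hx =>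
      ⟨⟨x, h.closure_le_dihedralGroup hx⟩, rfl⟩
  refine Set.Finite.to_subtype ((hK.union ((hK.image (c * ·)).union (hK.image (c⁻¹ * ·)))).subset ?_)
  intro x hx
  rcases h.mem_coset hx with hx | hx | hx
  · exact Or.inl hx
  · exact Or.inr (Or.inl ⟨_, hx, mul_inv_cancel_left _ _⟩)
  · exact Or.inr (Or.inr ⟨_, hx, inv_mul_cancel_left _ _⟩)

/-- The subgroup generated by `γ` is a Sylow `2`-subgroup of the group generated by `ν`. -/
def sylow (h : CosetCertificate ν γ c into words) : Sylow 2 (Subgroup.closure (Set.range ν)) where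
  toSubgroup := (Subgroup.closure (Set.range γ)).subgroupOf _
  isPGroup' := by
    rintro ⟨x, hx⟩
    refine ⟨2, ?_⟩
    apply Subtype.ext
    apply Subtype.ext
    exact pow_four_of_mem_dihedralGroup (h.closure_le_dihedralGroup hx)
  is_maximal' := by
    intro Q hQ hKQ
    refine le_antisymm (fun x hx => ?_) hKQ
    -- A larger `2`-subgroup that met another coset would contain `c`. An element of a `2`-group
    -- with trivial cube is the identity, so nothing new appears.
    have hz : ∀ z ∈ Q, z * z * z = 1 → z = 1 := by
      intro z hz hz3
      obtain ⟨n, hn⟩ := hQ ⟨z, hz⟩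
      have hn' : z ^ 2 ^ n = 1 := congrArg Subtype.val hn
      have h3 : z ^ 3 = 1 := by rw [pow_succ, pow_two, hz3]
      refine orderOf_eq_one_iff.1 (Nat.eq_one_of_dvd_coprimes ?_ (orderOf_dvd_of_pow_eq_one hn')
        (orderOf_dvd_of_pow_eq_one h3))
      exact Nat.Coprime.pow_left n (by norm_num)
    have hQ' : ∀ k (hk : k ∈ Subgroup.closure (Set.range γ)), ⟨k, h.closure_le hk⟩ ∈ Q :=
      fun k hk => hKQ hk
    rcases h.mem_coset x.2 with hk | hk | hk
    · exact hk
    · have h1 := hz (x * ⟨_, h.closure_le hk⟩⁻¹) (mul_mem hx (inv_mem (hQ' _ hk))) (by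
        apply Subtype.ext
        simp [← mul_assoc, h.pow_three])
      rw [mul_inv_eq_one] at h1
      change (x : GL (Fin 3) ℤ) ∈ Subgroup.closure (Set.range γ)
      rw [h1]
      exact hk
    · have h1 := hz (⟨_, h.closure_le hk⟩ * x⁻¹) (mul_mem (hQ' _ hk) (inv_mem hx)) (by
        apply Subtype.ext
        simp [← mul_assoc, h.pow_three])
      rw [mul_inv_eq_one] at h1
      change (x : GL (Fin 3) ℤ) ∈ Subgroup.closure (Set.range γ)
      rw [← h1]
      exact hk

/-- Sylow subgroups are conjugate, so any `S` is obtained from the explicit one by conjugating with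
`v` and then with an element of `G`. -/
theorem exists_sylow_conj (h : CosetCertificate ν γ c into words) {G : Subgroup (GL (Fin 3) ℤ)}
    (hG : ∃ v, G = (Subgroup.closure (Set.range ν)).map (MulAut.conj v).toMonoidHom)
    (S : Sylow 2 G) : ∃ u : GL (Fin 3) ℤ, (S : Subgroup G).map G.subtype =
      (Subgroup.closure (Set.range γ)).map (MulAut.conj u).toMonoidHom := by
  obtain ⟨v, rfl⟩ := hG
  have := h.finite
  let e := (MulAut.conj v).toMonoidHom.subgroupMap (Subgroup.closure (Set.range ν))
  have he : Function.Surjective e := MonoidHom.subgroupMap_surjective _ _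
  have hfin : Finite ((Subgroup.closure (Set.range ν)).map (MulAut.conj v).toMonoidHom) :=
    Finite.of_surjective e he
  obtain ⟨g, hg⟩ := MulAction.exists_smul_eq
    ((Subgroup.closure (Set.range ν)).map (MulAut.conj v).toMonoidHom) (h.sylow.mapSurjective he) S
  refine ⟨g * v, ?_⟩
  have hS : (S : Subgroup _) = (h.sylow.toSubgroup.map e).map (MulAut.conj g).toMonoidHom := by
    rw [← hg]
    rfl
  have hK : (Subgroup.closure (Set.range γ)) = h.sylow.toSubgroup.map (Subgroup.subtype _) := by
    rw [sylow, Subgroup.subgroupOf_map_subtype, inf_eq_left.2 h.closure_le]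
  rw [hS, hK, Subgroup.map_map, Subgroup.map_map, Subgroup.map_map]
  congr 1
  ext1 x
  change (g : GL (Fin 3) ℤ) * (v * x * v⁻¹) * (g : GL (Fin 3) ℤ)⁻¹ = g * v * x * (g * v)⁻¹
  simp [mul_assoc]

end CosetCertificate

end N3

end SylowCertificates

/-! ### Assembly of the fifteen cases. -/

namespace N3

/-- The matrix `c` transformed by the change of basis that takes `a₁` to `alpha`. -/
def chi : GL (Fin 3) ℤ :=
  ⟨!![0, 1, -1; -1, 0, 0; -1, 1, 0], !![0, -1, 0; 0, -1, 1; -1, -1, 1], by decide, by decide⟩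

/-- The matrix `w` in the basis in which the matrices of `b₁`, `b₂`, `r` are given. -/
def omega : GL (Fin 3) ℤ :=
  ⟨!![0, 1, -1; 0, 1, 0; -1, 1, 0], !![0, 1, -1; 0, 1, 0; -1, 1, 0], by decide, by decide⟩

/-- The change of basis from `a₁`, `a₂`, `c`, `q`, `w` to `alpha`, `b₂`, `chi`, `kappa`, `omega`. -/
def basisChange : GL (Fin 3) ℤ :=
  ⟨!![-1, 0, 0; 0, 0, 1; 0, 1, 1], !![-1, 0, 0; 0, -1, 1; 0, 1, 0], by decide, by decide⟩

/-- `ExpansionCertificate.two_part` for a group whose Sylow `2`-subgroup is identified by a coset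
certificate, up to a change of basis. -/
theorem two_part_of_cosetCertificate {s t r m : ℕ} {ns ν : Fin s → GL (Fin 3) ℤ}
    {γ : Fin t → GL (Fin 3) ℤ} {c : GL (Fin 3) ℤ} {into : Fin t → List (Fin s)}
    {words : Fin s → List (Fin t) × (Bool × List (Fin t)) × (Bool × List (Fin t))}
    (u : GL (Fin 3) ℤ) (hconj : ∀ k, (ns k).1 * u.1 = u.1 * (ν k).1)
    (hc : CosetCertificate ν γ c into words)
    {W : Matrix (Fin r) (Fin 3) ℤ} {σ : Fin t → Fin 3 ⊕ Fin r → Fin 3 ⊕ Fin r}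
    {coeff : (Fin 3 → ℤ) → Fin 3 ⊕ Fin r → ℤ} (hexp : ExpansionCertificate γ W σ coeff)
    {orbit : Fin r → Fin (m + 1)} {rep : Fin (m + 1) → Fin r}
    {cert : Fin (m + 1) → Fin (m + 1) → List (Fin t × Fin r × Fin r)}
    (htop : LocalTopCertificate (fun g => cokernelMatrix W (σ g)) orbit rep cert)
    (hodd : Odd r) (hne : r ≠ 1) {N G : Subgroup (GL (Fin 3) ℤ)}
    (hN : N = Subgroup.closure (Set.range ns))
    (hG : ∃ v : GL (Fin 3) ℤ, G = N.map (MulAut.conj v).toMonoidHom) (S : Sylow 2 G) :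
    HasFaithfulIndecomposableTwoPart (latticeRep G) S r := by
  obtain ⟨v, hv⟩ := hG
  have hns : ns = MulAut.conj u ∘ ν := funext fun k => by
    rw [Function.comp_apply, MulAut.conj_apply, eq_mul_inv_iff_mul_eq]
    exact Units.ext (hconj k)
  have hG : G = (Subgroup.closure (Set.range ν)).map (MulAut.conj (v * u)).toMonoidHom := by
    rw [hv, hN, hns, Set.range_comp, map_mul]
    exact (congrArg _ (MonoidHom.map_closure (MulAut.conj u).toMonoidHom (Set.range ν)).symm).trans
      (Subgroup.map_map _ _ _)
  have := hc.finite
  have : Finite G := by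
    rw [hG]
    exact Finite.of_surjective _ (MonoidHom.subgroupMap_surjective _ _)
  exact hexp.two_part htop hodd hne G S (hc.exists_sylow_conj ⟨_, hG⟩ S)

/-- The `klein` data serve `N_{3,1}` and `N_{3,8}`; `kleinNeg` serves `N_{3,2}` and `N_{3,9}`;
`boxNeg` serves `N_{3,3}` and `N_{3,10}`; `cyclicNeg` serves `N_{3,4}`; `dihedral` serves `N_{3,5}`,
`N_{3,11}` and `N_{3,12}`; `dihedralNeg` serves `N_{3,6}` and `N_{3,13}`; `dihedralFull` serves
`N_{3,7}`, `N_{3,14}` and `N_{3,15}`. -/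
theorem two_part_group (i : Fin 15) (G : Subgroup (GL (Fin 3) ℤ))
    (hG : ∃ t : GL (Fin 3) ℤ, G = (N3.group i).map (MulAut.conj t).toMonoidHom) (S : Sylow 2 G) :
    HasFaithfulIndecomposableTwoPart (latticeRep G) S (N3.rank i) := by
  fin_cases i
  -- The first seven groups are `2`-groups, so `c = 1` and all three cosets coincide with the whole
  -- group.
  · exact two_part_of_cosetCertificate (c := 1) (into := ![[0], [1]])
      (words := ![([0], (true, [0]), (true, [0])),
        ([1], (true, [1]), (true, [1]))])
      (ns := ![a₁, a₂]) (ν := ![alpha, b₂]) basisChange⁻¹ (by decide +kernel)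
      ⟨by decide +kernel, by decide +kernel, by decide +kernel, by decide +kernel⟩
      klein_expansion klein_localTop (by decide) (by decide)
      (congrArg Subgroup.closure (by ext x; simp; tauto)) hG S
  · exact two_part_of_cosetCertificate (c := 1) (into := ![[0], [1], [2]])
      (words := ![([0], (true, [0]), (true, [0])),
        ([1], (true, [1]), (true, [1])),
        ([2], (true, [2]), (true, [2]))])
      (ns := ![a₁, a₂, -1]) (ν := ![alpha, b₂, -1]) basisChange⁻¹ (by decide +kernel)
      ⟨by decide +kernel, by decide +kernel, by decide +kernel, by decide +kernel⟩
      kleinNeg_expansion kleinNeg_localTop (by decide) (by decide)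
      (congrArg Subgroup.closure (by ext x; simp; tauto)) hG S
  · exact two_part_of_cosetCertificate (c := 1) (into := ![[0], [1], [2]])
      (words := ![([0], (true, [0]), (true, [0])),
        ([1], (true, [1]), (true, [1])),
        ([2], (true, [2]), (true, [2]))])
      (ns := ![b₁, b₂, -1]) (ν := ![b₁, b₂, -1]) 1 (by decide +kernel)
      ⟨by decide +kernel, by decide +kernel, by decide +kernel, by decide +kernel⟩
      boxNeg_expansion boxNeg_localTop (by decide) (by decide)
      (congrArg Subgroup.closure (by ext x; simp; tauto)) hG S
  · exact two_part_of_cosetCertificate (c := 1) (into := ![[0], [1], [0, 0]])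
      (words := ![([0], (true, [0]), (true, [0])),
        ([1], (true, [1]), (true, [1]))])
      (ns := ![q, -1]) (ν := ![kappa, -1]) basisChange⁻¹ (by decide +kernel)
      ⟨by decide +kernel, by decide +kernel, by decide +kernel, by decide +kernel⟩
      cyclicNeg_expansion cyclicNeg_localTop (by decide) (by decide)
      (congrArg Subgroup.closure (by ext x; simp; tauto)) hG S
  · exact two_part_of_cosetCertificate (c := 1) (into := ![[0], [1], [0, 0]])
      (words := ![([0], (true, [0]), (true, [0])),
        ([1], (true, [1]), (true, [1]))])
      (ns := ![q, a₁]) (ν := ![kappa, alpha]) basisChange⁻¹ (by decide +kernel)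
      ⟨by decide +kernel, by decide +kernel, by decide +kernel, by decide +kernel⟩
      dihedral_expansion dihedral_localTop (by decide) (by decide)
      (congrArg Subgroup.closure (by ext x; simp; tauto)) hG S
  · exact two_part_of_cosetCertificate (c := 1) (into := ![[0], [1], [0, 0]])
      (words := ![([0], (true, [0]), (true, [0])),
        ([1], (true, [1]), (true, [1]))])
      (ns := ![-q, a₁]) (ν := ![-kappa, alpha]) basisChange⁻¹ (by decide +kernel)
      ⟨by decide +kernel, by decide +kernel, by decide +kernel, by decide +kernel⟩
      dihedralNeg_expansion dihedralNeg_localTop (by decide) (by decide)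
      (congrArg Subgroup.closure (by ext x; simp; tauto)) hG S
  · exact two_part_of_cosetCertificate (c := 1) (into := ![[0], [1], [2], [0, 0]])
      (words := ![([0], (true, [0]), (true, [0])),
        ([1], (true, [1]), (true, [1])),
        ([2], (true, [2]), (true, [2]))])
      (ns := ![q, a₁, -1]) (ν := ![kappa, alpha, -1]) basisChange⁻¹ (by decide +kernel)
      ⟨by decide +kernel, by decide +kernel, by decide +kernel, by decide +kernel⟩
      dihedralFull_expansion dihedralFull_localTop (by decide) (by decide)
      (congrArg Subgroup.closure (by ext x; simp; tauto)) hG S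
  -- The element `chi` of order three does not act by signed permutations of the four coordinates.
  -- This is harmless, since only the Sylow subgroup has to preserve the family. The empty words are
  -- placeholders for the generator that equals `c`.
  · exact two_part_of_cosetCertificate (c := chi) (into := ![[0], [1]])
      (words := ![([0], (true, [0, 1]), (true, [1])),
        ([1], (true, [0]), (true, [0, 1])),
        ([], (true, []), (true, []))])
      (ns := ![a₁, a₂, c]) (ν := ![alpha, b₂, chi]) basisChange⁻¹ (by decide +kernel)
      ⟨by decide +kernel, by decide +kernel, by decide +kernel, by decide +kernel⟩
      klein_expansion klein_localTop (by decide) (by decide)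
      (congrArg Subgroup.closure (by ext x; simp; tauto)) hG S
  · exact two_part_of_cosetCertificate (c := chi) (into := ![[0], [1], [3]])
      (words := ![([0], (true, [0, 1]), (true, [1])),
        ([1], (true, [0]), (true, [0, 1])),
        ([], (true, []), (true, [])),
        ([2], (true, [2]), (true, [2]))])
      (ns := ![a₁, a₂, c, -1]) (ν := ![alpha, b₂, chi, -1]) basisChange⁻¹ (by decide +kernel)
      ⟨by decide +kernel, by decide +kernel, by decide +kernel, by decide +kernel⟩
      kleinNeg_expansion kleinNeg_localTop (by decide) (by decide)
      (congrArg Subgroup.closure (by ext x; simp; tauto)) hG S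
  · exact two_part_of_cosetCertificate (c := c) (into := ![[0], [1], [3]])
      (words := ![([0], (true, [0, 1]), (true, [1])),
        ([1], (true, [0]), (true, [0, 1])),
        ([], (true, []), (true, [])),
        ([2], (true, [2]), (true, [2]))])
      (ns := ![b₁, b₂, c, -1]) (ν := ![b₁, b₂, c, -1]) 1 (by decide +kernel)
      ⟨by decide +kernel, by decide +kernel, by decide +kernel, by decide +kernel⟩
      boxNeg_expansion boxNeg_localTop (by decide) (by decide)
      (congrArg Subgroup.closure (by ext x; simp; tauto)) hG S
  · exact two_part_of_cosetCertificate (c := chi) (into := ![[3], [0], [1]])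
      (words := ![([1], (true, [1, 2]), (true, [2])),
        ([2], (true, [1]), (true, [1, 2])),
        ([], (true, []), (true, [])),
        ([0], (false, [0, 2]), (false, [1, 0]))])
      (ns := ![a₁, a₂, c, q]) (ν := ![alpha, b₂, chi, kappa]) basisChange⁻¹ (by decide +kernel)
      ⟨by decide +kernel, by decide +kernel, by decide +kernel, by decide +kernel⟩
      dihedral_expansion dihedral_localTop (by decide) (by decide)
      (congrArg Subgroup.closure (by ext x; simp; tauto)) hG S
  -- Here `kappa` and `alpha` are the products `b₂ * r` and `b₁ * r`. Hence this group has the same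
  -- Sylow subgroup as the preceding transformed one, although its element of order three is
  -- different.
  · exact two_part_of_cosetCertificate (c := c) (into := ![[1, 3], [0, 3], [1]])
      (words := ![([1, 0], (true, [0, 1]), (true, [2])),
        ([2], (true, [1, 0]), (true, [0, 1])),
        ([], (true, []), (true, [])),
        ([0, 2], (false, [0]), (false, [1]))])
      (ns := ![b₁, b₂, c, r]) (ν := ![b₁, b₂, c, r]) 1 (by decide +kernel)
      ⟨by decide +kernel, by decide +kernel, by decide +kernel, by decide +kernel⟩
      dihedral_expansion dihedral_localTop (by decide) (by decide)
      (congrArg Subgroup.closure (by ext x; simp; tauto)) hG S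
  · exact two_part_of_cosetCertificate (c := chi) (into := ![[3, 0], [0], [1]])
      (words := ![([1], (true, [1, 2]), (true, [2])),
        ([2], (true, [1]), (true, [1, 2])),
        ([], (true, []), (true, [])),
        ([0, 1], (false, [0, 1]), (false, [0, 1]))])
      (ns := ![a₁, a₂, c, w]) (ν := ![alpha, b₂, chi, omega]) basisChange⁻¹ (by decide +kernel)
      ⟨by decide +kernel, by decide +kernel, by decide +kernel, by decide +kernel⟩
      dihedralNeg_expansion dihedralNeg_localTop (by decide) (by decide)
      (congrArg Subgroup.closure (by ext x; simp; tauto)) hG S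
  · exact two_part_of_cosetCertificate (c := chi) (into := ![[3], [0], [4], [1]])
      (words := ![([1], (true, [1, 3]), (true, [3])),
        ([3], (true, [1]), (true, [1, 3])),
        ([], (true, []), (true, [])),
        ([0], (false, [0, 3]), (false, [1, 0])),
        ([2], (true, [2]), (true, [2]))])
      (ns := ![a₁, a₂, c, q, -1]) (ν := ![alpha, b₂, chi, kappa,
      -1]) basisChange⁻¹ (by decide +kernel)
      ⟨by decide +kernel, by decide +kernel, by decide +kernel, by decide +kernel⟩
      dihedralFull_expansion dihedralFull_localTop (by decide) (by decide)
      (congrArg Subgroup.closure (by ext x; simp; tauto)) hG S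
  · exact two_part_of_cosetCertificate (c := c) (into := ![[1, 3], [0, 3], [4], [1]])
      (words := ![([1, 0], (true, [0, 1]), (true, [3])),
        ([3], (true, [1, 0]), (true, [0, 1])),
        ([], (true, []), (true, [])),
        ([0, 3], (false, [0]), (false, [1])),
        ([2], (true, [2]), (true, [2]))])
      (ns := ![b₁, b₂, c, r, -1]) (ν := ![b₁, b₂, c, r, -1]) 1 (by decide +kernel)
      ⟨by decide +kernel, by decide +kernel, by decide +kernel, by decide +kernel⟩
      dihedralFull_expansion dihedralFull_localTop (by decide) (by decide)
      (congrArg Subgroup.closure (by ext x; simp; tauto)) hG S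

end N3

theorem theorem7p12 (i : Fin 15) (G : Subgroup (GL (Fin 3) ℤ))
    (hG : ∃ t : GL (Fin 3) ℤ, G = (N3.group i).map (MulAut.conj t).toMonoidHom)
    (S : Sylow 2 G) :
    -- flabby resolutions of `M_G` exist, and each of them yields a `2`-part
    Nonempty (FlabbyResolution (latticeRep G)) ∧
    (∀ E : FlabbyResolution (latticeRep G),
      ∃ (N : Type) (_ : AddCommGroup N) (_ : Module ℤ_[2] N) (τ : Representation ℤ_[2] S N),
        IsPPart 2 E S τ) ∧
    -- the `2`-part is unique up to isomorphism and independent of the resolution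
    (∀ (E E' : FlabbyResolution (latticeRep G))
      (N : Type) [AddCommGroup N] [Module ℤ_[2] N] (τ : Representation ℤ_[2] S N)
      (N' : Type) [AddCommGroup N'] [Module ℤ_[2] N'] (τ' : Representation ℤ_[2] S N'),
      IsPPart 2 E S τ → IsPPart 2 E' S τ' → Nonempty (Representation.Equiv τ τ')) ∧
    -- the `2`-part is a faithful indecomposable lattice of the given rank
    (∀ (E : FlabbyResolution (latticeRep G))
      (N : Type) [AddCommGroup N] [Module ℤ_[2] N] (τ : Representation ℤ_[2] S N),
      IsPPart 2 E S τ →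
        IsLatticeRep τ ∧ Function.Injective τ ∧ IsIndecomposableRep τ ∧
          Module.finrank ℤ_[2] N = N3.rank i) := by
  exact N3.two_part_group i G hG S
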